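/- Let $n\ge 0$, let $G_2\mathbb{R}^{2n+2}$ be the Grassmann manifold of oriented $2$-planes through the origin of $\mathbb{R}^{2n+2}$, and identify an oriented great circle of the unit sphere $S^{2n+1}$ with the oriented $2$-plane that it spans. A smooth fibration $F$ of $S^{2n+1}$ by oriented great circles is a partition of $S^{2n+1}$ into oriented great circles that is a smooth oriented circle bundle: every fibre has an open neighbourhood $U$ that is a union of fibres, with a diffeomorphism $U\to V\times S^1$, $V\subset\mathbb{R}^{2n}$ open, taking the fibres in $U$, with their orientations, to the circles $\{v\}\times S^1$. Its base space $M_F\subset G_2\mathbb{R}^{2n+2}$ is the set of its fibres. A Hopf fibration consists of the unit circles in the $J$-complex lines, oriented by $J$, for some orthogonal complex structure $J$ on $\mathbb{R}^{2n+2}$ (an orthogonal linear map with $J^2=-I$). Fix an oriented great circle $P$ in $S^{2n+1}$. For every smooth fibration $F$ of $S^{2n+1}$ by oriented great circles that contains $P$, the vectors tangent to $M_F$ at $P$ form a $2n$-dimensional linear subspace $T_PM_F$ of $T_P(G_2\mathbb{R}^{2n+2})=\mathrm{Hom}(P,P^\perp)$, and every Hopf fibration is such a smooth fibration. The space $$\{T_PM_F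 : F \text{ a smooth fibration of } S^{2n+1} \text{ by oriented great circles containing } P\},$$ topologized as a subspace of the Grassmannian of $2n$-dimensional linear subspaces of $T_P(G_2\mathbb{R}^{2n+2})$, deformation retracts (with the points of the subspace fixed at all times) onto its subspace $$\{T_PM_H : H \text{ a Hopf fibration of } S^{2n+1} \text{ containing } P\}.$$ -/

import Mathlib

open scoped Manifold ContDiff

/-! ### Grassmannians and deformation retractions -/

/-- The Grassmannian of `k`-dimensional linear subspaces of the real vector space `V`. -/
def Gr (k : ℕ) (V : Type*) [AddCommGroup V] [Module ℝ V] : Type _ :=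
  {T : Submodule ℝ V // Module.finrank ℝ T = k}

/-- The subspace spanned by a linearly independent `k`-frame. -/
def frameSpan (k : ℕ) (V : Type*) [AddCommGroup V] [Module ℝ V]
    (v : {v : Fin k → V // LinearIndependent ℝ v}) : Gr k V :=
  ⟨Submodule.span ℝ (Set.range v.1), by
    simpa using finrank_span_eq_card v.2⟩

/-- The usual topology of the Grassmannian: the quotient topology from the space of linearly
independent `k`-frames. -/
instance Gr.instTopologicalSpace (k : ℕ) (V : Type*) [AddCommGroup V] [Module ℝ V]
    [TopologicalSpace V] : TopologicalSpace (Gr k V) :=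
  TopologicalSpace.coinduced (frameSpan k V) inferInstance

/-- `A` is contained in `S`, and the subspace `S` of `X` deformation retracts to `A`: there is a
homotopy of maps `S → S`, from the identity to a map with values in `A`, that keeps every point
of `A` fixed at all times. -/
def DeformationRetractsTo {X : Type*} [TopologicalSpace X] (S A : Set X) : Prop :=
  A ⊆ S ∧ ∃ H : C(unitInterval × S, S),
    (∀ x : S, H (0, x) = x) ∧
    (∀ x : S, (H (1, x) : X) ∈ A) ∧
    (∀ (t : unitInterval) (x : S), (x : X) ∈ A → H (t, x) = x)

/-! ### Oriented great circles -/

/-- The ambient Euclidean space `ℝ²ⁿ⁺²`. -/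
abbrev Amb (n : ℕ) : Type := EuclideanSpace ℝ (Fin (2 * n + 2))

instance Amb.instFactFinrank (n : ℕ) : Fact (Module.finrank ℝ (Amb n) = (2 * n + 1) + 1) :=
  ⟨by simp⟩

/-- The unit sphere `S²ⁿ⁺¹`, with the smooth structure given by Mathlib. -/
abbrev Sph (n : ℕ) : Type := Metric.sphere (0 : Amb n) 1

/-- A point of the Grassmannian of oriented 2-planes through the origin of `ℝ²ⁿ⁺²`; equivalently,
an oriented great circle of `S²ⁿ⁺¹`. -/
structure OrientedPlane (n : ℕ) where
  /-- the underlying plane -/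
  plane : Submodule ℝ (Amb n)
  finrank_plane : Module.finrank ℝ plane = 2
  /-- its orientation -/
  orient : Orientation ℝ plane (Fin 2)

namespace OrientedPlane

variable {n : ℕ}

/-- The great circle cut out by the plane. -/
def circle (P : OrientedPlane n) : Set (Sph n) := {x | (x : Amb n) ∈ P.plane}

/-- The rotation of an oriented plane through a right angle in the positive direction; at a point
`x` of the great circle, `P.rot x` is the positive unit tangent vector of the circle. -/
noncomputable def rot (P : OrientedPlane n) : P.plane ≃ₗᵢ[ℝ] P.plane :=
  haveI : Fact (Module.finrank ℝ P.plane = 2) := ⟨P.finrank_plane⟩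
  P.orient.rightAngleRotation

/-- The space `Hom(P, P^⊥)`: the model of the coordinate neighbourhood of `P` in the Grassmannian
(see `graph`), and therefore also the tangent space to the Grassmannian at `P`. -/
abbrev HomPerp (P : OrientedPlane n) : Type := P.plane →L[ℝ] (P.plane)ᗮ

/-- The map `x ↦ x + L x` from `P` to `ℝ²ⁿ⁺²`. -/
noncomputable def graphMap (P : OrientedPlane n) (L : P.HomPerp) : P.plane →ₗ[ℝ] Amb n :=
  P.plane.subtype + (P.plane)ᗮ.subtype ∘ₗ (L : P.plane →ₗ[ℝ] (P.plane)ᗮ)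

theorem graphMap_injective (P : OrientedPlane n) (L : P.HomPerp) :
    Function.Injective (P.graphMap L) := by
  rw [injective_iff_map_eq_zero]
  intro x hx
  have h1 : (x : Amb n) + (L x : Amb n) = 0 := by simpa [graphMap] using hx
  have h2 : inner ℝ (x : Amb n) (L x : Amb n) = 0 :=
    Submodule.inner_right_of_mem_orthogonal x.2 (L x).2
  have h3 : inner ℝ (x : Amb n) ((x : Amb n) + (L x : Amb n)) = 0 := by rw [h1, inner_zero_right]
  rw [inner_add_right, h2, add_zero, inner_self_eq_zero] at h3
  exact_mod_cast h3

/-- The parametrization `L ↦ graph of L` of the coordinate neighbourhood `N(P)` of `P`, which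
consists of the oriented planes whose orthogonal projection to `P` is an orientation-preserving
isomorphism. The graph is oriented through its orthogonal projection to `P`, which is the inverse
of `x ↦ x + L x`. -/
noncomputable def graph (P : OrientedPlane n) (L : P.HomPerp) : OrientedPlane n where
  plane := LinearMap.range (P.graphMap L)
  finrank_plane := by
    rw [LinearMap.finrank_range_of_inj (P.graphMap_injective L), P.finrank_plane]
  orient := Orientation.map (Fin 2)
    (LinearEquiv.ofInjective (P.graphMap L) (P.graphMap_injective L)) P.orient

/-- The tangent vectors at `P` to a set `M` of oriented planes, as elements of `Hom(P, P^⊥)`: the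
velocities at time `0` of the smooth curves in `M` that pass through `P` at time `0`, computed in
the chart around `P`. -/
def tangentVectors (P : OrientedPlane n) (M : Set (OrientedPlane n)) : Set P.HomPerp :=
  {A | ∃ ε > (0 : ℝ), ∃ γ : ℝ → P.HomPerp, ContDiffOn ℝ ∞ γ (Set.Ioo (-ε) ε) ∧ γ 0 = 0 ∧
    (∀ t ∈ Set.Ioo (-ε) ε, P.graph (γ t) ∈ M) ∧ HasDerivAt γ A 0}

end OrientedPlane

/-! ### Fibrations by oriented great circles -/

/-- Two points of the sphere lie on a common circle of the family `M`. -/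
def SameFibre {n : ℕ} (M : Set (OrientedPlane n)) (x y : Sph n) : Prop :=
  ∃ Q ∈ M, x ∈ Q.circle ∧ y ∈ Q.circle

/-- A smooth trivialization of the family `M` of oriented great circles: a diffeomorphism `Φ` from
an open subset of the sphere onto `V × S¹`, with `V` open in `ℝ²ⁿ`, whose domain is a union of
circles of the family, which takes these circles to the circles `{v} × S¹`, and which preserves
orientations. -/
structure IsSmoothTrivialization {n : ℕ} (M : Set (OrientedPlane n))
    (Φ : OpenPartialHomeomorph (Sph n) (EuclideanSpace ℝ (Fin (2 * n)) × Circle)) : Prop where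
  target_eq : ∃ V : Set (EuclideanSpace ℝ (Fin (2 * n))), Φ.target = V ×ˢ Set.univ
  smooth : ContMDiffOn (𝓡 (2 * n + 1)) ((𝓡 (2 * n)).prod (𝓡 1)) ∞ Φ Φ.source
  smooth_symm : ContMDiffOn ((𝓡 (2 * n)).prod (𝓡 1)) (𝓡 (2 * n + 1)) ∞ Φ.symm Φ.target
  fibres : ∀ x ∈ Φ.source, ∀ y : Sph n,
    SameFibre M x y ↔ y ∈ Φ.source ∧ (Φ y).1 = (Φ x).1
  oriented : ∀ Q ∈ M, ∀ x : Q.plane, ∀ hx : (x : Amb n) ∈ Metric.sphere (0 : Amb n) 1,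
    (⟨x, hx⟩ : Sph n) ∈ Φ.source →
    0 < inner ℝ (Q.rot x : Amb n)
      (deriv (fun t : ℝ => (Φ.symm ((Φ ⟨x, hx⟩).1, (Φ ⟨x, hx⟩).2 * Circle.exp t) : Amb n)) 0)

/-- `M` is (the set of fibres of) a smooth fibration of `S²ⁿ⁺¹` by oriented great circles: the
circles partition the sphere, and they form a smooth oriented circle bundle. A fibration is
identified with its set of fibres, so that `M`, as a set of points of the Grassmannian of oriented
planes, is also the base space of the fibration. -/
structure IsGreatCircleFibration {n : ℕ} (M : Set (OrientedPlane n)) : Prop where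
  partition : ∀ x : Sph n, ∃! Q : OrientedPlane n, Q ∈ M ∧ x ∈ Q.circle
  locallyTrivial : ∀ Q ∈ M, ∃ Φ, IsSmoothTrivialization M Φ ∧ Q.circle ⊆ Φ.source

/-- `M` is (the set of fibres of) a Hopf fibration: for some orthogonal complex structure `J` of
`ℝ²ⁿ⁺²`, it consists of the unit circles of the `J`-complex lines, oriented by `J`. -/
def IsHopfFibration {n : ℕ} (M : Set (OrientedPlane n)) : Prop :=
  ∃ J : Amb n ≃ₗᵢ[ℝ] Amb n, (∀ x, J (J x) = -x) ∧
    M = {Q | ∀ x : Q.plane, (Q.rot x : Amb n) = J x}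

/-- The space of tangent `2n`-planes at `P` to the base spaces of the smooth fibrations of
`S²ⁿ⁺¹` by oriented great circles that contain `P`. -/
def fibrationTangentPlanes {n : ℕ} (P : OrientedPlane n) : Set (Gr (2 * n) P.HomPerp) :=
  {T | ∃ M : Set (OrientedPlane n), IsGreatCircleFibration M ∧ P ∈ M ∧
    (T.1 : Set P.HomPerp) = P.tangentVectors M}

/-- The space of tangent `2n`-planes at `P` to the base spaces of the Hopf fibrations of
`S²ⁿ⁺¹` that contain `P`. -/
def hopfTangentPlanes {n : ℕ} (P : OrientedPlane n) : Set (Gr (2 * n) P.HomPerp) :=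
  {T | ∃ M : Set (OrientedPlane n), IsHopfFibration M ∧ P ∈ M ∧
    (T.1 : Set P.HomPerp) = P.tangentVectors M}

/-!
Fix a unit vector `e` of `P`. A linear map `A : P → Pᗮ` is the pair `(A e, A (P.rot e))`, so that
`Hom(P, Pᗮ)` is `Pᗮ × Pᗮ`, and the `2n`-planes in it that meet `0 × Pᗮ` trivially are the graphs of
the endomorphisms `φ` of `Pᗮ`. These form an open subset of the Grassmannian, homeomorphic to
`End(Pᗮ)` (`Gr.isOpenEmbedding_ofSlope`). In this chart, the tangent planes of smooth fibrations
are exactly the `φ` without real eigenvalues (`OrientedPlane.fibrationTangentPlanes_eq`), and those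
of Hopf fibrations are the orthogonal complex structures (`OrientedPlane.hopfTangentPlanes_eq`).

A tangent plane is of this kind because a fibre is determined by any one of its points: for each
`u ≠ 0` in `P`, the map `L ↦ u + L u` restricts to an immersion of the base near `P`, so no nonzero
tangent vector `A` kills `u` (`OrientedPlane.exists_tangentSpace`). With `A = (y, φ y)` and
`u = P.rot e - c e`, this says that `φ y = c y` only for `y = 0`.

Conversely, let `φ` have no real eigenvalue. Then some skew-adjoint `W` tames it, which means that
`⟪φ v, W v⟫ > 0` for `v ≠ 0` (`NoRealEigenvalue.exists_tames`, by induction on the dimension). The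
orthogonal factor `U` of the polar decomposition of `W` is a complex structure tamed by `W` as well.
Interpolate between `φ` near the origin and `U` far away by a cutoff that depends so slowly on the
logarithm of the radius that the resulting map `f` is still tamed, in the sense that
`⟪f y - f z, W (y - z)⟫ ≥ c ‖y - z‖²` (`Tames.exists_isTamedMap`). Then `y ↦ a y + b f(y)` is a
diffeomorphism of `Pᗮ` for all `(a, b) ≠ 0`, so the planes spanned by `e + y` and `P.rot e + f y`
fibre the complement of `Pᗮ` in the sphere; since `f` is `U` far away, the `U`-complex lines in `Pᗮ`
complete this family to a smooth fibration (`OrientedPlane.exists_isGreatCircleFibration`).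

For the deformation retraction, the conditions on `W` are convex, so a partition of unity gives a
taming map `W` that depends continuously on `φ`, and that equals `φ` if `φ` is an orthogonal complex
structure. Let `r φ` be the orthogonal factor of `W`. As the same `W` tames `φ` and `r φ`, it tames
the segment between them, which is therefore free of real eigenvalues
(`exists_orthComplex_retraction`); the segments form the homotopy.
-/

/-! ### Endomorphisms without real eigenvalues and the skew maps taming them -/

section Taming

variable {E : Type*} [NormedAddCommGroup E] [InnerProductSpace ℝ E]

/-- `φ` has no real eigenvalue. -/
def NoRealEigenvalue (φ : E →L[ℝ] E) : Prop := ∀ (c : ℝ) (v : E), φ v = c • v → v = 0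

/-- `W` is skew-adjoint. -/
def IsSkew (W : E →L[ℝ] E) : Prop := ∀ v, inner ℝ (W v) v = 0

/-- The skew-adjoint map `W` tames `φ`: the alternating form `(v, w) ↦ ⟪w, W v⟫` is positive on
`(v, φ v)` for all `v ≠ 0`. -/
def Tames (W φ : E →L[ℝ] E) : Prop := IsSkew W ∧ ∀ v, v ≠ 0 → 0 < inner ℝ (φ v) (W v)

/-- `U` is an orthogonal complex structure; orthogonality is encoded as skew-adjointness, which
is equivalent for maps of square `-1`. -/
def IsOrthComplex (U : E →L[ℝ] E) : Prop := IsSkew U ∧ ∀ v, U (U v) = -v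

theorem IsSkew.inner_left {W : E →L[ℝ] E} (h : IsSkew W) (v w : E) :
    inner ℝ (W v) w = -inner ℝ v (W w) := by
  have h1 := h (v + w)
  simp only [map_add, inner_add_left, inner_add_right, h v, h w] at h1
  rw [real_inner_comm (W w) v]
  linarith

theorem IsOrthComplex.inner_map {U : E →L[ℝ] E} (h : IsOrthComplex U) (v w : E) :
    inner ℝ (U v) (U w) = inner ℝ v w := by
  rw [h.1.inner_left, h.2, inner_neg_right, neg_neg]

theorem IsOrthComplex.norm_map {U : E →L[ℝ] E} (h : IsOrthComplex U) (v : E) : ‖U v‖ = ‖v‖ := by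
  rw [norm_eq_sqrt_real_inner, h.inner_map, ← norm_eq_sqrt_real_inner]

theorem IsOrthComplex.tames {U : E →L[ℝ] E} (h : IsOrthComplex U) : Tames U U :=
  ⟨h.1, fun v hv => by rw [h.inner_map]; exact real_inner_self_pos.2 hv⟩

theorem Tames.noRealEigenvalue {W φ : E →L[ℝ] E} (h : Tames W φ) : NoRealEigenvalue φ := by
  intro c v hv
  by_contra hne
  have := h.2 v hne
  rw [hv, inner_smul_left, real_inner_comm, h.1 v] at this
  simp at this

/-- The maps tamed by a given `W` form a convex cone. -/
theorem Tames.segment {W φ ψ : E →L[ℝ] E} (h : Tames W φ) (h' : Tames W ψ) {t : ℝ}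
    (h0 : 0 ≤ t) (h1 : t ≤ 1) : Tames W ((1 - t) • φ + t • ψ) := by
  refine ⟨h.1, fun v hv => ?_⟩
  have a := h.2 v hv
  have b := h'.2 v hv
  simp only [add_apply, smul_apply, inner_add_left,
    inner_smul_left, conj_trivial]
  rcases h0.eq_or_lt with rfl | h0
  · simpa using a
  · have := mul_nonneg (sub_nonneg.2 h1) a.le
    have := mul_pos h0 b
    linarith

/-- In an oriented plane, the vectors `y` with `ω(x, y) = 0` are the multiples of `x ≠ 0`. -/
theorem exists_smul_of_areaForm_eq_zero [Fact (Module.finrank ℝ E = 2)]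
    (o : Orientation ℝ E (Fin 2)) {x y : E} (hx : x ≠ 0) (h : o.areaForm x y = 0) :
    ∃ c : ℝ, y = c • x := by
  have hn : ‖x‖ ^ 2 ≠ 0 := by simpa using hx
  refine ⟨inner ℝ x y / ‖x‖ ^ 2, ?_⟩
  refine ext_inner_right ℝ fun z => ?_
  have := o.inner_mul_areaForm_sub x y (o.rightAngleRotation z)
  have h2 := o.inner_mul_inner_add_areaForm_mul_areaForm x y z
  rw [h, zero_mul, add_zero] at h2
  rw [inner_smul_left, conj_trivial, div_mul_eq_mul_div, eq_div_iff hn, h2]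
  ring

variable [FiniteDimensional ℝ E]

/-- A positive definite quadratic form on a finite-dimensional space is coercive. -/
theorem exists_coercive {F : Type*} [NormedAddCommGroup F] [InnerProductSpace ℝ F]
    (A B : E →L[ℝ] F) (h : ∀ v, v ≠ 0 → 0 < inner ℝ (A v) (B v)) :
    ∃ c > 0, ∀ v, c * ‖v‖ ^ 2 ≤ inner ℝ (A v) (B v) := by
  rcases subsingleton_or_nontrivial E with hE | hE
  · exact ⟨1, one_pos, fun v => by simp [Subsingleton.elim v 0]⟩
  have hK : IsCompact (Metric.sphere (0 : E) 1) := isCompact_sphere 0 1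
  obtain ⟨x, hx, hmin⟩ := hK.exists_isMinOn (NormedSpace.sphere_nonempty.2 zero_le_one)
    (f := fun v => inner ℝ (A v) (B v)) (by fun_prop)
  have hx1 : ‖x‖ = 1 := by simpa using hx
  refine ⟨inner ℝ (A x) (B x), h x (by rintro rfl; simp at hx1), fun v => ?_⟩
  rcases eq_or_ne v 0 with rfl | hv
  · simp
  have hn : ‖v‖ ≠ 0 := norm_ne_zero_iff.2 hv
  have h1 := hmin (a := ‖v‖⁻¹ • v) (by simp [norm_smul, hn])
  simp only [map_smul, inner_smul_left, inner_smul_right, conj_trivial, Set.mem_ofPred_eq] at h1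
  calc inner ℝ (A x) (B x) * ‖v‖ ^ 2
      ≤ (‖v‖⁻¹ * (‖v‖⁻¹ * inner ℝ (A v) (B v))) * ‖v‖ ^ 2 := by gcongr
    _ = inner ℝ (A v) (B v) := by field_simp

/-- Without real eigenvalues there is an invariant plane, spanned by `v` and `φ v`: take `v` in the
kernel of `q(φ)` for an irreducible factor `q` of the minimal polynomial, of degree two. -/
theorem NoRealEigenvalue.exists_quadratic [Nontrivial E] {φ : E →L[ℝ] E}
    (h : NoRealEigenvalue φ) : ∃ v : E, v ≠ 0 ∧ ∃ a b : ℝ, φ (φ v) = a • v + b • φ v := by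
  set f : Module.End ℝ E := (φ : E →ₗ[ℝ] E) with hf
  have hint : IsIntegral ℝ f := Algebra.IsIntegral.isIntegral f
  obtain ⟨q, hq, r, hr⟩ := WfDvdMonoid.exists_irreducible_factor (minpoly.not_isUnit ℝ f)
    (minpoly.ne_zero hint)
  have hr0 : Polynomial.aeval f r ≠ 0 := by
    intro h0
    obtain ⟨s, hs⟩ := minpoly.dvd ℝ f h0
    refine hq.not_isUnit (IsUnit.of_mul_eq_one s (mul_left_cancel₀ (minpoly.ne_zero hint) ?_))
    calc minpoly ℝ f * (q * s) = q * (minpoly ℝ f * s) := by ring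
      _ = minpoly ℝ f * 1 := by rw [← hs, hr, mul_one]
  obtain ⟨w, hw⟩ : ∃ w, Polynomial.aeval f r w ≠ 0 := by
    by_contra! hcon
    exact hr0 (LinearMap.ext hcon)
  set v := Polynomial.aeval f r w with hv
  have hqv : Polynomial.aeval f q v = 0 := by
    have := minpoly.aeval ℝ f
    rw [hr, map_mul] at this
    exact congrArg (fun g : Module.End ℝ E => g w) this
  have hquad := Polynomial.eq_quadratic_of_degree_le_two hq.degree_le_two
  set a := q.coeff 2
  set b := q.coeff 1
  set c := q.coeff 0
  rw [hquad] at hqv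
  have hqv' : a • φ (φ v) + b • φ v + c • v = 0 := by
    simpa [hf, pow_two, Algebra.algebraMap_eq_smul_one] using hqv
  refine ⟨v, hw, ?_⟩
  have ha : a ≠ 0 := by
    intro ha
    rw [ha, zero_smul, zero_add] at hqv'
    have hb : b = 0 := by
      by_contra hb
      refine hw (h (-(b⁻¹ * c)) v ?_)
      have : φ v = b⁻¹ • (b • φ v) := by rw [smul_smul, inv_mul_cancel₀ hb, one_smul]
      rw [this, eq_neg_of_add_eq_zero_left hqv', smul_neg, smul_smul, neg_smul]
    rw [hb, zero_smul, zero_add] at hqv'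
    have hc : c = 0 := (smul_eq_zero.1 hqv').resolve_right hw
    rw [ha, hb, hc] at hquad
    exact hq.ne_zero (by simpa using hquad)
  refine ⟨-(a⁻¹ * c), -(a⁻¹ * b), ?_⟩
  have : φ (φ v) = a⁻¹ • (a • φ (φ v)) := by rw [smul_smul, inv_mul_cancel₀ ha, one_smul]
  rw [this, show a • φ (φ v) = -(b • φ v + c • v) by
    rw [eq_neg_iff_add_eq_zero, ← hqv']; abel]
  simp only [smul_neg, smul_add, smul_smul, neg_smul]
  abel

/-- In dimension two, one of the two rotations `±R` through a right angle tames `φ`, because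
`⟪φ v, R v⟫` vanishes only if `φ v` is a multiple of `v`, and so has constant sign for `v ≠ 0`. -/
theorem NoRealEigenvalue.exists_tames_of_finrank_eq_two (hE : Module.finrank ℝ E = 2)
    {φ : E →L[ℝ] E} (h : NoRealEigenvalue φ) : ∃ W, Tames W φ := by
  have : Fact (Module.finrank ℝ E = 2) := ⟨hE⟩
  let o : Orientation ℝ E (Fin 2) :=
    ((Module.finBasis ℝ E).reindex (finCongr hE)).orientation
  let R : E →L[ℝ] E := (o.rightAngleRotation.toContinuousLinearEquiv : E →L[ℝ] E)
  have hR : ∀ v, R v = o.rightAngleRotation v := fun v => rfl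
  have hskew : IsSkew R := fun v => by rw [hR]; exact o.inner_rightAngleRotation_self v
  have hne : ∀ v, v ≠ 0 → inner ℝ (φ v) (R v) ≠ 0 := by
    intro v hv h0
    rw [hR, real_inner_comm, o.inner_rightAngleRotation_left] at h0
    obtain ⟨c, hc⟩ := exists_smul_of_areaForm_eq_zero o hv h0
    exact hv (h c v hc)
  have hconn : IsPreconnected ({0}ᶜ : Set E) := by
    refine (isConnected_compl_singleton_of_one_lt_rank ?_ 0).isPreconnected
    rw [← Module.finrank_eq_rank, hE]
    norm_num
  have hcont : Continuous fun v => inner ℝ (φ v) (R v) := by fun_prop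
  by_cases hpos : ∃ v, v ≠ 0 ∧ 0 < inner ℝ (φ v) (R v)
  · obtain ⟨v, hv, hv0⟩ := hpos
    refine ⟨R, hskew, fun w hw => ?_⟩
    by_contra hcon
    obtain ⟨z, hz, hz0⟩ := hconn.intermediate_value (a := w) (b := v) hw hv hcont.continuousOn
      ⟨not_lt.1 hcon, hv0.le⟩
    exact hne z hz hz0
  · push Not at hpos
    refine ⟨-R, fun v => by simp [hskew v], fun w hw => ?_⟩
    have := lt_of_le_of_ne (hpos w hw) (hne w hw)
    simpa using this

/-- Every endomorphism without real eigenvalues is tamed by a skew-adjoint map: by induction, take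
an invariant plane `F`, a map that tames the restriction to `F` and one that tames the compression
to `Fᗮ`, and use the direct sum of the first and a large multiple of the second. -/
theorem NoRealEigenvalue.exists_tames {φ : E →L[ℝ] E} (h : NoRealEigenvalue φ) :
    ∃ W, Tames W φ := by
  induction hn : Module.finrank ℝ E using Nat.strong_induction_on generalizing E with
  | _ n ih =>
  rcases subsingleton_or_nontrivial E with hE | hE
  · exact ⟨0, fun v => by simp, fun v hv => absurd (Subsingleton.elim v 0) hv⟩
  obtain ⟨v, hv, a, b, hab⟩ := h.exists_quadratic
  let F : Submodule ℝ E := Submodule.span ℝ (Set.range ![v, φ v])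
  have hli : LinearIndependent ℝ ![v, φ v] := by
    rw [LinearIndependent.pair_iff' hv]
    intro c hc
    exact hv (h c v hc.symm)
  have hF2 : Module.finrank ℝ F = 2 := by simpa using finrank_span_eq_card hli
  have hFinv : ∀ x ∈ F, φ x ∈ F := by
    intro x hx
    have hvF : v ∈ F := Submodule.subset_span ⟨0, rfl⟩
    have hφF : φ v ∈ F := Submodule.subset_span ⟨1, rfl⟩
    induction hx using Submodule.span_induction with
    | mem y hy =>
      obtain ⟨i, rfl⟩ := hy
      fin_cases i
      · exact hφF
      · simpa [hab] using F.add_mem (F.smul_mem a hvF) (F.smul_mem b hφF)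
    | zero => simp
    | add y z _ _ hy hz => simpa using F.add_mem hy hz
    | smul c y _ hy => simpa using F.smul_mem c hy
  let φF : F →L[ℝ] F := F.orthogonalProjectionOnto ∘L φ ∘L F.subtypeL
  have hφF : ∀ x : F, (φF x : E) = φ x := fun x =>
    congrArg Subtype.val (F.orthogonalProjectionOnto_mem_subspace_eq_self ⟨φ x, hFinv x x.2⟩)
  let φG : Fᗮ →L[ℝ] Fᗮ := Fᗮ.orthogonalProjectionOnto ∘L φ ∘L Fᗮ.subtypeL
  have hFno : NoRealEigenvalue φF := by
    intro c x hx
    refine Subtype.ext (h c x ?_)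
    rw [← hφF, hx]; rfl
  have hGno : NoRealEigenvalue φG := by
    intro c y hy
    -- `φ - c` is bijective on `F`, so an eigenvector modulo `F` can be corrected to one of `φ`
    have hmem : φ y - c • (y : E) ∈ F := by
      have h0 : Fᗮ.orthogonalProjectionOnto (φ y - c • (y : E)) = 0 := by
        rw [map_sub, map_smul, Submodule.orthogonalProjectionOnto_mem_subspace_eq_self]
        exact sub_eq_zero.2 hy
      rw [Submodule.orthogonalProjectionOnto_eq_zero_iff, Submodule.orthogonal_orthogonal] at h0
      exact h0
    let g : F →ₗ[ℝ] F := (φF : F →ₗ[ℝ] F) - c • (LinearMap.id : F →ₗ[ℝ] F)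
    have hinj : Function.Injective g := by
      rw [injective_iff_map_eq_zero]
      intro x hx
      exact hFno c x (sub_eq_zero.1 hx)
    obtain ⟨x, hx⟩ := LinearMap.injective_iff_surjective.1 hinj ⟨_, hmem⟩
    have hx' : φ x - c • (x : E) = φ y - c • (y : E) := by
      have := congrArg Subtype.val hx
      simpa [g, hφF] using this
    have hyx : (y : E) - x = 0 := by
      apply h c
      rw [map_sub, smul_sub]
      rw [sub_eq_sub_iff_add_eq_add] at hx' ⊢
      rw [← hx']
      abel
    have hyF : (y : E) ∈ F := by rw [sub_eq_zero.1 hyx]; exact x.2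
    have := Submodule.inner_right_of_mem_orthogonal hyF y.2
    rw [inner_self_eq_zero] at this
    exact_mod_cast this
  have hGlt : Module.finrank ℝ Fᗮ < n := by
    have := F.finrank_add_finrank_orthogonal
    omega
  obtain ⟨WF, hWFs, hWF⟩ := hFno.exists_tames_of_finrank_eq_two hF2
  obtain ⟨WG, hWGs, hWG⟩ := ih _ hGlt hGno rfl
  obtain ⟨cF, hcF, hcF'⟩ := exists_coercive _ _ hWF
  obtain ⟨cG, hcG, hcG'⟩ := exists_coercive _ _ hWG
  let B : Fᗮ →L[ℝ] F := F.orthogonalProjectionOnto ∘L φ ∘L Fᗮ.subtypeL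
  set C := ‖B‖ * ‖WF‖ with hC
  -- the mixed term is dominated once `s` is large
  set s := (C ^ 2 / cF + 1) / cG with hs
  have hs0 : 0 < s := by positivity
  let π := F.orthogonalProjectionOnto
  let π' := Fᗮ.orthogonalProjectionOnto
  let W : E →L[ℝ] E := F.subtypeL ∘L WF ∘L π + s • (Fᗮ.subtypeL ∘L WG ∘L π')
  have hW : ∀ z, W z = (WF (π z) : E) + s • (WG (π' z) : E) := fun z => rfl
  have hin : ∀ (z : E) (x : F), inner ℝ z (x : E) = inner ℝ (π z) x := fun z x => by
    rw [← Submodule.inner_orthogonalProjectionOnto_eq_of_mem_right]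
  have hin' : ∀ (z : E) (x : Fᗮ), inner ℝ z (x : E) = inner ℝ (π' z) x := fun z x => by
    rw [← Submodule.inner_orthogonalProjectionOnto_eq_of_mem_right]
  refine ⟨W, fun z => ?_, fun z hz => ?_⟩
  · rw [hW, inner_add_left, inner_smul_left, real_inner_comm, hin, real_inner_comm,
      real_inner_comm z, hin', real_inner_comm _ (π' z), hWFs, hWGs]
    simp
  · have hdec : (π z : E) + π' z = z := F.starProjection_add_starProjection_orthogonal z
    have h1 : π (φ z) = φF (π z) + B (π' z) := by
      conv_lhs => rw [← hdec]
      rw [map_add, map_add]; rfl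
    have h2 : π' (φ z) = φG (π' z) := by
      conv_lhs => rw [← hdec]
      rw [map_add, map_add]
      have : π' (φ (π z)) = 0 :=
        Submodule.orthogonalProjectionOnto_apply_of_mem_orthogonal
          (F.le_orthogonal_orthogonal (hFinv _ (π z).2))
      rw [this, zero_add]; rfl
    rw [hW, inner_add_right, inner_smul_right, hin, hin', h1, h2, inner_add_left]
    have hB : -(C * ‖π' z‖ * ‖π z‖) ≤ inner ℝ (B (π' z)) (WF (π z)) := by
      refine (abs_le.1 ((abs_real_inner_le_norm _ _).trans ?_)).1
      calc ‖B (π' z)‖ * ‖WF (π z)‖ ≤ (‖B‖ * ‖π' z‖) * (‖WF‖ * ‖π z‖) := by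
            gcongr <;> exact ContinuousLinearMap.le_opNorm _ _
        _ = C * ‖π' z‖ * ‖π z‖ := by rw [hC]; ring
    have e1 := hcF' (π z)
    have e2 := mul_le_mul_of_nonneg_left (hcG' (π' z)) hs0.le
    have e3 : s * (cG * ‖π' z‖ ^ 2) = (C ^ 2 / cF + 1) * ‖π' z‖ ^ 2 := by
      rw [hs]; field_simp
    have hpos : 0 < cF * ‖π z‖ ^ 2 - C * ‖π' z‖ * ‖π z‖ + (C ^ 2 / cF + 1) * ‖π' z‖ ^ 2 := by
      -- complete the square
      have key : cF * ‖π z‖ ^ 2 - C * ‖π' z‖ * ‖π z‖ + (C ^ 2 / cF + 1) * ‖π' z‖ ^ 2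
          = cF * (‖π z‖ - C / (2 * cF) * ‖π' z‖) ^ 2
            + (3 / 4 * (C ^ 2 / cF) + 1) * ‖π' z‖ ^ 2 := by
        field_simp
        ring
      rw [key]
      rcases eq_or_ne (π' z) 0 with h0 | h0
      · have : π z ≠ 0 := by
          intro h00
          rw [h0, h00] at hdec
          exact hz (by simpa using hdec.symm)
        have := norm_pos_iff.2 this
        rw [h0]
        simp only [norm_zero, mul_zero, sub_zero]
        positivity
      · have := norm_pos_iff.2 h0
        have : 0 ≤ cF * (‖π z‖ - C / (2 * cF) * ‖π' z‖) ^ 2 := by positivity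
        positivity
    linarith

end Taming

/-! ### The orthogonal part of an invertible skew map -/

section Polar

variable {E : Type*} [NormedAddCommGroup E] [InnerProductSpace ℝ E]

/-- `U` is the orthogonal factor in the polar decomposition of the skew-adjoint map `W`: an
orthogonal complex structure commuting with `W` for which `U⁻¹ W` is positive. The positivity is
not strict, so that the condition is closed. -/
def IsPolar (W U : E →L[ℝ] E) : Prop :=
  IsOrthComplex U ∧ (∀ v, U (W v) = W (U v)) ∧ ∀ v, 0 ≤ inner ℝ (U v) (W v)

theorem IsPolar.inner_pos {W U : E →L[ℝ] E} (h : IsPolar W U) (hW : IsSkew W)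
    (hinj : ∀ v, W v = 0 → v = 0) {v : E} (hv : v ≠ 0) : 0 < inner ℝ (U v) (W v) := by
  refine lt_of_le_of_ne (h.2.2 v) fun h0 => ?_
  -- the symmetric form `(v, w) ↦ ⟪U v, W w⟫` is positive semidefinite and `v` is isotropic
  have hsymm : ∀ x y, inner ℝ (U x) (W y) = inner ℝ (U y) (W x) := fun x y => by
    rw [h.1.1.inner_left, h.2.1, real_inner_comm, hW.inner_left, neg_neg]
  set w := -U (W v) with hw
  set p := ‖W v‖ ^ 2 with hp
  set q := inner ℝ (U w) (W w) with hq
  have hq0 : 0 ≤ q := h.2.2 w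
  have hpw : inner ℝ (U w) (W v) = p := by
    rw [hw, map_neg, h.1.2, neg_neg, real_inner_self_eq_norm_sq]
  have hquad : ∀ t : ℝ, 0 ≤ 2 * t * p + t ^ 2 * q := fun t => by
    have := h.2.2 (v + t • w)
    simp only [map_add, map_smul, inner_add_left, inner_add_right, inner_smul_left,
      inner_smul_right, conj_trivial, ← h0, hsymm v w, hpw, ← hq] at this
    linarith
  have hp0 : p ≠ 0 := by
    have : W v ≠ 0 := fun h => hv (hinj v h)
    simpa [hp] using this
  have hpp : 0 < p := lt_of_le_of_ne (by positivity) hp0.symm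
  have := hquad (-p / (q + 1))
  have e : 2 * (-p / (q + 1)) * p + (-p / (q + 1)) ^ 2 * q = -(p ^ 2 * (q + 2)) / (q + 1) ^ 2 := by
    field_simp
    ring
  rw [e] at this
  have : 0 < p ^ 2 * (q + 2) / (q + 1) ^ 2 := by positivity
  rw [neg_div] at *
  linarith

theorem IsPolar.tames {W U : E →L[ℝ] E} (h : IsPolar W U) (hW : IsSkew W)
    (hinj : ∀ v, W v = 0 → v = 0) : Tames W U :=
  ⟨hW, fun _ hv => h.inner_pos hW hinj hv⟩

theorem IsOrthComplex.isPolar {U : E →L[ℝ] E} (h : IsOrthComplex U) : IsPolar U U :=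
  ⟨h, fun _ => rfl, fun _ => real_inner_self_nonneg⟩

theorem isClosed_isPolar : IsClosed {p : (E →L[ℝ] E) × (E →L[ℝ] E) | IsPolar p.1 p.2} := by
  simp only [IsPolar, IsOrthComplex, IsSkew, Set.ofPred_and, Set.ofPred_forall]
  refine ((isClosed_iInter fun v => ?_).inter (isClosed_iInter fun v => ?_)).inter
    ((isClosed_iInter fun v => ?_).inter (isClosed_iInter fun v => ?_))
  · exact isClosed_eq (by fun_prop) (by fun_prop)
  · exact isClosed_eq (by fun_prop) (by fun_prop)
  · exact isClosed_eq (by fun_prop) (by fun_prop)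
  · exact isClosed_le (by fun_prop) (by fun_prop)

theorem Tames.injective {W φ : E →L[ℝ] E} (h : Tames W φ) (v : E) (hv : W v = 0) : v = 0 := by
  by_contra hne
  have := h.2 v hne
  rw [hv, inner_zero_right] at this
  exact lt_irrefl _ this

theorem isClosed_isOrthComplex : IsClosed {U : E →L[ℝ] E | IsOrthComplex U} := by
  simp only [IsOrthComplex, IsSkew, Set.ofPred_and, Set.ofPred_forall]
  refine (isClosed_iInter fun v => ?_).inter (isClosed_iInter fun v => ?_)
  · exact isClosed_eq (by fun_prop) (by fun_prop)
  · exact isClosed_eq (by fun_prop) (by fun_prop)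

variable [FiniteDimensional ℝ E]

/-- Uniqueness of the positive square root of `-W²`, in terms of the orthogonal factors. -/
theorem IsPolar.unique {W U U' : E →L[ℝ] E} (h : IsPolar W U) (h' : IsPolar W U') (hW : IsSkew W)
    (hinj : ∀ v, W v = 0 → v = 0) : U = U' := by
  let X : E →ₗ[ℝ] E := ((U' - U) ∘L W : E →L[ℝ] E)
  have hX : ∀ v, X v = U' (W v) - U (W v) := fun v => rfl
  have hsym : X.IsSymmetric := by
    have key : ∀ {U : E →L[ℝ] E}, IsPolar W U → ∀ x y,
        inner ℝ (U (W x)) y = inner ℝ x (U (W y)) := fun {U} h x y => by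
      rw [h.1.1.inner_left, hW.inner_left, neg_neg, h.2.1]
    intro x y
    rw [hX, hX, inner_sub_left, inner_sub_right, key h, key h']
  have hzero : ∀ (μ : ℝ) v, X v = μ • v → X v = 0 := by
    intro μ v hv
    rcases eq_or_ne v 0 with rfl | hv0
    · simp
    have e1 : inner ℝ (U (W (X v))) v + inner ℝ (U' (W v)) (X v) = 0 := by
      have : inner ℝ (U' (W v)) (X v) = inner ℝ (X (U' (W v))) v := (hsym _ _).symm
      rw [this, ← inner_add_left]
      have hz : U (W (X v)) + X (U' (W v)) = 0 := by
        rw [hX, hX, map_sub, map_sub, ← h'.2.1 (W v), ← h.2.1 (W v), h.1.2, h'.1.2]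
        abel
      rw [hz, inner_zero_left]
    have p1 := h.inner_pos hW hinj hv0
    have p2 := h'.inner_pos hW hinj hv0
    have e2 : inner ℝ (U (W v)) v = -inner ℝ (U v) (W v) := by
      rw [h.1.1.inner_left, real_inner_comm]
    have e3 : inner ℝ (U' (W v)) v = -inner ℝ (U' v) (W v) := by
      rw [h'.1.1.inner_left, real_inner_comm]
    rw [hv, map_smul, map_smul, inner_smul_left, inner_smul_right, e2, e3, conj_trivial] at e1
    have hμ : μ = 0 := by
      have : μ * (inner ℝ (U v) (W v) + inner ℝ (U' v) (W v)) = 0 := by linarith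
      exact (mul_eq_zero.1 this).resolve_right (by linarith)
    rw [hv, hμ, zero_smul]
  have hX0 : X = 0 := by
    refine (hsym.eigenvectorBasis rfl).toBasis.ext fun i => ?_
    rw [OrthonormalBasis.coe_toBasis]
    exact hzero _ _ (hsym.apply_eigenvectorBasis rfl i)
  have hsurj : Function.Surjective (W : E →ₗ[ℝ] E) :=
    LinearMap.injective_iff_surjective.1 ((injective_iff_map_eq_zero _).2 hinj)
  ext v
  obtain ⟨w, rfl⟩ := hsurj v
  have : U' (W w) - U (W w) = 0 := by rw [← hX, hX0]; rfl
  exact (sub_eq_zero.1 this).symm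

/-- The orthogonal factor is `W S` with `S = (-W²)^(-1/2)`, which is defined through an orthonormal
basis of eigenvectors of `-W²` and commutes with `W`. -/
theorem IsSkew.exists_isPolar {W : E →L[ℝ] E} (hW : IsSkew W) (hinj : ∀ v, W v = 0 → v = 0) :
    ∃ U, IsPolar W U := by
  let A : E →ₗ[ℝ] E := (-(W ∘L W) : E →L[ℝ] E)
  have hA : ∀ v, A v = -W (W v) := fun v => rfl
  have hsym : A.IsSymmetric := fun x y => by
    rw [hA, hA, inner_neg_left, inner_neg_right, hW.inner_left, hW.inner_left, neg_neg]
  let b := hsym.eigenvectorBasis rfl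
  let l := hsym.eigenvalues rfl
  have hl : ∀ i, A (b i) = l i • b i := fun i => hsym.apply_eigenvectorBasis rfl i
  have hlpos : ∀ i, 0 < l i := by
    intro i
    have h1 : inner ℝ (A (b i)) (b i) = l i := by
      rw [hl, inner_smul_left, real_inner_self_eq_norm_sq, b.norm_eq_one]; simp
    rw [← h1, hA, inner_neg_left, hW.inner_left, neg_neg]
    refine real_inner_self_pos.2 fun h0 => ?_
    exact b.orthonormal.ne_zero i (hinj _ h0)
  let s : Fin (Module.finrank ℝ E) → ℝ := fun i => (Real.sqrt (l i))⁻¹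
  have hs : ∀ i, s i * s i * l i = 1 := fun i => by
    have h1 := Real.mul_self_sqrt (hlpos i).le
    have h2 := Real.sqrt_pos.2 (hlpos i)
    simp only [s]
    field_simp
    nlinarith
  have hspos : ∀ i, 0 < s i := fun i => inv_pos.2 (Real.sqrt_pos.2 (hlpos i))
  let S : E →L[ℝ] E := LinearMap.toContinuousLinearMap (b.toBasis.constr ℝ fun i => s i • b i)
  have hSb : ∀ i, S (b i) = s i • b i := fun i => by
    have := b.toBasis.constr_basis ℝ (fun i => s i • b i) i
    rwa [OrthonormalBasis.coe_toBasis] at this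
  have hin : ∀ i v, inner ℝ (b i) (S v) = s i * inner ℝ (b i) v := by
    intro i v
    conv_lhs => rw [← b.sum_repr' v]
    simp only [map_sum, map_smul, hSb, inner_sum, inner_smul_right]
    rw [Finset.sum_eq_single i]
    · rw [real_inner_self_eq_norm_sq, b.norm_eq_one]; ring
    · intro j _ hj
      rw [b.orthonormal.2 hj.symm]; ring
    · simp
  have hSsym : ∀ v w, inner ℝ (S v) w = inner ℝ v (S w) := by
    intro v w
    rw [← b.sum_inner_mul_inner, ← b.sum_inner_mul_inner]
    refine Finset.sum_congr rfl fun i _ => ?_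
    rw [real_inner_comm, hin, hin, real_inner_comm v]
    ring
  have hcomm : ∀ v, S (W v) = W (S v) := by
    suffices h : (S ∘L W : E →L[ℝ] E) = W ∘L S from fun v => congrArg (fun f => f v) h
    refine ContinuousLinearMap.coe_injective (b.toBasis.ext fun i => ?_)
    rw [OrthonormalBasis.coe_toBasis]
    refine InnerProductSpace.ext_inner_left_basis b.toBasis fun j => ?_
    rw [OrthonormalBasis.coe_toBasis]
    change inner ℝ (b j) (S (W (b i))) = inner ℝ (b j) (W (S (b i)))
    rw [hin, hSb, map_smul, inner_smul_right]
    have h1 : l j * inner ℝ (b j) (W (b i)) = l i * inner ℝ (b j) (W (b i)) := by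
      have e1 : inner ℝ (A (b j)) (W (b i)) = inner ℝ (b j) (A (W (b i))) := hsym _ _
      have e2 : A (W (b i)) = W (A (b i)) := by rw [hA, hA, map_neg]
      rw [e2, hl, hl, map_smul, inner_smul_left, inner_smul_right, conj_trivial] at e1
      exact e1
    by_cases h0 : inner ℝ (b j) (W (b i)) = 0
    · rw [h0]; ring
    · have : l j = l i := mul_right_cancel₀ h0 h1
      simp only [s, this]
  have hSA : ∀ v, S (S (A v)) = v := by
    suffices h : ((S ∘L S : E →L[ℝ] E) : E →ₗ[ℝ] E) ∘ₗ A = LinearMap.id from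
      fun v => congrArg (fun f : E →ₗ[ℝ] E => f v) h
    refine b.toBasis.ext fun i => ?_
    rw [OrthonormalBasis.coe_toBasis]
    change S (S (A (b i))) = b i
    rw [hl, map_smul, map_smul, hSb, map_smul, hSb, smul_smul, smul_smul,
      show l i * s i * s i = 1 by rw [← hs i]; ring, one_smul]
  refine ⟨W ∘L S, ⟨fun v => ?_, fun v => ?_⟩, fun v => ?_, fun v => ?_⟩
  · change inner ℝ (W (S v)) v = 0
    have h1 : inner ℝ (W (S v)) v = -inner ℝ (W (S v)) v := by
      conv_lhs => rw [hW.inner_left, hSsym, hcomm, real_inner_comm]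
    linarith
  · change W (S (W (S v))) = -v
    rw [← hcomm, ← hcomm, ← hcomm]
    have := hSA v
    rw [hA, map_neg, map_neg] at this
    rw [← neg_eq_iff_eq_neg, this]
  · change W (S (W v)) = W (W (S v))
    rw [hcomm]
  · change 0 ≤ inner ℝ (W (S v)) (W v)
    have h1 : inner ℝ (W (S v)) (W v) = inner ℝ (S v) (A v) := by
      rw [hW.inner_left, hA, inner_neg_right]
    rw [h1, ← b.sum_inner_mul_inner]
    refine Finset.sum_nonneg fun i _ => ?_
    have h2 : inner ℝ (b i) (A v) = l i * inner ℝ (b i) v := by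
      rw [← hsym (b i) v, hl, inner_smul_left, conj_trivial]
    rw [real_inner_comm, hin, h2]
    have := mul_pos (hspos i) (hlpos i)
    calc (0 : ℝ) ≤ (s i * l i) * (inner ℝ (b i) v) ^ 2 := by positivity
      _ = _ := by ring

open Classical in
/-- The orthogonal factor of an invertible skew-adjoint map (and `0` for other maps). -/
noncomputable def polarPart (W : E →L[ℝ] E) : E →L[ℝ] E :=
  if h : ∃ U, IsPolar W U then h.choose else 0

theorem isPolar_polarPart {W : E →L[ℝ] E} (hW : IsSkew W) (hinj : ∀ v, W v = 0 → v = 0) :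
    IsPolar W (polarPart W) := by
  have h := hW.exists_isPolar hinj
  rw [polarPart, dif_pos h]
  exact h.choose_spec

/-- Continuity holds because the graph is closed and the values stay in a compact set. -/
theorem continuousOn_polarPart :
    ContinuousOn (polarPart (E := E)) {W | IsSkew W ∧ ∀ v, W v = 0 → v = 0} := by
  intro W hW
  have hcomp : IsCompact (Metric.closedBall (0 : E →L[ℝ] E) 1) := isCompact_closedBall _ _
  refine hcomp.tendsto_nhds_of_unique_mapClusterPt ?_ fun U _ hU => ?_
  · filter_upwards [self_mem_nhdsWithin] with V hV
    rw [mem_closedBall_zero_iff]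
    refine ContinuousLinearMap.opNorm_le_bound _ zero_le_one fun v => ?_
    rw [(isPolar_polarPart hV.1 hV.2).1.norm_map, one_mul]
  · obtain ⟨F, hF, hFU⟩ := mapClusterPt_iff_ultrafilter.1 hU
    refine IsPolar.unique (W := W) ?_ (isPolar_polarPart hW.1 hW.2) hW.1 hW.2
    have hlim : Filter.Tendsto (fun V => (V, polarPart V)) F (nhds (W, U)) :=
      Filter.Tendsto.prodMk_nhds (hF.trans nhdsWithin_le_nhds) hFU
    refine isClosed_isPolar.mem_of_tendsto hlim ?_
    filter_upwards [hF self_mem_nhdsWithin] with V hV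
    exact isPolar_polarPart hV.1 hV.2

/-! ### A retraction onto the orthogonal complex structures -/

theorem isOpen_posDef : IsOpen {Q : E →L[ℝ] E | ∀ v, v ≠ 0 → 0 < inner ℝ (Q v) v} := by
  rw [Metric.isOpen_iff]
  intro Q hQ
  obtain ⟨c, hc, h⟩ := exists_coercive Q (ContinuousLinearMap.id ℝ E) hQ
  refine ⟨c, hc, fun R hR v hv => ?_⟩
  have h1 := h v
  have h2 : |inner ℝ ((R - Q) v) v| ≤ ‖R - Q‖ * ‖v‖ ^ 2 := by
    refine (abs_real_inner_le_norm _ _).trans ?_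
    have := (R - Q).le_opNorm v
    nlinarith [norm_nonneg v]
  have h3 : ‖R - Q‖ < c := by rwa [← dist_eq_norm]
  have h4 : 0 < ‖v‖ := norm_pos_iff.2 hv
  have h5 : ‖R - Q‖ * ‖v‖ ^ 2 < c * ‖v‖ ^ 2 := by gcongr
  have h6 := (abs_le.1 h2).1
  rw [sub_apply, inner_sub_left] at h6
  simp only [ContinuousLinearMap.coe_id', id] at h1
  linarith

/-- A taming map can be chosen continuously, and equal to `φ` when `φ` is an orthogonal complex
structure: the admissible choices form convex sets, so that local choices can be glued. -/
theorem exists_continuous_tames :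
    ∃ g : C({φ : E →L[ℝ] E // NoRealEigenvalue φ}, E →L[ℝ] E),
      ∀ φ, Tames (g φ) φ.1 ∧ (IsOrthComplex φ.1 → g φ = φ.1) := by
  refine exists_continuous_forall_mem_convex_of_local
    (t := fun φ : {φ : E →L[ℝ] E // NoRealEigenvalue φ} =>
      {W : E →L[ℝ] E | Tames W φ.1 ∧ (IsOrthComplex φ.1 → W = φ.1)}) ?_ ?_
  · rintro φ W ⟨⟨hW, hW1⟩, hW2⟩ V ⟨⟨hV, hV1⟩, hV2⟩ a b ha hb hab
    refine ⟨⟨fun v => ?_, fun v hv => ?_⟩, fun h => ?_⟩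
    · simp [inner_add_left, inner_smul_left, hW v, hV v]
    · simp only [add_apply, smul_apply, inner_add_right, inner_smul_right]
      have h1 := hW1 v hv
      have h2 := hV1 v hv
      rcases ha.eq_or_lt with rfl | ha
      · rw [zero_add] at hab
        simpa [hab] using h2
      · have := mul_pos ha h1
        have := mul_nonneg hb h2.le
        linarith
    · rw [hW2 h, hV2 h, ← add_smul, hab, one_smul]
  · intro φ
    have hopen : ∀ g : (E →L[ℝ] E) → (E →L[ℝ] E), Continuous g → Tames (g φ.1) φ.1 →
        ∀ᶠ ψ : {φ : E →L[ℝ] E // NoRealEigenvalue φ} in nhds φ,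
          ∀ v, v ≠ 0 → 0 < inner ℝ (ψ.1 v) (g ψ.1 v) := by
      intro g hg h0
      have hc : Continuous fun ψ : {φ : E →L[ℝ] E // NoRealEigenvalue φ} =>
          ContinuousLinearMap.adjoint (g ψ.1) ∘L ψ.1 :=
        (ContinuousLinearMap.adjoint.continuous.comp (hg.comp continuous_subtype_val)).clm_comp
          continuous_subtype_val
      have := hc.continuousAt.eventually (isOpen_posDef.mem_nhds (x :=
        ContinuousLinearMap.adjoint (g φ.1) ∘L φ.1) fun v hv => by
          rw [ContinuousLinearMap.comp_apply, ContinuousLinearMap.adjoint_inner_left]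
          exact h0.2 v hv)
      filter_upwards [this] with ψ hψ v hv
      have := hψ v hv
      rwa [ContinuousLinearMap.comp_apply, ContinuousLinearMap.adjoint_inner_left] at this
    by_cases hφ : IsOrthComplex φ.1
    · -- near an orthogonal complex structure, the skew part of `φ` is an admissible choice
      let g : (E →L[ℝ] E) → (E →L[ℝ] E) := fun ψ =>
        (2⁻¹ : ℝ) • (ψ - ContinuousLinearMap.adjoint ψ)
      have hg : Continuous g :=
        (continuous_id.sub ContinuousLinearMap.adjoint.continuous).const_smul (2⁻¹ : ℝ)
      have hfix : ∀ ψ, IsOrthComplex ψ → g ψ = ψ := by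
        intro ψ h
        have : ContinuousLinearMap.adjoint ψ = -ψ := by
          symm
          rw [ContinuousLinearMap.eq_adjoint_iff]
          intro x y
          rw [neg_apply, inner_neg_left, h.1.inner_left, neg_neg]
        simp only [g, this, sub_neg_eq_add, ← two_smul ℝ ψ, smul_smul]
        norm_num
      have hskew : ∀ ψ, IsSkew (g ψ) := by
        intro ψ v
        simp only [g, smul_apply, sub_apply, inner_smul_left, inner_sub_left,
          ContinuousLinearMap.adjoint_inner_left]
        rw [real_inner_comm, sub_self, mul_zero]
      refine ⟨_, hopen g hg (by rw [hfix _ hφ]; exact hφ.tames), fun ψ => g ψ.1,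
        (hg.comp continuous_subtype_val).continuousOn, fun ψ hψ => ⟨⟨hskew _, hψ⟩, hfix _⟩⟩
    · obtain ⟨W, hW⟩ := φ.2.exists_tames
      have hno : ∀ᶠ ψ : {φ : E →L[ℝ] E // NoRealEigenvalue φ} in nhds φ, ¬IsOrthComplex ψ.1 :=
        continuous_subtype_val.continuousAt.eventually
          (isClosed_isOrthComplex.isOpen_compl.mem_nhds hφ)
      refine ⟨_, (hopen (fun _ => W) continuous_const hW).and hno, fun _ => W,
        continuousOn_const, fun ψ hψ => ⟨⟨hW.1, hψ.1⟩, fun h => absurd h hψ.2⟩⟩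

/-- A continuous map `r` from the endomorphisms without real eigenvalues to the orthogonal complex
structures, which fixes the latter, such that the segment from `φ` to `r φ` stays clear of real
eigenvalues because a single skew-adjoint map tames both ends. -/
theorem exists_orthComplex_retraction :
    ∃ r : (E →L[ℝ] E) → (E →L[ℝ] E), ContinuousOn r {φ | NoRealEigenvalue φ} ∧
      ∀ φ, NoRealEigenvalue φ → IsOrthComplex (r φ) ∧ (∃ W, Tames W φ ∧ Tames W (r φ)) ∧
        (IsOrthComplex φ → r φ = φ) := by
  classical
  obtain ⟨g, hg⟩ := exists_continuous_tames (E := E)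
  have hpol : ∀ φ, IsPolar (g φ) (polarPart (g φ)) := fun φ =>
    isPolar_polarPart (hg φ).1.1 (hg φ).1.injective
  let r : (E →L[ℝ] E) → (E →L[ℝ] E) := fun φ =>
    if h : NoRealEigenvalue φ then polarPart (g ⟨φ, h⟩) else 0
  have hr : ∀ φ (h : NoRealEigenvalue φ), r φ = polarPart (g ⟨φ, h⟩) := fun φ h => dif_pos h
  refine ⟨r, ?_, fun φ h => ?_⟩
  · rw [continuousOn_iff_continuous_domRestrict]
    have : Set.domRestrict {φ | NoRealEigenvalue φ} r = fun φ => polarPart (g φ) :=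
      funext fun φ => hr φ.1 φ.2
    rw [this]
    exact continuousOn_polarPart.comp_continuous g.continuous
      fun φ => ⟨(hg φ).1.1, (hg φ).1.injective⟩
  · rw [hr φ h]
    refine ⟨(hpol _).1, ⟨_, (hg _).1, (hpol _).tames (hg _).1.1 (hg _).1.injective⟩, fun h' => ?_⟩
    have := hpol ⟨φ, h⟩
    rw [(hg ⟨φ, h⟩).2 h'] at this ⊢
    exact this.unique h'.isPolar h'.1 h'.tames.injective

end Polar

/-! ### Nonlinear maps tamed by a skew map -/

section TamedMap

variable {E : Type*} [NormedAddCommGroup E] [InnerProductSpace ℝ E]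

/-- The smooth map `f` is tamed by the skew-adjoint map `W`: this is the uniform and nonlinear
version of `Tames`. It makes the planes spanned by `e₁ + y` and `e₂ + f y` pairwise transverse. -/
def IsTamedMap (W : E →L[ℝ] E) (f : E → E) : Prop :=
  ContDiff ℝ ∞ f ∧ IsSkew W ∧
    ∃ c > 0, ∀ y z, c * ‖y - z‖ ^ 2 ≤ inner ℝ (f y - f z) (W (y - z))

theorem IsOrthComplex.isTamedMap {U : E →L[ℝ] E} (h : IsOrthComplex U) : IsTamedMap U U :=
  ⟨U.contDiff, h.1, 1, one_pos, fun y z => by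
    rw [← map_sub, h.inner_map, real_inner_self_eq_norm_sq, one_mul]⟩

theorem IsTamedMap.eq_of_eq {W : E →L[ℝ] E} {f : E → E} (h : IsTamedMap W f) {p : ℝ × ℝ}
    (hp : p ≠ 0) {y z : E} (hyz : p.1 • y + p.2 • f y = p.1 • z + p.2 • f z) : y = z := by
  obtain ⟨-, hW, c, hc, h⟩ := h
  have h1 : p.1 • (y - z) + p.2 • (f y - f z) = 0 := by
    rw [smul_sub, smul_sub, ← sub_eq_zero.2 hyz]; abel
  have h2 := congrArg (fun x => inner ℝ x (W (y - z))) h1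
  simp only [inner_add_left, inner_smul_left, inner_zero_left, conj_trivial] at h2
  rw [real_inner_comm, hW, mul_zero, zero_add] at h2
  rcases mul_eq_zero.1 h2 with h3 | h3
  · have h4 : p.1 ≠ 0 := fun h4 => hp (Prod.ext h4 h3)
    rw [h3, zero_smul, add_zero] at h1
    exact sub_eq_zero.1 ((smul_eq_zero.1 h1).resolve_left h4)
  · have h4 := h y z
    rw [h3] at h4
    have h5 : ‖y - z‖ ^ 2 = 0 := le_antisymm (by by_contra hcon; nlinarith) (by positivity)
    exact sub_eq_zero.1 (by simpa using h5)

/-- The derivative of a tamed map is tamed as well. -/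
theorem IsTamedMap.tames_fderiv {W : E →L[ℝ] E} {f : E → E} (h : IsTamedMap W f) (y : E) :
    Tames W (fderiv ℝ f y) := by
  obtain ⟨hf, hW, c, hc, h⟩ := h
  refine ⟨hW, fun v hv => ?_⟩
  have hd : HasFDerivAt f (fderiv ℝ f y) y := (hf.differentiable (by simp) y).hasFDerivAt
  have hline := hd.hasLineDerivAt v
  have hlim := hline.tendsto_slope_zero_right
  have hlim' := hlim.inner (𝕜 := ℝ) (tendsto_const_nhds (x := W v))
  have hn : 0 < ‖v‖ := norm_pos_iff.2 hv
  refine lt_of_lt_of_le (by positivity : 0 < c * ‖v‖ ^ 2) (ge_of_tendsto hlim' ?_)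
  filter_upwards [self_mem_nhdsWithin] with t ht
  have ht : 0 < t := ht
  have h1 := h (y + t • v) y
  simp only [add_sub_cancel_left, norm_smul, map_smul, inner_smul_right, Real.norm_eq_abs,
    mul_pow, sq_abs] at h1
  simp only [inner_smul_left, conj_trivial]
  have h2 : t * (t * (c * ‖v‖ ^ 2)) ≤ t * inner ℝ (f (y + t • v) - f y) (W v) := by
    linarith
  have h3 := le_of_mul_le_mul_left h2 ht
  rw [inv_mul_eq_div, le_div_iff₀ ht]
  linarith

/-- The equation `a y + b f(y) = 0` for the linear map `f = φ` has only the trivial solution. -/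
theorem Tames.eq_zero_of_add_eq_zero {W φ : E →L[ℝ] E} (h : Tames W φ) {p : ℝ × ℝ} (hp : p ≠ 0)
    {v : E} (hv : p.1 • v + p.2 • φ v = 0) : v = 0 := by
  by_contra hne
  have h2 := congrArg (fun x => inner ℝ x (W v)) hv
  simp only [inner_add_left, inner_smul_left, inner_zero_left, conj_trivial] at h2
  rw [real_inner_comm, h.1, mul_zero, zero_add] at h2
  have h3 : p.2 = 0 := (mul_eq_zero.1 h2).resolve_right (h.2 v hne).ne'
  rw [h3, zero_smul, add_zero] at hv
  exact hp (Prod.ext ((smul_eq_zero.1 hv).resolve_right hne) h3)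

/-! ### A slowly varying cutoff -/

theorem exists_lipschitz_smoothTransition :
    ∃ L > 0, ∀ s t : ℝ, |Real.smoothTransition s - Real.smoothTransition t| ≤ L * |s - t| := by
  obtain ⟨K, hK⟩ := (((Real.smoothTransition.contDiff (n := 1)).locallyLipschitz).locallyLipschitzOn
    (s := Set.Icc 0 1)).exists_lipschitzOnWith_of_compact isCompact_Icc
  refine ⟨K + 1, by positivity, fun s t => ?_⟩
  have h1 := hK.dist_le_mul _ (Set.projIcc (0 : ℝ) 1 zero_le_one s).2 _
    (Set.projIcc (0 : ℝ) 1 zero_le_one t).2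
  rw [Real.smoothTransition.projIcc, Real.smoothTransition.projIcc, Real.dist_eq] at h1
  have h2 : dist (Set.projIcc (0 : ℝ) 1 zero_le_one s : ℝ) (Set.projIcc (0 : ℝ) 1 zero_le_one t)
      ≤ |s - t| := by
    rw [Real.dist_eq]
    exact Set.abs_projIcc_sub_projIcc zero_le_one
  calc _ ≤ _ := h1
    _ ≤ K * |s - t| := by gcongr
    _ ≤ (K + 1) * |s - t| := by gcongr; simp

/-- A radial cutoff that varies slowly with the logarithm of the radius: its difference at two
points is bounded by a small multiple of their relative distance. -/
theorem exists_slow_cutoff {δ : ℝ} (hδ : 0 < δ) :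
    ∃ τ : E → ℝ, ContDiff ℝ ∞ τ ∧ (∀ y, 0 ≤ τ y ∧ τ y ≤ 1) ∧ (∀ᶠ y in nhds 0, τ y = 0) ∧
      (∃ R, ∀ y, R ≤ ‖y‖ → τ y = 1) ∧
      ∀ y z, ‖z‖ ≤ ‖y‖ → |τ y - τ z| * ‖z‖ ≤ δ * ‖y - z‖ := by
  obtain ⟨L, hL, hLip⟩ := exists_lipschitz_smoothTransition
  set k := δ / (2 * L) with hk
  have hk0 : 0 < k := by positivity
  let τ : E → ℝ := fun y => Real.smoothTransition (k * Real.log (‖y‖ ^ 2))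
  have hzero : ∀ᶠ y in nhds (0 : E), τ y = 0 := by
    filter_upwards [Metric.ball_mem_nhds (0 : E) one_pos] with y hy
    have hy1 : ‖y‖ < 1 := by simpa using hy
    refine Real.smoothTransition.zero_of_nonpos (mul_nonpos_of_nonneg_of_nonpos hk0.le ?_)
    exact Real.log_nonpos (by positivity) (by nlinarith [norm_nonneg y])
  refine ⟨τ, contDiff_iff_contDiffAt.2 fun y => ?_,
    fun y => ⟨Real.smoothTransition.nonneg _, Real.smoothTransition.le_one _⟩, hzero,
    ⟨Real.exp (k⁻¹), fun y hy => ?_⟩, fun y z hzy => ?_⟩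
  · rcases eq_or_ne y 0 with rfl | hy
    · exact (contDiffAt_const (c := (0 : ℝ))).congr_of_eventuallyEq hzero
    · refine Real.smoothTransition.contDiffAt.comp y (contDiffAt_const.mul ?_)
      exact (contDiff_norm_sq ℝ).contDiffAt.log (by simpa using hy)
  · refine Real.smoothTransition.one_of_one_le ?_
    have h1 : k⁻¹ ≤ Real.log ‖y‖ := by
      rw [Real.le_log_iff_exp_le (lt_of_lt_of_le (Real.exp_pos _) hy)]
      exact hy
    rw [Real.log_pow]
    have h2 : k * k⁻¹ ≤ k * Real.log ‖y‖ := by gcongr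
    rw [mul_inv_cancel₀ hk0.ne'] at h2
    push_cast
    linarith
  · rcases (norm_nonneg z).eq_or_lt with h0 | h0
    · rw [← h0, mul_zero]; positivity
    have hy0 : 0 < ‖y‖ := h0.trans_le hzy
    -- `log r - log s ≤ (r - s) / s` for `s = ‖z‖ ≤ r = ‖y‖`
    have hlog : Real.log ‖y‖ - Real.log ‖z‖ ≤ (‖y‖ - ‖z‖) / ‖z‖ := by
      rw [← Real.log_div hy0.ne' h0.ne', sub_div, div_self h0.ne']
      exact Real.log_le_sub_one_of_pos (by positivity)
    have hlog0 : 0 ≤ Real.log ‖y‖ - Real.log ‖z‖ := sub_nonneg.2 (Real.log_le_log h0 hzy)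
    have h1 : |τ y - τ z| ≤ L * (2 * k * (Real.log ‖y‖ - Real.log ‖z‖)) := by
      refine (hLip _ _).trans (le_of_eq ?_)
      rw [Real.log_pow, Real.log_pow, ← mul_sub, ← mul_sub, abs_of_nonneg]
      · push_cast; ring
      · push_cast; positivity
    calc |τ y - τ z| * ‖z‖ ≤ L * (2 * k * ((‖y‖ - ‖z‖) / ‖z‖)) * ‖z‖ := by
          gcongr
          exact h1.trans (by gcongr)
      _ = δ * (‖y‖ - ‖z‖) := by rw [hk]; field_simp
      _ ≤ δ * ‖y - z‖ := by gcongr; exact norm_sub_norm_le y z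

/-! ### The inverse of `y ↦ a y + b f(y)` for a tamed map -/

variable [FiniteDimensional ℝ E]

/-- The map `y ↦ a y + b f(y)` is surjective: its image is open by the inverse function theorem, and
closed because the map is proper. -/
theorem IsTamedMap.surjective {W : E →L[ℝ] E} {f : E → E} (h : IsTamedMap W f) {p : ℝ × ℝ}
    (hp : p ≠ 0) : Function.Surjective fun y => p.1 • y + p.2 • f y := by
  have hf := h.1
  set g : E → E := fun y => p.1 • y + p.2 • f y with hg
  have hgd : ContDiff ℝ ∞ g := by fun_prop
  have hder : ∀ y, HasFDerivAt g (p.1 • ContinuousLinearMap.id ℝ E + p.2 • fderiv ℝ f y) y :=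
    fun y => ((hasFDerivAt_id y).const_smul p.1).add
      ((hf.differentiable (by simp) y).hasFDerivAt.const_smul p.2)
  have hinj : ∀ y, Function.Injective
      ((p.1 • ContinuousLinearMap.id ℝ E + p.2 • fderiv ℝ f y : E →L[ℝ] E) : E →ₗ[ℝ] E) := by
    intro y
    rw [injective_iff_map_eq_zero]
    intro v hv
    exact (h.tames_fderiv y).eq_zero_of_add_eq_zero hp hv
  have hopen : IsOpenMap g := by
    refine isOpenMap_of_hasStrictFDerivAt_equiv (𝕜 := ℝ) (f' := fun y =>
      (LinearEquiv.ofInjectiveEndo _ (hinj y)).toContinuousLinearEquiv) fun y => ?_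
    have h1 := hgd.contDiffAt (x := y) |>.hasStrictFDerivAt (by simp)
    rw [(hder y).fderiv] at h1
    exact h1
  have hclosed : IsClosed (Set.range g) := by
    by_cases hb : p.2 = 0
    · have ha : p.1 ≠ 0 := fun h4 => hp (Prod.ext h4 hb)
      have : Set.range g = Set.univ := Set.range_eq_univ.2 fun q =>
        ⟨p.1⁻¹ • q, by simp [hg, hb, smul_smul, ha]⟩
      rw [this]
      exact isClosed_univ
    · obtain ⟨-, hW, c, hc, hfc⟩ := h
      have hb' : 0 < |p.2| := abs_pos.2 hb
      have hanti : AntilipschitzWith (Real.toNNReal (‖W‖ / (|p.2| * c))) g := by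
        refine AntilipschitzWith.of_le_mul_dist fun y z => ?_
        rw [dist_eq_norm, dist_eq_norm, Real.coe_toNNReal _ (by positivity),
          div_mul_eq_mul_div, le_div_iff₀ (by positivity)]
        have e1 : inner ℝ (g y - g z) (W (y - z)) = p.2 * inner ℝ (f y - f z) (W (y - z)) := by
          have : g y - g z = p.1 • (y - z) + p.2 • (f y - f z) := by
            simp only [hg, smul_sub]; abel
          rw [this, inner_add_left, inner_smul_left, inner_smul_left, real_inner_comm, hW]
          simp
        have e2 : |p.2| * (c * ‖y - z‖ ^ 2) ≤ ‖g y - g z‖ * (‖W‖ * ‖y - z‖) := by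
          calc |p.2| * (c * ‖y - z‖ ^ 2) ≤ |p.2| * |inner ℝ (f y - f z) (W (y - z))| := by
                gcongr; exact (hfc y z).trans (le_abs_self _)
            _ = |inner ℝ (g y - g z) (W (y - z))| := by rw [e1, abs_mul]
            _ ≤ ‖g y - g z‖ * ‖W (y - z)‖ := abs_real_inner_le_norm _ _
            _ ≤ _ := by gcongr; exact W.le_opNorm _
        rcases (norm_nonneg (y - z)).eq_or_lt with h0 | h0
        · rw [← h0]; simp; positivity
        · refine le_of_mul_le_mul_left ?_ h0
          linarith
      have hproper : IsProperMap g := by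
        rw [isProperMap_iff_tendsto_cocompact]
        refine ⟨hgd.continuous, ?_⟩
        rw [← Metric.cobounded_eq_cocompact]
        exact hanti.tendsto_cobounded
      exact hproper.isClosed_range
  have hclopen : IsClopen (Set.range g) := ⟨hclosed, hopen.isOpen_range⟩
  exact Set.range_eq_univ.1 (hclopen.eq_univ (Set.range_nonempty g))

open Classical in
/-- The solution `y` of the equation `a y + b f(y) = q`, as a function of `((a, b), q)` (and `0` if
there is no solution). -/
noncomputable def tamedSolution (f : E → E) (x : (ℝ × ℝ) × E) : E :=
  if h : ∃ y, x.1.1 • y + x.1.2 • f y = x.2 then h.choose else 0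

theorem IsTamedMap.apply_tamedSolution {W : E →L[ℝ] E} {f : E → E} (h : IsTamedMap W f)
    {p : ℝ × ℝ} (hp : p ≠ 0) (q : E) :
    p.1 • tamedSolution f (p, q) + p.2 • f (tamedSolution f (p, q)) = q := by
  have hex : ∃ y, p.1 • y + p.2 • f y = q := h.surjective hp q
  rw [tamedSolution, dif_pos hex]
  exact hex.choose_spec

theorem IsTamedMap.tamedSolution_eq {W : E →L[ℝ] E} {f : E → E} (h : IsTamedMap W f)
    {p : ℝ × ℝ} (hp : p ≠ 0) {q y : E} (hy : p.1 • y + p.2 • f y = q) :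
    tamedSolution f (p, q) = y :=
  h.eq_of_eq hp (by rw [h.apply_tamedSolution hp, hy])

/-- Smoothness of the solution, by the inverse function theorem applied to
`(p, y) ↦ (p, p₁ y + p₂ f(y))`. -/
theorem IsTamedMap.contDiffAt_tamedSolution {W : E →L[ℝ] E} {f : E → E} (h : IsTamedMap W f)
    {x : (ℝ × ℝ) × E} (hx : x.1 ≠ 0) : ContDiffAt ℝ ∞ (tamedSolution f) x := by
  have hf := h.1
  set G : (ℝ × ℝ) × E → (ℝ × ℝ) × E := fun z => (z.1, z.1.1 • z.2 + z.1.2 • f z.2) with hG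
  have hGd : ContDiff ℝ ∞ G := by fun_prop
  set z₀ : (ℝ × ℝ) × E := (x.1, tamedSolution f x) with hz₀
  have hGz : G z₀ = x := Prod.ext rfl (h.apply_tamedSolution hx x.2)
  have hD : HasFDerivAt G (fderiv ℝ G z₀) z₀ := (hGd.differentiable (by simp) z₀).hasFDerivAt
  have hinj : Function.Injective (fderiv ℝ G z₀ : (ℝ × ℝ) × E →ₗ[ℝ] (ℝ × ℝ) × E) := by
    rw [injective_iff_map_eq_zero]
    rintro ⟨v, w⟩ hvw
    have hvw : fderiv ℝ G z₀ (v, w) = 0 := hvw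
    have h1 : (fderiv ℝ G z₀ (v, w)).1 = v := by
      have e1 := hD.fst
      have e2 : HasFDerivAt (fun z : (ℝ × ℝ) × E => (G z).1)
        (ContinuousLinearMap.fst ℝ (ℝ × ℝ) E) z₀ := hasFDerivAt_fst
      exact congrArg (fun l => l (v, w)) (e1.unique e2)
    rw [hvw] at h1
    have hv : v = 0 := h1.symm
    subst hv
    have h2 : HasFDerivAt (fun y => (G (x.1, y)).2)
        (x.1.1 • ContinuousLinearMap.id ℝ E + x.1.2 • fderiv ℝ f z₀.2) z₀.2 :=
      ((hasFDerivAt_id z₀.2).const_smul x.1.1).add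
        ((hf.differentiable (by simp) z₀.2).hasFDerivAt.const_smul x.1.2)
    have h3 : HasFDerivAt (fun y => (G (x.1, y)).2) _ z₀.2 :=
      (hD.comp z₀.2 (hasFDerivAt_prodMk_right x.1 z₀.2)).snd
    have h4 := congrArg (fun l => l w) (h2.unique h3)
    have h5 : x.1.1 • w + x.1.2 • fderiv ℝ f z₀.2 w = (fderiv ℝ G z₀ (0, w)).2 := h4
    rw [hvw] at h5
    rw [(h.tames_fderiv z₀.2).eq_zero_of_add_eq_zero hx h5]
    rfl
  let D : ((ℝ × ℝ) × E) ≃L[ℝ] ((ℝ × ℝ) × E) :=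
    (LinearEquiv.ofInjectiveEndo _ hinj).toContinuousLinearEquiv
  have hstrict : HasStrictFDerivAt G (D : (ℝ × ℝ) × E →L[ℝ] (ℝ × ℝ) × E) z₀ :=
    hGd.contDiffAt.hasStrictFDerivAt (by simp)
  have hsm := hGd.contDiffAt.to_localInverse (𝕂 := ℝ) hstrict.hasFDerivAt (by simp)
  rw [hGz] at hsm
  have hsm2 := hsm.snd
  refine hsm2.congr_of_eventuallyEq ?_
  have hr := hstrict.eventually_right_inverse
  rw [hGz] at hr
  have hne : ∀ᶠ z : (ℝ × ℝ) × E in nhds x, z.1 ≠ 0 :=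
    continuous_fst.continuousAt.eventually_ne hx
  filter_upwards [hr, hne] with z hz hz0
  have e1 := congrArg Prod.fst hz
  have e2 := congrArg Prod.snd hz
  refine h.tamedSolution_eq (p := z.1) hz0 ?_
  simp only [hG] at e1 e2
  rw [e1] at e2
  exact e2

/-! ### Interpolation between linear maps tamed by the same skew map -/

/-- If `W` tames both `φ` and `U`, then there is a map tamed by `W` which is `φ` near the origin
and `U` near infinity. -/
theorem Tames.exists_isTamedMap {W φ U : E →L[ℝ] E} (hφ : Tames W φ) (hU : Tames W U) :
    ∃ f : E → E, IsTamedMap W f ∧ (∀ᶠ y in nhds 0, f y = φ y) ∧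
      ∃ R, ∀ y, R ≤ ‖y‖ → f y = U y := by
  obtain ⟨c₁, hc₁, h₁⟩ := exists_coercive _ _ hφ.2
  obtain ⟨c₂, hc₂, h₂⟩ := exists_coercive _ _ hU.2
  set c := min c₁ c₂ with hc
  have hc0 : 0 < c := lt_min hc₁ hc₂
  set N := ‖U - φ‖ * ‖W‖ + 1 with hN
  have hN0 : 0 < N := by positivity
  obtain ⟨τ, hτ, hτ01, hτ0, ⟨R, hτ1⟩, hslow⟩ :=
    exists_slow_cutoff (E := E) (δ := c / (2 * N)) (by positivity)
  let f : E → E := fun y => φ y + τ y • (U - φ) y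
  have key : ∀ y z, ‖z‖ ≤ ‖y‖ → c / 2 * ‖y - z‖ ^ 2 ≤ inner ℝ (f y - f z) (W (y - z)) := by
    intro y z hzy
    set d := y - z with hd
    have e1 : f y - f z = ((1 - τ y) • φ d + τ y • U d) + (τ y - τ z) • (U - φ) z := by
      have : y = d + z := by rw [hd]; abel
      simp only [f]
      rw [show φ y = φ d + φ z by rw [← map_add, ← this],
        show (U - φ) y = U d - φ d + (U - φ) z by
          rw [this, map_add, sub_apply]]
      simp only [smul_add, smul_sub, sub_smul, one_smul, sub_apply]
      abel
    have e2 : c * ‖d‖ ^ 2 ≤ inner ℝ ((1 - τ y) • φ d + τ y • U d) (W d) := by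
      rw [inner_add_left, inner_smul_left, inner_smul_left, conj_trivial, conj_trivial]
      have a1 : c * ‖d‖ ^ 2 ≤ inner ℝ (φ d) (W d) :=
        le_trans (by gcongr; exact min_le_left _ _) (h₁ d)
      have a2 : c * ‖d‖ ^ 2 ≤ inner ℝ (U d) (W d) :=
        le_trans (by gcongr; exact min_le_right _ _) (h₂ d)
      have b1 := mul_le_mul_of_nonneg_left a1 (sub_nonneg.2 (hτ01 y).2)
      have b2 := mul_le_mul_of_nonneg_left a2 (hτ01 y).1
      linarith
    have e3 : |inner ℝ ((τ y - τ z) • (U - φ) z) (W d)| ≤ c / 2 * ‖d‖ ^ 2 := by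
      calc _ ≤ ‖(τ y - τ z) • (U - φ) z‖ * ‖W d‖ := abs_real_inner_le_norm _ _
        _ ≤ (|τ y - τ z| * (‖U - φ‖ * ‖z‖)) * (‖W‖ * ‖d‖) := by
          rw [norm_smul, Real.norm_eq_abs]
          gcongr
          · exact (U - φ).le_opNorm z
          · exact W.le_opNorm d
        _ = (|τ y - τ z| * ‖z‖) * ((‖U - φ‖ * ‖W‖) * ‖d‖) := by ring
        _ ≤ (c / (2 * N) * ‖d‖) * (N * ‖d‖) := by
          have hN' : ‖U - φ‖ * ‖W‖ ≤ N := by rw [hN]; linarith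
          exact mul_le_mul (hslow y z hzy) (mul_le_mul_of_nonneg_right hN' (norm_nonneg d))
            (by positivity) (by positivity)
        _ = c / 2 * ‖d‖ ^ 2 := by field_simp
    rw [e1, inner_add_left]
    have := (abs_le.1 e3).1
    linarith
  refine ⟨f, ⟨?_, hφ.1, c / 2, by positivity, fun y z => ?_⟩, ?_, R, fun y hy => ?_⟩
  · exact φ.contDiff.add (hτ.smul (U - φ).contDiff)
  · rcases le_total ‖z‖ ‖y‖ with h | h
    · exact key y z h
    · have := key z y h
      rw [← neg_sub (f y), ← neg_sub y, map_neg, inner_neg_neg, norm_neg] at this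
      exact this
  · filter_upwards [hτ0] with y hy
    simp [f, hy]
  · simp [f, hτ1 y hy]

end TamedMap

/-! ### Positively oriented pairs of vectors -/

namespace OrientedPlane

variable {n : ℕ}

instance instFactFinrankPlane (P : OrientedPlane n) : Fact (Module.finrank ℝ P.plane = 2) :=
  ⟨P.finrank_plane⟩

theorem rot_rot (P : OrientedPlane n) (x : P.plane) : P.rot (P.rot x) = -x :=
  P.orient.rightAngleRotation_rightAngleRotation x

theorem inner_rot_self (P : OrientedPlane n) (x : P.plane) : inner ℝ (P.rot x) x = 0 :=
  P.orient.inner_rightAngleRotation_self x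

theorem inner_rot_left (P : OrientedPlane n) (x y : P.plane) :
    inner ℝ (P.rot x) y = P.orient.areaForm x y :=
  P.orient.inner_rightAngleRotation_left x y

theorem _root_.Module.Basis.orientation_eq_iff_areaForm_pos {E : Type*} [NormedAddCommGroup E]
    [InnerProductSpace ℝ E] [Fact (Module.finrank ℝ E = 2)] (b : Module.Basis (Fin 2) ℝ E)
    (o : Orientation ℝ E (Fin 2)) : b.orientation = o ↔ 0 < o.areaForm (b 0) (b 1) := by
  have h2 : Module.finrank ℝ E = 2 := Fact.out
  let e := o.finOrthonormalBasis two_pos h2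
  have he : e.toBasis.orientation = o := o.finOrthonormalBasis_orientation two_pos h2
  rw [o.areaForm_to_volumeForm, o.volumeForm_robust e he]
  have hb : (![b 0, b 1] : Fin 2 → E) = b := by
    ext i; fin_cases i <;> rfl
  rw [hb, ← Module.Basis.orientation_eq_iff_det_pos, he, eq_comm]

/-- `(u, v)` is a positively oriented basis of the oriented plane `Q`. -/
def PosPair (Q : OrientedPlane n) (u v : Amb n) : Prop :=
  ∃ b : Module.Basis (Fin 2) ℝ Q.plane, (b 0 : Amb n) = u ∧ (b 1 : Amb n) = v ∧
    b.orientation = Q.orient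

theorem PosPair.mem_left {Q : OrientedPlane n} {u v : Amb n} (h : Q.PosPair u v) :
    u ∈ Q.plane := by
  obtain ⟨b, rfl, -, -⟩ := h
  exact (b 0).2

theorem PosPair.mem_right {Q : OrientedPlane n} {u v : Amb n} (h : Q.PosPair u v) :
    v ∈ Q.plane := by
  obtain ⟨b, -, rfl, -⟩ := h
  exact (b 1).2

theorem posPair_coe_iff {Q : OrientedPlane n} {u v : Q.plane} :
    Q.PosPair u v ↔ 0 < inner ℝ (Q.rot u : Amb n) v := by
  rw [← Submodule.coe_inner, inner_rot_left]
  constructor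
  · rintro ⟨b, hu, hv, hb⟩
    rw [b.orientation_eq_iff_areaForm_pos, Subtype.ext hu, Subtype.ext hv] at hb
    exact hb
  · intro h
    have hu : u ≠ 0 := by
      rintro rfl
      simp at h
    have hli : LinearIndependent ℝ ![u, v] := by
      rw [LinearIndependent.pair_iff' hu]
      rintro c rfl
      simp at h
    let b := basisOfLinearIndependentOfCardEqFinrank hli (by simp [Q.finrank_plane])
    have hb : ⇑b = ![u, v] := coe_basisOfLinearIndependentOfCardEqFinrank _ _
    refine ⟨b, by rw [hb]; rfl, by rw [hb]; rfl, ?_⟩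
    rw [b.orientation_eq_iff_areaForm_pos, hb]
    exact h

theorem PosPair.plane_eq {Q : OrientedPlane n} {u v : Amb n} (h : Q.PosPair u v) :
    Q.plane = Submodule.span ℝ {u, v} := by
  obtain ⟨b, rfl, rfl, -⟩ := h
  have h1 := congrArg (Submodule.map Q.plane.subtype) b.span_eq
  rw [Submodule.map_span, Submodule.map_subtype_top] at h1
  refine h1.symm.trans (congrArg _ ?_)
  ext x
  simp [Fin.exists_fin_two, eq_comm]

theorem PosPair.eq {Q Q' : OrientedPlane n} {u v : Amb n} (h : Q.PosPair u v)
    (h' : Q'.PosPair u v) : Q = Q' := by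
  have hplane : Q.plane = Q'.plane := by rw [h.plane_eq, h'.plane_eq]
  obtain ⟨E, hE, o⟩ := Q
  obtain ⟨E', hE', o'⟩ := Q'
  obtain rfl : E = E' := hplane
  obtain ⟨b, hu, hv, hb⟩ := h
  obtain ⟨b', hu', hv', hb'⟩ := h'
  have : b = b' := by
    refine Module.Basis.eq_of_apply_eq fun i => ?_
    fin_cases i
    · exact Subtype.ext (hu.trans hu'.symm)
    · exact Subtype.ext (hv.trans hv'.symm)
  subst this
  obtain rfl : o = o' := hb.symm.trans hb'
  rfl

theorem exists_posPair {u v : Amb n} (h : LinearIndependent ℝ ![u, v]) :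
    ∃ Q : OrientedPlane n, Q.PosPair u v := by
  let b := Module.Basis.span h
  refine ⟨⟨_, by simpa using finrank_span_eq_card h, b.orientation⟩, b, ?_, ?_, rfl⟩
  · exact congrArg Subtype.val (Module.Basis.span_apply h 0)
  · exact congrArg Subtype.val (Module.Basis.span_apply h 1)

/-- The map `x ↦ x + L x` preserves orientations. -/
theorem PosPair.graph {P : OrientedPlane n} {u v : P.plane} (h : P.PosPair u v)
    (L : P.HomPerp) : (P.graph L).PosPair (P.graphMap L u) (P.graphMap L v) := by
  obtain ⟨b, hu, hv, hb⟩ := h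
  refine ⟨b.map (LinearEquiv.ofInjective (P.graphMap L) (P.graphMap_injective L)), ?_, ?_, ?_⟩
  · rw [Subtype.ext hu.symm]; rfl
  · rw [Subtype.ext hv.symm]; rfl
  · exact (b.orientation_map _).trans (congrArg _ hb)

theorem posPair_rot {P : OrientedPlane n} {u : P.plane} (hu : u ≠ 0) :
    P.PosPair u (P.rot u) := by
  rw [posPair_coe_iff, ← Submodule.coe_inner]
  exact real_inner_self_pos.2 (by simpa using hu)

/-! ### Complex lines -/

/-- `Q` is a complex line for the complex structure `J`, oriented by `J`. -/
def IsLine (J : Amb n →L[ℝ] Amb n) (Q : OrientedPlane n) : Prop :=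
  ∀ x : Q.plane, (Q.rot x : Amb n) = J x

variable {J : Amb n →L[ℝ] Amb n}

theorem IsLine.map_mem {Q : OrientedPlane n} (h : IsLine J Q) {x : Amb n} (hx : x ∈ Q.plane) :
    J x ∈ Q.plane := by
  rw [← h ⟨x, hx⟩]
  exact (Q.rot ⟨x, hx⟩).2

theorem IsLine.posPair {Q : OrientedPlane n} (h : IsLine J Q) {x : Amb n} (hx : x ∈ Q.plane)
    (hx0 : x ≠ 0) : Q.PosPair x (J x) := by
  rw [← h ⟨x, hx⟩]
  exact posPair_rot (u := ⟨x, hx⟩) fun h0 => hx0 (congrArg Subtype.val h0)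

theorem IsLine.eq {Q Q' : OrientedPlane n} (h : IsLine J Q) (h' : IsLine J Q') {x : Amb n}
    (hx : x ∈ Q.plane) (hx' : x ∈ Q'.plane) (hx0 : x ≠ 0) : Q = Q' :=
  (h.posPair hx hx0).eq (h'.posPair hx' hx0)

/-- A plane is a complex line as soon as one of the pairs `(x, J x)` is a positively oriented basis
of it: the unit vector `J x / ‖x‖` is orthogonal to `x`, and so it is that of the rotation. -/
theorem PosPair.isLine (hJ : IsOrthComplex J) {Q : OrientedPlane n} {x : Amb n}
    (h : Q.PosPair x (J x)) : IsLine J Q := by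
  have hx := h.mem_left
  have hJx := h.mem_right
  have hpos := (posPair_coe_iff (u := ⟨x, hx⟩) (v := ⟨J x, hJx⟩)).1 h
  have key : Q.rot ⟨x, hx⟩ = ⟨J x, hJx⟩ := by
    have h1 := Q.orient.inner_sq_add_areaForm_sq ⟨x, hx⟩ ⟨J x, hJx⟩
    rw [← Submodule.coe_inner, inner_rot_left] at hpos
    have h2 : inner ℝ (⟨x, hx⟩ : Q.plane) ⟨J x, hJx⟩ = 0 := by
      rw [Submodule.coe_inner, real_inner_comm]; exact hJ.1 x
    have h3 : ‖(⟨J x, hJx⟩ : Q.plane)‖ = ‖(⟨x, hx⟩ : Q.plane)‖ := hJ.norm_map x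
    rw [h2, h3] at h1
    have h4 : Q.orient.areaForm ⟨x, hx⟩ ⟨J x, hJx⟩ = ‖(⟨x, hx⟩ : Q.plane)‖ ^ 2 := by
      rw [← sq_eq_sq₀ hpos.le (by positivity)]
      linarith
    rw [← sub_eq_zero, ← norm_eq_zero, ← sq_eq_zero_iff, norm_sub_sq_real, inner_rot_left, h4, h3,
      LinearIsometryEquiv.norm_map]
    ring
  have hspan := h.plane_eq
  rintro ⟨z, hz⟩
  obtain ⟨a, b, hab⟩ := Submodule.mem_span_pair.1 (hspan ▸ hz)
  have hz' : (⟨z, hz⟩ : Q.plane) = a • ⟨x, hx⟩ + b • Q.rot ⟨x, hx⟩ := by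
    rw [key]; exact Subtype.ext hab.symm
  have e1 : Q.rot ⟨z, hz⟩ = a • ⟨J x, hJx⟩ + b • -⟨x, hx⟩ := by
    rw [hz', map_add, map_smul, map_smul, rot_rot, key]
  rw [e1]
  change a • J x + b • -x = J z
  rw [← hab, map_add, map_smul, map_smul, hJ.2]

theorem exists_isLine (hJ : IsOrthComplex J) {x : Amb n} (hx : x ≠ 0) :
    ∃ Q : OrientedPlane n, IsLine J Q ∧ x ∈ Q.plane := by
  have hli : LinearIndependent ℝ ![x, J x] := by
    rw [LinearIndependent.pair_iff' hx]
    exact fun c hc => hx (hJ.tames.noRealEigenvalue c x hc.symm)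
  obtain ⟨Q, hQ⟩ := exists_posPair hli
  exact ⟨Q, hQ.isLine hJ, hQ.mem_left⟩

/-! ### Graphs -/

theorem coe_graphMap (P : OrientedPlane n) (L : P.HomPerp) (p : P.plane) :
    P.graphMap L p = (p : Amb n) + (L p : Amb n) := rfl

theorem graphMap_mem (P : OrientedPlane n) (L : P.HomPerp) (p : P.plane) :
    P.graphMap L p ∈ (P.graph L).plane := ⟨p, rfl⟩

theorem proj_graphMap (P : OrientedPlane n) (L : P.HomPerp) (p : P.plane) :
    P.plane.orthogonalProjectionOnto (P.graphMap L p) = p := by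
  rw [coe_graphMap, map_add, Submodule.orthogonalProjectionOnto_mem_subspace_eq_self,
    Submodule.orthogonalProjectionOnto_apply_of_mem_orthogonal (L p).2, add_zero]

theorem proj_perp_graphMap (P : OrientedPlane n) (L : P.HomPerp) (p : P.plane) :
    P.planeᗮ.orthogonalProjectionOnto (P.graphMap L p) = L p := by
  rw [coe_graphMap, map_add, Submodule.orthogonalProjectionOnto_mem_subspace_eq_self,
    Submodule.orthogonalProjectionOnto_orthogonal_apply_eq_zero p.2, zero_add]

theorem proj_add_proj_perp (P : OrientedPlane n) (x : Amb n) :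
    (P.plane.orthogonalProjectionOnto x : Amb n) + (P.planeᗮ.orthogonalProjectionOnto x : Amb n)
      = x :=
  P.plane.starProjection_add_starProjection_orthogonal x

theorem mem_graph_iff (P : OrientedPlane n) (L : P.HomPerp) (x : Amb n) :
    x ∈ (P.graph L).plane ↔
      L (P.plane.orthogonalProjectionOnto x) = P.planeᗮ.orthogonalProjectionOnto x := by
  constructor
  · rintro ⟨p, rfl⟩
    rw [proj_graphMap, proj_perp_graphMap]
  · intro h
    refine ⟨P.plane.orthogonalProjectionOnto x, ?_⟩
    rw [coe_graphMap, h, proj_add_proj_perp]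

theorem graph_injective (P : OrientedPlane n) : Function.Injective P.graph := by
  intro L L' h
  ext1 p
  have h1 := P.graphMap_mem L p
  rw [h, mem_graph_iff, proj_graphMap, proj_perp_graphMap] at h1
  exact h1.symm

end OrientedPlane

/-! ### Local trivializations -/

/-- The direction of a nonzero vector of `ℝ²`, as a point of the circle. -/
noncomputable def circleDir (p : ℝ × ℝ) : Circle := Circle.exp (Complex.arg ⟨p.1, p.2⟩)

theorem norm_mul_circleDir (p : ℝ × ℝ) :
    (‖(⟨p.1, p.2⟩ : ℂ)‖ : ℂ) * circleDir p = ⟨p.1, p.2⟩ := by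
  rw [circleDir, Circle.coe_exp]
  exact Complex.norm_mul_exp_arg_mul_I _

theorem complex_mk_ne_zero {p : ℝ × ℝ} (hp : p ≠ 0) : (⟨p.1, p.2⟩ : ℂ) ≠ 0 := fun h =>
  hp (Prod.ext (congrArg Complex.re h) (congrArg Complex.im h))

theorem circleDir_eq {p : ℝ × ℝ} {c : Circle} {r : ℝ} (hr : 0 < r)
    (h : (r : ℂ) * c = ⟨p.1, p.2⟩) : circleDir p = c := by
  have hn : ‖(⟨p.1, p.2⟩ : ℂ)‖ = r := by
    rw [← h, norm_mul, Circle.norm_coe, mul_one, Complex.norm_of_nonneg hr.le]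
  have h1 := norm_mul_circleDir p
  rw [hn, ← h] at h1
  exact Circle.ext (mul_left_cancel₀ (Complex.ofReal_ne_zero.2 hr.ne') h1)

theorem contMDiffAt_circleDir {p : ℝ × ℝ} (hp : p ≠ 0) :
    ContMDiffAt 𝓘(ℝ, ℝ × ℝ) (𝓡 1) ∞ circleDir p := by
  let ζ : ℝ × ℝ → ℂ := fun q => Complex.equivRealProdCLM.symm q
  have hζ : ∀ q, ζ q = ⟨q.1, q.2⟩ := fun q => rfl
  have hζd : ContDiff ℝ ∞ ζ := Complex.equivRealProdCLM.symm.contDiff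
  have hp' : ζ p ≠ 0 := complex_mk_ne_zero hp
  -- near `p`, the angle relative to that of `p` is given by the principal branch of the logarithm
  have hloc : ∀ᶠ q in nhds p, circleDir q =
      circleDir p * Circle.exp (Complex.log (ζ q / ζ p)).im := by
    filter_upwards [continuousAt_id.eventually_ne hp] with q hq
    have hq' : ζ q ≠ 0 := complex_mk_ne_zero hq
    refine circleDir_eq (r := ‖ζ q‖) (norm_pos_iff.2 hq') ?_
    rw [← hζ, Circle.coe_mul, Complex.log_im, Circle.coe_exp]
    have e1 := norm_mul_circleDir p
    have e2 := Complex.norm_mul_exp_arg_mul_I (ζ q / ζ p)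
    rw [← hζ] at e1
    have e3 : (‖ζ q‖ : ℂ) = ‖ζ q / ζ p‖ * ‖ζ p‖ := by
      rw [norm_div]; push_cast
      rw [div_mul_cancel₀]
      simpa using hp'
    calc (‖ζ q‖ : ℂ) * (circleDir p * Complex.exp (Complex.arg (ζ q / ζ p) * Complex.I))
        = (‖ζ q / ζ p‖ * Complex.exp (Complex.arg (ζ q / ζ p) * Complex.I)) *
          (‖ζ p‖ * circleDir p) := by rw [e3]; ring
      _ = ζ q := by rw [e1, e2, div_mul_cancel₀ _ hp']
  refine ContMDiffAt.congr_of_eventuallyEq ?_ hloc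
  have hdiff : ContDiffAt ℝ ∞ (fun q => (Complex.log (ζ q / ζ p)).im) p := by
    have h1 : ContDiffAt ℝ ∞ (fun q => ζ q / ζ p) p := by
      simp only [div_eq_mul_inv]
      exact hζd.contDiffAt.mul contDiffAt_const
    have h2 : ContDiffAt ℝ ∞ Complex.log (ζ p / ζ p) :=
      (Complex.contDiffAt_log (n := ∞) (by rw [div_self hp']; exact Complex.one_mem_slitPlane)
        ).restrict_scalars ℝ
    exact Complex.imCLM.contDiff.contDiffAt.comp p (h2.comp p h1)
  have hexp : ContMDiffAt 𝓘(ℝ, ℝ × ℝ) (𝓡 1) ∞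
      (fun q => Circle.exp (Complex.log (ζ q / ζ p)).im) p :=
    (contMDiff_circleExp.contMDiffAt (x := _)).comp p hdiff.contMDiffAt
  have hconst : ContMDiffAt 𝓘(ℝ, ℝ × ℝ) (𝓡 1) ∞ (fun _ => circleDir p) p := contMDiffAt_const
  exact hconst.mul hexp

theorem contMDiff_circle_coe : ContMDiff (𝓡 1) 𝓘(ℝ, ℂ) ∞ fun c : Circle => (c : ℂ) :=
  have : Fact (Module.finrank ℝ ℂ = 1 + 1) := finrank_real_complex_fact'
  contMDiff_coe_sphere

namespace OrientedPlane

variable {n : ℕ}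

/-- The coordinates of the projection to `P` with respect to the basis `e`, `P.rot e`. -/
noncomputable def coord (P : OrientedPlane n) (e : P.plane) : Amb n →L[ℝ] ℝ × ℝ :=
  (innerSL ℝ (e : Amb n)).prod (innerSL ℝ (P.rot e : Amb n))

theorem coord_apply (P : OrientedPlane n) (e : P.plane) (x : Amb n) :
    P.coord e x = (inner ℝ (e : Amb n) x, inner ℝ (P.rot e : Amb n) x) := rfl

variable {P : OrientedPlane n} {e : P.plane}

theorem proj_eq (he : ‖e‖ = 1) (x : Amb n) :
    P.plane.orthogonalProjectionOnto x = (P.coord e x).1 • e + (P.coord e x).2 • P.rot e := by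
  refine ext_inner_right ℝ fun z => ?_
  have h1 := P.orient.inner_mul_inner_add_areaForm_mul_areaForm e
    (P.plane.orthogonalProjectionOnto x) z
  rw [he, one_pow, one_mul] at h1
  rw [← h1, inner_add_left, inner_smul_left, inner_smul_left, coord_apply, ← inner_rot_left,
    ← inner_rot_left]
  simp

theorem coord_smul_add (he : ‖e‖ = 1) (a b : ℝ) :
    P.coord e (a • e + b • P.rot e : P.plane) = (a, b) := by
  have h1 : ‖P.rot e‖ = 1 := by rw [LinearIsometryEquiv.norm_map, he]
  have h2 := P.inner_rot_self e
  rw [coord_apply, ← Submodule.coe_inner, ← Submodule.coe_inner]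
  simp only [inner_add_right, inner_smul_right, h2, real_inner_comm (P.rot e) e,
    real_inner_self_eq_norm_sq, he, h1]
  simp

theorem eq_of_coord_eq (he : ‖e‖ = 1) {p q : P.plane} (h : P.coord e p = P.coord e q) :
    p = q := by
  rw [← P.plane.orthogonalProjectionOnto_mem_subspace_eq_self p,
    ← P.plane.orthogonalProjectionOnto_mem_subspace_eq_self q, proj_eq he, proj_eq he, h]

theorem coord_graphMap (L : P.HomPerp) (p : P.plane) :
    P.coord e (P.graphMap L p) = P.coord e p := by
  rw [coord_apply, coord_apply, coe_graphMap, inner_add_right, inner_add_right,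
    Submodule.inner_right_of_mem_orthogonal e.2 (L p).2,
    Submodule.inner_right_of_mem_orthogonal (P.rot e).2 (L p).2, add_zero, add_zero]

/-- The linear map `P → Pᗮ` that takes `e` to `y` and `P.rot e` to `f y`, for a unit vector `e`. -/
noncomputable def framedMap (P : OrientedPlane n) (e : P.plane) (f : P.planeᗮ → P.planeᗮ)
    (y : P.planeᗮ) : P.HomPerp :=
  (innerSL ℝ e).smulRight y + (innerSL ℝ (P.rot e)).smulRight (f y)

variable {f : P.planeᗮ → P.planeᗮ}

theorem framedMap_apply (y : P.planeᗮ) (p : P.plane) :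
    P.framedMap e f y p = (P.coord e p).1 • y + (P.coord e p).2 • f y := rfl

theorem mem_graph_framedMap_iff (he : ‖e‖ = 1) (y : P.planeᗮ) (x : Amb n) :
    x ∈ (P.graph (P.framedMap e f y)).plane ↔
      (P.coord e x).1 • y + (P.coord e x).2 • f y = P.planeᗮ.orthogonalProjectionOnto x := by
  rw [mem_graph_iff, framedMap_apply, proj_eq he, coord_smul_add he]

theorem coord_ne_zero_of_mem (he : ‖e‖ = 1) {L : P.HomPerp} {x : Amb n}
    (hx : x ∈ (P.graph L).plane) (hx0 : x ≠ 0) : P.coord e x ≠ 0 := by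
  intro h0
  obtain ⟨p, rfl⟩ := hx
  rw [coord_graphMap] at h0
  have : p = 0 := eq_of_coord_eq he (by rw [h0]; simp)
  exact hx0 (by rw [this, map_zero])

theorem mem_plane_iff_proj_perp (x : Amb n) :
    x ∈ P.plane ↔ P.planeᗮ.orthogonalProjectionOnto x = 0 := by
  rw [Submodule.orthogonalProjectionOnto_eq_zero_iff, Submodule.orthogonal_orthogonal]

theorem finrank_perp (P : OrientedPlane n) : Module.finrank ℝ P.planeᗮ = 2 * n := by
  have h1 := P.plane.finrank_add_finrank_orthogonal
  rw [P.finrank_plane, finrank_euclideanSpace_fin] at h1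
  omega

/-- A linear coordinate system of the orthogonal complement of `P`. -/
noncomputable def perpEquiv (P : OrientedPlane n) :
    P.planeᗮ ≃L[ℝ] EuclideanSpace ℝ (Fin (2 * n)) :=
  ContinuousLinearEquiv.ofFinrankEq (by rw [P.finrank_perp, finrank_euclideanSpace_fin])

/-- The point of `P` with complex coordinate `c`. -/
noncomputable def circlePoint (P : OrientedPlane n) (e : P.plane) (c : ℂ) : P.plane :=
  c.re • e + c.im • P.rot e

theorem circlePoint_ne_zero (he : ‖e‖ = 1) (c : Circle) : P.circlePoint e c ≠ 0 := by
  intro h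
  have h1 := coord_smul_add he (c : ℂ).re (c : ℂ).im
  rw [circlePoint] at h
  rw [h] at h1
  have h2 : (c : ℂ) = 0 := by
    apply Complex.ext
    · simpa using (congrArg Prod.fst h1).symm
    · simpa using (congrArg Prod.snd h1).symm
  exact Circle.coe_ne_zero c h2

/-- The point with complex coordinate `c` in the plane spanned by `e + y` and `P.rot e + f y`. -/
noncomputable def fibrePoint (P : OrientedPlane n) (e : P.plane) (f : P.planeᗮ → P.planeᗮ)
    (y : P.planeᗮ) (c : ℂ) : Amb n :=
  P.graphMap (P.framedMap e f y) (P.circlePoint e c)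

theorem fibrePoint_ne_zero (he : ‖e‖ = 1) (y : P.planeᗮ) (c : Circle) :
    P.fibrePoint e f y c ≠ 0 := fun h =>
  circlePoint_ne_zero he c (P.graphMap_injective _ (h.trans (map_zero _).symm))

theorem coord_fibrePoint (he : ‖e‖ = 1) (y : P.planeᗮ) (c : ℂ) :
    P.coord e (P.fibrePoint e f y c) = (c.re, c.im) := by
  rw [fibrePoint, coord_graphMap, circlePoint, coord_smul_add he]

theorem fibrePoint_eq (he : ‖e‖ = 1) (y : P.planeᗮ) (c : ℂ) :
    P.fibrePoint e f y c =
      (c.re • (e : Amb n) + c.im • (P.rot e : Amb n)) + (c.re • (y : Amb n) + c.im • (f y : Amb n)) := by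
  rw [fibrePoint, coe_graphMap, framedMap_apply, circlePoint, coord_smul_add he]
  rfl

/-- The normalization of `fibrePoint`, a point of the sphere. -/
noncomputable def spherePoint (f : P.planeᗮ → P.planeᗮ) (he : ‖e‖ = 1) (y : P.planeᗮ)
    (c : Circle) : Sph n :=
  ⟨‖P.fibrePoint e f y c‖⁻¹ • P.fibrePoint e f y c, by
    simp [norm_smul, fibrePoint_ne_zero he y c]⟩

theorem coe_spherePoint (he : ‖e‖ = 1) (y : P.planeᗮ) (c : Circle) :
    (spherePoint f he y c : Amb n) = ‖P.fibrePoint e f y c‖⁻¹ • P.fibrePoint e f y c := rfl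

/-- The parameter `y` of the plane through `x` spanned by `e + y` and `P.rot e + f y`. -/
noncomputable def fibreParam (P : OrientedPlane n) (e : P.plane) (f : P.planeᗮ → P.planeᗮ)
    (x : Amb n) : P.planeᗮ :=
  tamedSolution f (P.coord e x, P.planeᗮ.orthogonalProjectionOnto x)

variable {W : P.planeᗮ →L[ℝ] P.planeᗮ}

theorem mem_graph_framedMap_iff_fibreParam (he : ‖e‖ = 1) (hf : IsTamedMap W f) {y : P.planeᗮ}
    {x : Amb n} (hx : P.coord e x ≠ 0) :
    x ∈ (P.graph (P.framedMap e f y)).plane ↔ P.fibreParam e f x = y := by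
  rw [mem_graph_framedMap_iff he]
  constructor
  · exact fun h => hf.tamedSolution_eq hx h
  · rintro rfl
    exact hf.apply_tamedSolution hx _

theorem contDiffAt_fibreParam (hf : IsTamedMap W f) {x : Amb n} (hx : P.coord e x ≠ 0) :
    ContDiffAt ℝ ∞ (P.fibreParam e f) x :=
  (hf.contDiffAt_tamedSolution (x := (P.coord e x, P.planeᗮ.orthogonalProjectionOnto x)) hx).comp x
    ((P.coord e).contDiff.contDiffAt.prodMk P.planeᗮ.orthogonalProjectionOnto.contDiff.contDiffAt)

theorem fibreParam_spherePoint (he : ‖e‖ = 1) (hf : IsTamedMap W f) (y : P.planeᗮ) (c : Circle) :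
    P.coord e (spherePoint f he y c) ≠ 0 ∧ P.fibreParam e f (spherePoint f he y c) = y := by
  have hmem : (spherePoint f he y c : Amb n) ∈ (P.graph (P.framedMap e f y)).plane :=
    Submodule.smul_mem _ _ (graphMap_mem _ _ _)
  have h0 : P.coord e (spherePoint f he y c) ≠ 0 :=
    coord_ne_zero_of_mem he hmem (ne_zero_of_mem_unit_sphere _)
  exact ⟨h0, (mem_graph_framedMap_iff_fibreParam he hf h0).1 hmem⟩

theorem circleDir_spherePoint (he : ‖e‖ = 1) (y : P.planeᗮ) (c : Circle) :
    circleDir (P.coord e (spherePoint f he y c)) = c := by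
  have hpos : 0 < ‖P.fibrePoint e f y c‖ := norm_pos_iff.2 (fibrePoint_ne_zero he y c)
  refine circleDir_eq (inv_pos.2 hpos) ?_
  rw [coe_spherePoint, map_smul, coord_fibrePoint he]
  apply Complex.ext <;> simp

theorem spherePoint_fibreParam (he : ‖e‖ = 1) (hf : IsTamedMap W f) {x : Sph n}
    (hx : P.coord e x ≠ 0) :
    spherePoint f he (P.fibreParam e f x) (circleDir (P.coord e x)) = x := by
  set p := P.coord e x with hp
  set r := ‖(⟨p.1, p.2⟩ : ℂ)‖ with hr
  have hr0 : 0 < r := norm_pos_iff.2 (complex_mk_ne_zero hx)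
  have h1 := norm_mul_circleDir p
  have hre : r * (circleDir p : ℂ).re = p.1 := by simpa using congrArg Complex.re h1
  have him : r * (circleDir p : ℂ).im = p.2 := by simpa using congrArg Complex.im h1
  have h2 : r • P.fibrePoint e f (P.fibreParam e f x) (circleDir p) = x := by
    have h3 := hf.apply_tamedSolution hx (P.planeᗮ.orthogonalProjectionOnto (x : Amb n))
    have h4 := proj_add_proj_perp P (x : Amb n)
    rw [← h3, proj_eq he] at h4
    rw [fibrePoint_eq he, smul_add, smul_add, smul_add, smul_smul, smul_smul, smul_smul, smul_smul,
      hre, him]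
    exact h4
  have hx1 : ‖(x : Amb n)‖ = 1 := norm_eq_of_mem_sphere x
  have hn : r * ‖P.fibrePoint e f (P.fibreParam e f x) (circleDir p)‖ = 1 := by
    have h3 := (congrArg norm h2).trans hx1
    rwa [norm_smul, Real.norm_of_nonneg hr0.le] at h3
  apply Subtype.ext
  rw [coe_spherePoint, ← eq_inv_of_mul_eq_one_left hn]
  exact h2

theorem contDiffAt_normalize {E : Type*} [NormedAddCommGroup E] [InnerProductSpace ℝ E] {v : E}
    (hv : v ≠ 0) : ContDiffAt ℝ ∞ (fun x : E => ‖x‖⁻¹ • x) v :=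
  ((contDiffAt_norm ℝ hv).inv (norm_ne_zero_iff.2 hv)).smul contDiffAt_id

theorem contDiff_fibrePoint (he : ‖e‖ = 1) (hf : ContDiff ℝ ∞ f) :
    ContDiff ℝ ∞ (fun z : EuclideanSpace ℝ (Fin (2 * n)) × ℂ =>
      P.fibrePoint e f (P.perpEquiv.symm z.1) z.2) := by
  simp only [fibrePoint_eq he]
  have h1 : ContDiff ℝ ∞ fun z : EuclideanSpace ℝ (Fin (2 * n)) × ℂ => z.2.re :=
    Complex.reCLM.contDiff.comp contDiff_snd
  have h2 : ContDiff ℝ ∞ fun z : EuclideanSpace ℝ (Fin (2 * n)) × ℂ => z.2.im :=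
    Complex.imCLM.contDiff.comp contDiff_snd
  have h3 : ContDiff ℝ ∞ fun z : EuclideanSpace ℝ (Fin (2 * n)) × ℂ => P.perpEquiv.symm z.1 :=
    P.perpEquiv.symm.contDiff.comp contDiff_fst
  have h4 : ContDiff ℝ ∞ ((↑) : P.planeᗮ → Amb n) := P.planeᗮ.subtypeL.contDiff
  exact ((h1.smul contDiff_const).add (h2.smul contDiff_const)).add
    ((h1.smul (h4.comp h3)).add (h2.smul (h4.comp (hf.comp h3))))

theorem contMDiff_coe_spherePoint (he : ‖e‖ = 1) (hf : ContDiff ℝ ∞ f) :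
    ContMDiff ((𝓡 (2 * n)).prod (𝓡 1)) 𝓘(ℝ, Amb n) ∞
      (fun z : EuclideanSpace ℝ (Fin (2 * n)) × Circle =>
        (spherePoint f he (P.perpEquiv.symm z.1) z.2 : Amb n)) := by
  have hg : ContMDiff ((𝓡 (2 * n)).prod (𝓡 1)) 𝓘(ℝ, EuclideanSpace ℝ (Fin (2 * n)) × ℂ) ∞
      (fun z : EuclideanSpace ℝ (Fin (2 * n)) × Circle => (z.1, (z.2 : ℂ))) :=
    contMDiff_fst.prodMk_space (contMDiff_circle_coe.comp contMDiff_snd)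
  have hG : ContMDiff ((𝓡 (2 * n)).prod (𝓡 1)) 𝓘(ℝ, Amb n) ∞
      (fun z : EuclideanSpace ℝ (Fin (2 * n)) × Circle =>
        P.fibrePoint e f (P.perpEquiv.symm z.1) z.2) :=
    ContMDiff.comp (g := fun z : EuclideanSpace ℝ (Fin (2 * n)) × ℂ =>
        P.fibrePoint e f (P.perpEquiv.symm z.1) z.2)
      (f := fun z : EuclideanSpace ℝ (Fin (2 * n)) × Circle => (z.1, (z.2 : ℂ)))
      (contDiff_fibrePoint he hf).contMDiff hg
  intro z
  exact ContMDiffAt.comp (g := fun x : Amb n => ‖x‖⁻¹ • x)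
    (f := fun z : EuclideanSpace ℝ (Fin (2 * n)) × Circle =>
      P.fibrePoint e f (P.perpEquiv.symm z.1) z.2) z
    (contDiffAt_normalize (fibrePoint_ne_zero he _ _)).contMDiffAt (hG z)

theorem contMDiff_spherePoint (he : ‖e‖ = 1) (hf : ContDiff ℝ ∞ f) :
    ContMDiff ((𝓡 (2 * n)).prod (𝓡 1)) (𝓡 (2 * n + 1)) ∞
      (fun z : EuclideanSpace ℝ (Fin (2 * n)) × Circle =>
        spherePoint f he (P.perpEquiv.symm z.1) z.2) :=
  (contMDiff_coe_spherePoint he hf).codRestrict_sphere fun _ => Subtype.property _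

/-- The family of planes spanned by `e + y` and `P.rot e + f y`, `y ∈ V`, as a trivial circle
bundle. -/
noncomputable def trivialization (he : ‖e‖ = 1) (hf : IsTamedMap W f) {V : Set P.planeᗮ}
    (hV : IsOpen V) :
    OpenPartialHomeomorph (Sph n) (EuclideanSpace ℝ (Fin (2 * n)) × Circle) where
  toFun x := (P.perpEquiv (P.fibreParam e f x), circleDir (P.coord e x))
  invFun z := spherePoint f he (P.perpEquiv.symm z.1) z.2
  source := {x | P.coord e x ≠ 0 ∧ P.fibreParam e f x ∈ V}
  target := (P.perpEquiv.symm ⁻¹' V) ×ˢ Set.univ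
  map_source' x hx := ⟨by simpa using hx.2, trivial⟩
  map_target' z hz := by
    obtain ⟨h1, h2⟩ := fibreParam_spherePoint he hf (P.perpEquiv.symm z.1) z.2
    exact ⟨h1, by rw [h2]; exact hz.1⟩
  left_inv' x hx := by
    rw [ContinuousLinearEquiv.symm_apply_apply]
    exact spherePoint_fibreParam he hf hx.1
  right_inv' z hz := by
    rw [(fibreParam_spherePoint he hf _ _).2, circleDir_spherePoint,
      ContinuousLinearEquiv.apply_symm_apply]
  open_source := by
    have h1 : IsOpen {x : Sph n | P.coord e x ≠ 0} :=
      isOpen_ne_fun ((P.coord e).continuous.comp continuous_subtype_val) continuous_const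
    have h2 : ContinuousOn (fun x : Sph n => P.fibreParam e f x) {x : Sph n | P.coord e x ≠ 0} :=
      fun x hx => ((contDiffAt_fibreParam hf hx).continuousAt.comp
        continuous_subtype_val.continuousAt).continuousWithinAt
    exact h2.isOpen_inter_preimage h1 hV
  open_target := (hV.preimage P.perpEquiv.symm.continuous).prod isOpen_univ
  continuousOn_toFun := by
    intro x hx
    refine (ContinuousAt.prodMk ?_ ?_).continuousWithinAt
    · exact P.perpEquiv.continuous.continuousAt.comp
        ((contDiffAt_fibreParam hf hx.1).continuousAt.comp continuous_subtype_val.continuousAt)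
    · exact ContinuousAt.comp (g := circleDir) (f := fun x : Sph n => P.coord e x)
        (contMDiffAt_circleDir hx.1).continuousAt
        ((P.coord e).continuous.comp continuous_subtype_val).continuousAt
  continuousOn_invFun := (contMDiff_spherePoint he hf.1).continuous.continuousOn

/-- The velocity of the curve through `x` in its circle that is traced out by the second
coordinate of the trivialization is positive: up to multiples of `x`, it is a positive multiple of
the image of the rotated vector. -/
theorem inner_rot_deriv_spherePoint_pos (he : ‖e‖ = 1) (y : P.planeᗮ) (c : Circle)
    {Q : OrientedPlane n} (hQ : Q = P.graph (P.framedMap e f y)) (x : Q.plane)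
    (hx : (x : Amb n) = spherePoint f he y c) :
    0 < inner ℝ (Q.rot x : Amb n)
      (deriv (fun t : ℝ => (spherePoint f he y (c * Circle.exp t) : Amb n)) 0) := by
  subst hQ
  set T := P.graphMap (P.framedMap e f y) with hT
  set u : P.plane := P.circlePoint e c with hu
  have hu0 : u ≠ 0 := circlePoint_ne_zero he c
  let z : ℝ → Amb n := fun t => P.fibrePoint e f y (c * Circle.exp t : Circle)
  have hz0 : z 0 = T u := by simp [z, fibrePoint, hT, hu]
  have hzn : z 0 ≠ 0 := fibrePoint_ne_zero he y _
  have hexp : HasDerivAt (fun t : ℝ => ((c * Circle.exp t : Circle) : ℂ)) (c * Complex.I) 0 := by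
    have h1 : HasDerivAt (fun t : ℝ => Complex.exp (t * Complex.I)) Complex.I 0 := by
      have h2 := ((hasDerivAt_id (0 : ℝ)).ofReal_comp.mul_const Complex.I).cexp
      simpa using h2
    simpa using h1.const_mul (c : ℂ)
  have hzd : HasDerivAt z (T (P.rot u)) 0 := by
    have hre : HasDerivAt (fun t : ℝ => ((c * Circle.exp t : Circle) : ℂ).re) (-(c : ℂ).im) 0 := by
      have h1 := Complex.reCLM.hasFDerivAt.comp_hasDerivAt (0 : ℝ) hexp
      rw [show Complex.reCLM ((c : ℂ) * Complex.I) = -(c : ℂ).im by simp] at h1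
      exact h1
    have him : HasDerivAt (fun t : ℝ => ((c * Circle.exp t : Circle) : ℂ).im) (c : ℂ).re 0 := by
      have h1 := Complex.imCLM.hasFDerivAt.comp_hasDerivAt (0 : ℝ) hexp
      rw [show Complex.imCLM ((c : ℂ) * Complex.I) = (c : ℂ).re by simp] at h1
      exact h1
    have hd := (hre.smul_const (T e)).add (him.smul_const (T (P.rot e)))
    have hzT : z = (fun t : ℝ => ((c * Circle.exp t : Circle) : ℂ).re • T e) +
        fun t : ℝ => ((c * Circle.exp t : Circle) : ℂ).im • T (P.rot e) := by
      funext t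
      simp only [z, fibrePoint, circlePoint, map_add, map_smul, hT, Pi.add_apply]
    have hTu : T (P.rot u) = -(c : ℂ).im • T e + (c : ℂ).re • T (P.rot e) := by
      rw [hu, circlePoint, map_add, map_smul, map_smul, rot_rot, map_add, map_smul, map_smul,
        map_neg, smul_neg, neg_smul, add_comm]
    rw [hzT, hTu]
    exact hd
  have hnd : DifferentiableAt ℝ (fun t => ‖z t‖⁻¹) 0 :=
    (hzd.differentiableAt.norm ℝ hzn).inv (norm_ne_zero_iff.2 hzn)
  have hder : HasDerivAt (fun t : ℝ => (spherePoint f he y (c * Circle.exp t) : Amb n)) _ 0 :=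
    hnd.hasDerivAt.smul hzd
  rw [hder.deriv, inner_add_right, inner_smul_right, inner_smul_right]
  have hxz : x = ‖z 0‖⁻¹ • (⟨T u, graphMap_mem _ _ _⟩ : (P.graph (P.framedMap e f y)).plane) := by
    apply Subtype.ext
    rw [hx, coe_spherePoint]
    change _ = ‖z 0‖⁻¹ • T u
    rw [hz0]
    rfl
  have horth : inner ℝ ((P.graph (P.framedMap e f y)).rot x : Amb n) (z 0) = 0 := by
    have h1 := inner_rot_self (P.graph (P.framedMap e f y)) ⟨T u, graphMap_mem _ _ _⟩
    rw [hxz, map_smul, Submodule.coe_smul, inner_smul_left, hz0]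
    rw [Submodule.coe_inner] at h1
    rw [h1, mul_zero]
  have hpos : 0 < inner ℝ ((P.graph (P.framedMap e f y)).rot x : Amb n) (T (P.rot u)) := by
    have h1 := (posPair_coe_iff (u := ⟨T u, graphMap_mem _ _ _⟩)
      (v := ⟨T (P.rot u), graphMap_mem _ _ _⟩)).1 ((posPair_rot hu0).graph (P.framedMap e f y))
    rw [hxz, map_smul, Submodule.coe_smul, inner_smul_left]
    exact mul_pos (by simpa using hzn) h1
  rw [horth, mul_zero, add_zero]
  exact mul_pos (inv_pos.2 (norm_pos_iff.2 hzn)) hpos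

/-- A family of circles that partition the sphere is locally trivial along the circles spanned by
`e + y` and `P.rot e + f y`, `y ∈ V`, provided that these belong to the family. -/
theorem isSmoothTrivialization_trivialization (he : ‖e‖ = 1) (hf : IsTamedMap W f)
    {V : Set P.planeᗮ} (hV : IsOpen V) {M : Set (OrientedPlane n)}
    (hpart : ∀ x : Sph n, ∃! Q : OrientedPlane n, Q ∈ M ∧ x ∈ Q.circle)
    (hM : ∀ y ∈ V, P.graph (P.framedMap e f y) ∈ M) :
    IsSmoothTrivialization M (trivialization he hf hV) where
  target_eq := ⟨P.perpEquiv.symm ⁻¹' V, rfl⟩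
  smooth := by
    intro x hx
    refine ContMDiffAt.contMDiffWithinAt (ContMDiffAt.prodMk ?_ ?_)
    · have h1 : ContDiffAt ℝ ∞ (fun z : Amb n => P.perpEquiv (P.fibreParam e f z)) x :=
        P.perpEquiv.contDiff.contDiffAt.comp _ (contDiffAt_fibreParam hf hx.1)
      exact h1.contMDiffAt.comp x contMDiff_coe_sphere.contMDiffAt
    · exact ContMDiffAt.comp (g := circleDir) (f := fun x : Sph n => P.coord e x) x
        (contMDiffAt_circleDir hx.1)
        ((P.coord e).contDiff.contMDiff.contMDiffAt.comp x contMDiff_coe_sphere.contMDiffAt)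
  smooth_symm := (contMDiff_spherePoint he hf.1).contMDiffOn
  fibres := by
    intro x hx z
    have hxM := hM _ hx.2
    have hxQ : x ∈ (P.graph (P.framedMap e f (P.fibreParam e f x))).circle :=
      (mem_graph_framedMap_iff_fibreParam he hf hx.1).2 rfl
    have hiff : SameFibre M x z ↔ z ∈ (P.graph (P.framedMap e f (P.fibreParam e f x))).circle := by
      constructor
      · rintro ⟨Q, hQ, hxQ', hz⟩
        rwa [(hpart x).unique ⟨hQ, hxQ'⟩ ⟨hxM, hxQ⟩] at hz
      · exact fun hz => ⟨_, hxM, hxQ, hz⟩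
    rw [hiff]
    change (z : Amb n) ∈ (P.graph (P.framedMap e f (P.fibreParam e f x))).plane ↔
      (P.coord e z ≠ 0 ∧ P.fibreParam e f z ∈ V) ∧
        P.perpEquiv (P.fibreParam e f z) = P.perpEquiv (P.fibreParam e f x)
    rw [P.perpEquiv.injective.eq_iff]
    constructor
    · intro hz
      have hz0 := coord_ne_zero_of_mem he hz (ne_zero_of_mem_unit_sphere z)
      have hzx := (mem_graph_framedMap_iff_fibreParam he hf hz0).1 hz
      exact ⟨⟨hz0, by rw [hzx]; exact hx.2⟩, hzx⟩
    · rintro ⟨⟨hz0, -⟩, hzx⟩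
      exact (mem_graph_framedMap_iff_fibreParam he hf hz0).2 hzx
  oriented := by
    intro Q hQ x hx hxs
    have hxM := hM _ hxs.2
    have hxQ : (⟨x, hx⟩ : Sph n) ∈ (P.graph (P.framedMap e f (P.fibreParam e f x))).circle :=
      (mem_graph_framedMap_iff_fibreParam he hf hxs.1).2 rfl
    have hQe := (hpart ⟨x, hx⟩).unique ⟨hQ, x.2⟩ ⟨hxM, hxQ⟩
    have h1 := inner_rot_deriv_spherePoint_pos he (P.fibreParam e f x)
      (circleDir (P.coord e x)) hQe x
      (congrArg Subtype.val (spherePoint_fibreParam he hf (x := ⟨x, hx⟩) hxs.1)).symm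
    have h2 : ∀ t : ℝ, (trivialization he hf hV).symm
        (((trivialization he hf hV) ⟨x, hx⟩).1,
          ((trivialization he hf hV) ⟨x, hx⟩).2 * Circle.exp t) =
        spherePoint f he (P.fibreParam e f x) (circleDir (P.coord e x) * Circle.exp t) := by
      intro t
      change spherePoint f he (P.perpEquiv.symm (P.perpEquiv (P.fibreParam e f x)))
        (circleDir (P.coord e x) * Circle.exp t) = _
      rw [ContinuousLinearEquiv.symm_apply_apply]
    simp only [h2]
    exact h1

theorem circle_subset_trivialization_source (he : ‖e‖ = 1) (hf : IsTamedMap W f)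
    {V : Set P.planeᗮ} (hV : IsOpen V) {y : P.planeᗮ} (hy : y ∈ V) :
    (P.graph (P.framedMap e f y)).circle ⊆ (trivialization he hf hV).source := by
  intro x hx
  have h0 := coord_ne_zero_of_mem he hx (ne_zero_of_mem_unit_sphere x)
  refine ⟨h0, ?_⟩
  rw [(mem_graph_framedMap_iff_fibreParam he hf h0).1 hx]
  exact hy

end OrientedPlane

/-! ### Hopf fibrations -/

namespace OrientedPlane

variable {n : ℕ} {P : OrientedPlane n} {e : P.plane} {f : P.planeᗮ → P.planeᗮ}
  {J : Amb n →L[ℝ] Amb n}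

theorem exists_norm_eq_one (P : OrientedPlane n) : ∃ e : P.plane, ‖e‖ = 1 := by
  have : Nontrivial P.plane :=
    Module.nontrivial_of_finrank_pos (R := ℝ) (by rw [P.finrank_plane]; norm_num)
  exact exists_norm_eq P.plane zero_le_one

theorem framedMap_apply_self (he : ‖e‖ = 1) (y : P.planeᗮ) : P.framedMap e f y e = y := by
  have h := coord_smul_add he 1 0
  rw [one_smul, zero_smul, add_zero] at h
  rw [framedMap_apply, h, one_smul, zero_smul, add_zero]

theorem framedMap_apply_rot (he : ‖e‖ = 1) (y : P.planeᗮ) :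
    P.framedMap e f y (P.rot e) = f y := by
  have h := coord_smul_add he 0 1
  rw [one_smul, zero_smul, zero_add] at h
  rw [framedMap_apply, h, one_smul, zero_smul, zero_add]

theorem graph_zero (P : OrientedPlane n) : P.graph 0 = P := by
  obtain ⟨e, he⟩ := P.exists_norm_eq_one
  have he0 : e ≠ 0 := by rintro rfl; simp at he
  have h1 := (posPair_rot he0).graph (0 : P.HomPerp)
  rw [coe_graphMap, coe_graphMap, zero_apply, zero_apply, Submodule.coe_zero, add_zero,
    add_zero] at h1
  exact h1.eq (posPair_rot he0)

theorem framedMap_zero (hf : f 0 = 0) : P.framedMap e f 0 = 0 := by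
  ext1 p
  rw [framedMap_apply, hf, smul_zero, smul_zero, add_zero, zero_apply]

theorem IsLine.map_perp_mem (hJ : IsOrthComplex J) {Q : OrientedPlane n} (h : IsLine J Q)
    {x : Amb n} (hx : x ∈ Q.planeᗮ) : J x ∈ Q.planeᗮ := by
  intro y hy
  rw [real_inner_comm, hJ.1.inner_left, real_inner_comm, neg_eq_zero]
  exact Submodule.inner_right_of_mem_orthogonal (h.map_mem hy) hx

/-- The complex structure on the orthogonal complement of a complex line. -/
noncomputable def perpComplex (hJ : IsOrthComplex J) {Q : OrientedPlane n} (h : IsLine J Q) :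
    Q.planeᗮ →L[ℝ] Q.planeᗮ :=
  (J ∘L Q.planeᗮ.subtypeL).codRestrict Q.planeᗮ fun x => h.map_perp_mem hJ x.2

theorem coe_perpComplex (hJ : IsOrthComplex J) {Q : OrientedPlane n} (h : IsLine J Q)
    (x : Q.planeᗮ) : (perpComplex hJ h x : Amb n) = J x := rfl

theorem isOrthComplex_perpComplex (hJ : IsOrthComplex J) {Q : OrientedPlane n} (h : IsLine J Q) :
    IsOrthComplex (perpComplex hJ h) :=
  ⟨fun v => hJ.1 v, fun v => Subtype.ext (hJ.2 v)⟩

/-- The plane spanned by `e + y` and `J (e + y)` is a complex line. -/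
theorem isLine_graph_framedMap (hJ : IsOrthComplex J) (h : IsLine J P) (he : ‖e‖ = 1)
    {y : P.planeᗮ} (hy : (f y : Amb n) = J y) : IsLine J (P.graph (P.framedMap e f y)) := by
  have he0 : e ≠ 0 := by rintro rfl; simp at he
  have h1 := (posPair_rot he0).graph (P.framedMap e f y)
  rw [coe_graphMap, coe_graphMap, framedMap_apply_self he, framedMap_apply_rot he, hy, h e,
    ← map_add] at h1
  exact h1.isLine hJ

/-- If all complex lines that meet the open set `N` belong to the family `M`, then `M` is locally
trivial along these lines. -/
theorem exists_trivialization_of_isLine (hJ : IsOrthComplex J) {M : Set (OrientedPlane n)}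
    (hpart : ∀ x : Sph n, ∃! Q : OrientedPlane n, Q ∈ M ∧ x ∈ Q.circle)
    {N : Set (Amb n)} (hN : IsOpen N)
    (hM : ∀ Q : OrientedPlane n, IsLine J Q → ∀ x ∈ Q.plane, x ∈ N → Q ∈ M)
    (h : IsLine J P) (he : ‖e‖ = 1) (heN : (e : Amb n) ∈ N) :
    ∃ Φ, IsSmoothTrivialization M Φ ∧ P.circle ⊆ Φ.source := by
  let U := perpComplex hJ h
  have hU : IsOrthComplex U := isOrthComplex_perpComplex hJ h
  let V : Set P.planeᗮ := {y | (e : Amb n) + (y : Amb n) ∈ N}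
  have hV : IsOpen V := hN.preimage (by fun_prop)
  have h0 : (0 : P.planeᗮ) ∈ V := by
    change (e : Amb n) + ((0 : P.planeᗮ) : Amb n) ∈ N
    rwa [Submodule.coe_zero, add_zero]
  refine ⟨trivialization he hU.isTamedMap hV,
    isSmoothTrivialization_trivialization he hU.isTamedMap hV hpart fun y hy => ?_, ?_⟩
  · refine hM _ (isLine_graph_framedMap hJ h he rfl) _ (graphMap_mem _ _ e) ?_
    rw [coe_graphMap, framedMap_apply_self he]
    exact hy
  · have h1 := circle_subset_trivialization_source he hU.isTamedMap hV h0
    rwa [framedMap_zero (map_zero U), graph_zero] at h1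

theorem existsUnique_isLine (hJ : IsOrthComplex J) (x : Sph n) :
    ∃! Q : OrientedPlane n, Q ∈ {Q : OrientedPlane n | IsLine J Q} ∧ x ∈ Q.circle := by
  obtain ⟨Q, hQ, hx⟩ := exists_isLine hJ (ne_zero_of_mem_unit_sphere x)
  exact ⟨Q, ⟨hQ, hx⟩, fun Q' hQ' => hQ'.1.eq hQ hQ'.2 hx (ne_zero_of_mem_unit_sphere x)⟩

theorem isGreatCircleFibration_isLine (hJ : IsOrthComplex J) :
    IsGreatCircleFibration {Q : OrientedPlane n | IsLine J Q} where
  partition := existsUnique_isLine hJ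
  locallyTrivial Q hQ := by
    obtain ⟨e, he⟩ := Q.exists_norm_eq_one
    exact exists_trivialization_of_isLine hJ (existsUnique_isLine hJ) isOpen_univ
      (fun Q hQ _ _ _ => hQ) hQ he trivial

theorem isOrthComplex_of_isometry (J : Amb n ≃ₗᵢ[ℝ] Amb n) (hJ : ∀ x, J (J x) = -x) :
    IsOrthComplex (J.toContinuousLinearEquiv : Amb n →L[ℝ] Amb n) := by
  refine ⟨fun v => ?_, hJ⟩
  change inner ℝ (J v) v = 0
  have h1 := J.inner_map_map (J v) v
  rw [hJ, inner_neg_left, real_inner_comm] at h1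
  linarith

theorem _root_.IsHopfFibration.isGreatCircleFibration {M : Set (OrientedPlane n)}
    (h : IsHopfFibration M) : IsGreatCircleFibration M := by
  obtain ⟨J, hJ, rfl⟩ := h
  exact isGreatCircleFibration_isLine (isOrthComplex_of_isometry J hJ)

theorem isHopfFibration_isLine (hJ : IsOrthComplex J) :
    IsHopfFibration {Q : OrientedPlane n | IsLine J Q} := by
  let L : Amb n ≃ₗ[ℝ] Amb n := LinearEquiv.ofLinearMap (J : Amb n →ₗ[ℝ] Amb n)
    (-(J : Amb n →ₗ[ℝ] Amb n)) (by ext1 x; simp [hJ.2]) (by ext1 x; simp [hJ.2])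
  exact ⟨⟨L, hJ.norm_map⟩, hJ.2, rfl⟩

/-! ### The complex structure that extends a given one from the orthogonal complement -/

/-- The complex structure that is the rotation on `P` and `U` on the orthogonal complement. -/
noncomputable def extendComplex (P : OrientedPlane n) (U : P.planeᗮ →L[ℝ] P.planeᗮ) :
    Amb n →L[ℝ] Amb n :=
  P.plane.subtypeL ∘L (P.rot.toContinuousLinearEquiv : P.plane →L[ℝ] P.plane) ∘L
      P.plane.orthogonalProjectionOnto +
    P.planeᗮ.subtypeL ∘L U ∘L P.planeᗮ.orthogonalProjectionOnto

theorem extendComplex_apply (U : P.planeᗮ →L[ℝ] P.planeᗮ) (x : Amb n) :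
    P.extendComplex U x = (P.rot (P.plane.orthogonalProjectionOnto x) : Amb n) +
      (U (P.planeᗮ.orthogonalProjectionOnto x) : Amb n) := rfl

theorem extendComplex_plane (U : P.planeᗮ →L[ℝ] P.planeᗮ) (p : P.plane) :
    P.extendComplex U p = P.rot p := by
  rw [extendComplex_apply, Submodule.orthogonalProjectionOnto_mem_subspace_eq_self,
    Submodule.orthogonalProjectionOnto_orthogonal_apply_eq_zero p.2, map_zero, Submodule.coe_zero,
    add_zero]

theorem extendComplex_perp (U : P.planeᗮ →L[ℝ] P.planeᗮ) (y : P.planeᗮ) :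
    P.extendComplex U y = U y := by
  rw [extendComplex_apply, Submodule.orthogonalProjectionOnto_mem_subspace_eq_self,
    Submodule.orthogonalProjectionOnto_apply_of_mem_orthogonal y.2, map_zero, Submodule.coe_zero,
    zero_add]

theorem isLine_extendComplex (U : P.planeᗮ →L[ℝ] P.planeᗮ) : IsLine (P.extendComplex U) P :=
  fun p => (extendComplex_plane U p).symm

theorem isOrthComplex_extendComplex {U : P.planeᗮ →L[ℝ] P.planeᗮ} (hU : IsOrthComplex U) :
    IsOrthComplex (P.extendComplex U) := by
  refine ⟨fun x => ?_, fun x => ?_⟩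
  · set p := P.plane.orthogonalProjectionOnto x
    set y := P.planeᗮ.orthogonalProjectionOnto x
    have hx : (p : Amb n) + (y : Amb n) = x := proj_add_proj_perp P x
    have h1 := P.inner_rot_self p
    have h2 := hU.1 y
    rw [Submodule.coe_inner] at h1 h2
    rw [← hx, map_add, extendComplex_plane, extendComplex_perp, inner_add_left, inner_add_right,
      inner_add_right, h1, h2, Submodule.inner_right_of_mem_orthogonal (P.rot p).2 y.2,
      Submodule.inner_left_of_mem_orthogonal p.2 (U y).2]
    norm_num
  · rw [← proj_add_proj_perp P x, map_add, map_add, extendComplex_plane, extendComplex_perp,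
      extendComplex_plane, extendComplex_perp, rot_rot, hU.2, Submodule.coe_neg,
      Submodule.coe_neg, neg_add]

theorem _root_.IsOrthComplex.norm_smul_add_smul_sq {E : Type*} [NormedAddCommGroup E]
    [InnerProductSpace ℝ E] {U : E →L[ℝ] E} (hU : IsOrthComplex U) (a b : ℝ) (v : E) :
    ‖a • v + b • U v‖ ^ 2 = (a ^ 2 + b ^ 2) * ‖v‖ ^ 2 := by
  rw [norm_add_sq_real, inner_smul_left, inner_smul_right, real_inner_comm, hU.1, norm_smul,
    norm_smul, hU.norm_map, mul_pow, mul_pow]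
  simp only [Real.norm_eq_abs, sq_abs]
  ring

theorem norm_proj_sq (he : ‖e‖ = 1) (x : Amb n) :
    ‖P.plane.orthogonalProjectionOnto x‖ ^ 2 = (P.coord e x).1 ^ 2 + (P.coord e x).2 ^ 2 := by
  rw [proj_eq he, norm_add_sq_real, inner_smul_left, inner_smul_right, real_inner_comm,
    P.inner_rot_self, norm_smul, norm_smul, LinearIsometryEquiv.norm_map, he]
  simp

/-! ### Fibrations with prescribed germ -/

/-- The family of great circles spanned by `e + y` and `P.rot e + f y`, completed by the complex
lines in the orthogonal complement of `P`. -/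
def extendedFamily (P : OrientedPlane n) (e : P.plane) (f : P.planeᗮ → P.planeᗮ)
    (U : P.planeᗮ →L[ℝ] P.planeᗮ) : Set (OrientedPlane n) :=
  {Q | ∃ y, Q = P.graph (P.framedMap e f y)} ∪
    {Q | IsLine (P.extendComplex U) Q ∧ Q.plane ≤ P.planeᗮ}

theorem coord_eq_zero_of_mem_perp {x : Amb n} (hx : x ∈ P.planeᗮ) : P.coord e x = 0 := by
  rw [coord_apply, Submodule.inner_right_of_mem_orthogonal e.2 hx,
    Submodule.inner_right_of_mem_orthogonal (P.rot e).2 hx]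
  rfl

theorem mem_perp_of_coord_eq_zero (he : ‖e‖ = 1) {x : Amb n} (hx : P.coord e x = 0) :
    x ∈ P.planeᗮ := by
  rw [← Submodule.orthogonalProjectionOnto_eq_zero_iff, proj_eq he, hx]
  simp

theorem IsLine.le_perp {U : P.planeᗮ →L[ℝ] P.planeᗮ} {Q : OrientedPlane n}
    (h : IsLine (P.extendComplex U) Q) {x : Amb n} (hx : x ∈ Q.plane) (hx0 : x ≠ 0)
    (hxP : x ∈ P.planeᗮ) : Q.plane ≤ P.planeᗮ := by
  rw [(h.posPair hx hx0).plane_eq, Submodule.span_le]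
  rintro z (rfl | rfl)
  · exact hxP
  · rw [extendComplex_perp U ⟨x, hxP⟩]
    exact (U _).2

variable {W U : P.planeᗮ →L[ℝ] P.planeᗮ}

theorem existsUnique_mem_extendedFamily (he : ‖e‖ = 1) (hf : IsTamedMap W f)
    (hU : IsOrthComplex U) (x : Sph n) :
    ∃! Q : OrientedPlane n, Q ∈ P.extendedFamily e f U ∧ x ∈ Q.circle := by
  have hx0 : (x : Amb n) ≠ 0 := ne_zero_of_mem_unit_sphere x
  by_cases hc : P.coord e x = 0
  · have hxP := mem_perp_of_coord_eq_zero he hc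
    obtain ⟨Q, hQ, hx⟩ := exists_isLine (isOrthComplex_extendComplex hU) hx0
    refine ⟨Q, ⟨Or.inr ⟨hQ, hQ.le_perp hx hx0 hxP⟩, hx⟩, ?_⟩
    rintro Q' ⟨⟨y, rfl⟩ | ⟨hQ', -⟩, hx'⟩
    · exact absurd hc (coord_ne_zero_of_mem he hx' hx0)
    · exact hQ'.eq hQ hx' hx hx0
  · refine ⟨P.graph (P.framedMap e f (P.fibreParam e f x)),
      ⟨Or.inl ⟨_, rfl⟩, (mem_graph_framedMap_iff_fibreParam he hf hc).2 rfl⟩, ?_⟩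
    rintro Q' ⟨⟨y, rfl⟩ | ⟨-, hQ'⟩, hx'⟩
    · rw [(mem_graph_framedMap_iff_fibreParam he hf hc).1 hx']
    · exact absurd (coord_eq_zero_of_mem_perp (hQ' hx')) hc

/-- Where `f` agrees with `U`, the family consists of complex lines. -/
theorem mem_extendedFamily_of_isLine (he : ‖e‖ = 1) (hU : IsOrthComplex U) {R : ℝ}
    (hfU : ∀ y, R ≤ ‖y‖ → f y = U y) {Q : OrientedPlane n} (hQ : IsLine (P.extendComplex U) Q)
    {x : Amb n} (hx : x ∈ Q.plane)
    (hxN : R * ‖P.plane.orthogonalProjectionOnto x‖ < ‖P.planeᗮ.orthogonalProjectionOnto x‖) :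
    Q ∈ P.extendedFamily e f U := by
  have hx0 : x ≠ 0 := by rintro rfl; simp at hxN
  by_cases hc : P.coord e x = 0
  · exact Or.inr ⟨hQ, hQ.le_perp hx hx0 (mem_perp_of_coord_eq_zero he hc)⟩
  · left
    set y := P.fibreParam e U x with hy
    have hxy : x ∈ (P.graph (P.framedMap e U y)).plane :=
      (mem_graph_framedMap_iff_fibreParam he hU.isTamedMap hc).2 rfl
    have hline : IsLine (P.extendComplex U) (P.graph (P.framedMap e U y)) :=
      isLine_graph_framedMap (isOrthComplex_extendComplex hU) (isLine_extendComplex U) he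
        (extendComplex_perp U y).symm
    have hyR : R ≤ ‖y‖ := by
      rw [mem_graph_framedMap_iff he] at hxy
      rw [← hxy] at hxN
      have h1 := norm_proj_sq he x
      have h2 := hU.norm_smul_add_smul_sq (P.coord e x).1 (P.coord e x).2 y
      rw [← h1, ← mul_pow] at h2
      rw [(sq_eq_sq₀ (norm_nonneg _) (by positivity)).1 h2, mul_comm] at hxN
      exact (lt_of_mul_lt_mul_left hxN (norm_nonneg _)).le
    refine ⟨y, ?_⟩
    rw [hQ.eq hline hx hxy hx0]
    simp only [framedMap, hfU y hyR]

theorem isGreatCircleFibration_extendedFamily (he : ‖e‖ = 1) (hf : IsTamedMap W f)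
    (hU : IsOrthComplex U) {R : ℝ} (hfU : ∀ y, R ≤ ‖y‖ → f y = U y) :
    IsGreatCircleFibration (P.extendedFamily e f U) where
  partition := existsUnique_mem_extendedFamily he hf hU
  locallyTrivial := by
    have hpart := existsUnique_mem_extendedFamily he hf hU
    rintro Q (⟨y, rfl⟩ | ⟨hQ, hQP⟩)
    · exact ⟨trivialization he hf isOpen_univ,
        isSmoothTrivialization_trivialization he hf isOpen_univ hpart fun y _ => Or.inl ⟨y, rfl⟩,
        circle_subset_trivialization_source he hf isOpen_univ trivial⟩
    · obtain ⟨e', he'⟩ := Q.exists_norm_eq_one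
      have hN : IsOpen {x : Amb n | R * ‖P.plane.orthogonalProjectionOnto x‖ <
          ‖P.planeᗮ.orthogonalProjectionOnto x‖} := isOpen_lt (by fun_prop) (by fun_prop)
      -- near `Pᗮ`, in the region where `f` is `U`, the family consists of all complex lines
      refine exists_trivialization_of_isLine (isOrthComplex_extendComplex hU) hpart hN
        (fun Q' hQ' x hx hxN => mem_extendedFamily_of_isLine he hU hfU hQ' hx hxN) hQ he' ?_
      have heP : (e' : Amb n) ∈ P.planeᗮ := hQP e'.2
      have h1 : P.plane.orthogonalProjectionOnto (e' : Amb n) = 0 :=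
        Submodule.orthogonalProjectionOnto_apply_of_mem_orthogonal heP
      have h2 : P.planeᗮ.orthogonalProjectionOnto (e' : Amb n) = ⟨e', heP⟩ :=
        Submodule.orthogonalProjectionOnto_mem_subspace_eq_self ⟨_, heP⟩
      have h3 : ‖(⟨e', heP⟩ : P.planeᗮ)‖ = 1 := he'
      rw [Set.mem_ofPred_eq, h1, h2, h3]
      simp

/-- Every endomorphism without real eigenvalues is realized by a fibration: one with
`f = φ` near the origin and `f = U` far away, for an orthogonal complex structure `U` tamed by the
same map as `φ`. -/
theorem exists_isGreatCircleFibration (he : ‖e‖ = 1) {φ : P.planeᗮ →L[ℝ] P.planeᗮ}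
    (hφ : NoRealEigenvalue φ) : ∃ M : Set (OrientedPlane n), IsGreatCircleFibration M ∧ P ∈ M ∧
      ∀ᶠ y in nhds 0, P.graph (P.framedMap e φ y) ∈ M := by
  obtain ⟨r, -, hr⟩ := exists_orthComplex_retraction (E := P.planeᗮ)
  obtain ⟨hU, ⟨W, hWφ, hWU⟩, -⟩ := hr φ hφ
  obtain ⟨f, hf, hf0, R, hfU⟩ := hWφ.exists_isTamedMap hWU
  have hev : ∀ᶠ y in nhds 0, P.graph (P.framedMap e φ y) ∈ P.extendedFamily e f (r φ) := by
    filter_upwards [hf0] with y hy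
    refine Or.inl ⟨y, ?_⟩
    simp only [framedMap, hy]
  refine ⟨P.extendedFamily e f (r φ), isGreatCircleFibration_extendedFamily he hf hU hfU, ?_,
    hev⟩
  have h0 := hev.self_of_nhds
  rwa [framedMap_zero (map_zero φ), graph_zero] at h0

end OrientedPlane

/-! ### The tangent space of the base of a fibration -/

namespace OrientedPlane

variable {n : ℕ} {P : OrientedPlane n} {e : P.plane} {M : Set (OrientedPlane n)}
  {Φ : OpenPartialHomeomorph (Sph n) (EuclideanSpace ℝ (Fin (2 * n)) × Circle)}

/-- The base of a smooth trivialization. -/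
def trivBase (Φ : OpenPartialHomeomorph (Sph n) (EuclideanSpace ℝ (Fin (2 * n)) × Circle)) :
    Set (EuclideanSpace ℝ (Fin (2 * n))) := {v | (v, (1 : Circle)) ∈ Φ.target}

theorem isOpen_trivBase : IsOpen (trivBase Φ) :=
  Φ.open_target.preimage (Continuous.prodMk_left _)

theorem mem_target_iff (hΦ : IsSmoothTrivialization M Φ) (v : EuclideanSpace ℝ (Fin (2 * n)))
    (c : Circle) : (v, c) ∈ Φ.target ↔ v ∈ trivBase Φ := by
  obtain ⟨V, hV⟩ := hΦ.target_eq
  simp [trivBase, hV]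

/-- The fibre over a point of the base, with its characterization in the trivialization. -/
theorem exists_fibre (hM : IsGreatCircleFibration M) (hΦ : IsSmoothTrivialization M Φ)
    {v : EuclideanSpace ℝ (Fin (2 * n))} (hv : v ∈ trivBase Φ) :
    ∃ Q ∈ M, ∀ y : Sph n, y ∈ Q.circle ↔ y ∈ Φ.source ∧ (Φ y).1 = v := by
  have h1 : (v, (1 : Circle)) ∈ Φ.target := hv
  set x := Φ.symm (v, 1) with hx
  have hxs : x ∈ Φ.source := Φ.map_target h1
  have hΦx : Φ x = (v, 1) := Φ.right_inv h1
  obtain ⟨Q, hQ, -⟩ := hM.partition x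
  refine ⟨Q, hQ.1, fun y => ?_⟩
  have h2 := hΦ.fibres x hxs y
  rw [hΦx] at h2
  rw [← h2]
  constructor
  · exact fun hy => ⟨Q, hQ.1, hQ.2, hy⟩
  · rintro ⟨Q', hQ', hxQ', hy⟩
    rwa [(hM.partition x).unique ⟨hQ', hxQ'⟩ hQ] at hy

/-- The point with coordinates `(v, c exp(it))` in the trivialization. -/
noncomputable def trivCurve
    (Φ : OpenPartialHomeomorph (Sph n) (EuclideanSpace ℝ (Fin (2 * n)) × Circle)) (c : Circle)
    (z : EuclideanSpace ℝ (Fin (2 * n)) × ℝ) : Amb n := Φ.symm (z.1, c * Circle.exp z.2)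

theorem contDiffAt_trivCurve (hΦ : IsSmoothTrivialization M Φ) (c : Circle)
    {z : EuclideanSpace ℝ (Fin (2 * n)) × ℝ} (hz : z.1 ∈ trivBase Φ) :
    ContDiffAt ℝ ∞ (trivCurve Φ c) z := by
  have h1 : ContMDiff 𝓘(ℝ, EuclideanSpace ℝ (Fin (2 * n)) × ℝ) ((𝓡 (2 * n)).prod (𝓡 1)) ∞
      (fun z : EuclideanSpace ℝ (Fin (2 * n)) × ℝ => (z.1, c * Circle.exp z.2)) := by
    refine ContMDiff.prodMk contDiff_fst.contMDiff ?_
    have h2 : ContMDiff 𝓘(ℝ, EuclideanSpace ℝ (Fin (2 * n)) × ℝ) (𝓡 1) ∞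
        (fun z : EuclideanSpace ℝ (Fin (2 * n)) × ℝ => Circle.exp z.2) :=
      contMDiff_circleExp.comp contDiff_snd.contMDiff
    have h3 : ContMDiff 𝓘(ℝ, EuclideanSpace ℝ (Fin (2 * n)) × ℝ) (𝓡 1) ∞
        (fun _ : EuclideanSpace ℝ (Fin (2 * n)) × ℝ => c) := contMDiff_const
    exact h3.mul h2
  have h4 : ContMDiffAt ((𝓡 (2 * n)).prod (𝓡 1)) (𝓡 (2 * n + 1)) ∞ Φ.symm
      (z.1, c * Circle.exp z.2) :=
    hΦ.smooth_symm.contMDiffAt (Φ.open_target.mem_nhds ((mem_target_iff hΦ _ _).2 hz))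
  have h5 := ContMDiffAt.comp (g := Φ.symm)
    (f := fun z : EuclideanSpace ℝ (Fin (2 * n)) × ℝ => (z.1, c * Circle.exp z.2)) z h4 (h1 z)
  have h6 : ContMDiffAt 𝓘(ℝ, EuclideanSpace ℝ (Fin (2 * n)) × ℝ) 𝓘(ℝ, Amb n) ∞
      (trivCurve Φ c) z := ContMDiffAt.comp (g := fun x : Sph n => (x : Amb n)) z
        contMDiff_coe_sphere.contMDiffAt h5
  exact h6.contDiffAt

/-- The velocity at time `0` of `trivCurve`, a tangent vector of the fibre. -/
noncomputable def trivVelocity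
    (Φ : OpenPartialHomeomorph (Sph n) (EuclideanSpace ℝ (Fin (2 * n)) × Circle)) (c : Circle)
    (v : EuclideanSpace ℝ (Fin (2 * n))) : Amb n := fderiv ℝ (trivCurve Φ c) (v, 0) (0, 1)

theorem contDiffAt_trivVelocity (hΦ : IsSmoothTrivialization M Φ) (c : Circle)
    {v : EuclideanSpace ℝ (Fin (2 * n))} (hv : v ∈ trivBase Φ) :
    ContDiffAt ℝ ∞ (trivVelocity Φ c) v := by
  have h1 : ContDiffAt ℝ ∞ (fderiv ℝ (trivCurve Φ c)) (v, 0) :=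
    (contDiffAt_trivCurve hΦ c (z := (v, 0)) hv).fderiv_right (by simp)
  have h2 : ContDiffAt ℝ ∞
      (fun w : EuclideanSpace ℝ (Fin (2 * n)) => fderiv ℝ (trivCurve Φ c) (w, 0)) v :=
    h1.comp v (contDiff_prodMk_left 0).contDiffAt
  exact h2.clm_apply contDiffAt_const

theorem hasDerivAt_trivCurve (hΦ : IsSmoothTrivialization M Φ) (c : Circle)
    {v : EuclideanSpace ℝ (Fin (2 * n))} (hv : v ∈ trivBase Φ) :
    HasDerivAt (fun t : ℝ => trivCurve Φ c (v, t)) (trivVelocity Φ c v) 0 := by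
  have h1 := ((contDiffAt_trivCurve hΦ c (z := (v, 0)) hv).differentiableAt (by simp)).hasFDerivAt
  exact h1.comp_hasDerivAt (0 : ℝ) ((hasDerivAt_const (0 : ℝ) v).prodMk (hasDerivAt_id (0 : ℝ)))

/-- A point of a fibre and the velocity there form a positively oriented basis of its plane. -/
theorem posPair_trivVelocity (hΦ : IsSmoothTrivialization M Φ) (c : Circle)
    {v : EuclideanSpace ℝ (Fin (2 * n))} (hv : v ∈ trivBase Φ) {Q : OrientedPlane n} (hQ : Q ∈ M)
    (hQv : ∀ y : Sph n, y ∈ Q.circle ↔ y ∈ Φ.source ∧ (Φ y).1 = v) :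
    Q.PosPair (trivCurve Φ c (v, 0)) (trivVelocity Φ c v) := by
  have hmem : ∀ t : ℝ, trivCurve Φ c (v, t) ∈ Q.plane := by
    intro t
    have h1 : (v, c * Circle.exp t) ∈ Φ.target := (mem_target_iff hΦ _ _).2 hv
    exact (hQv (Φ.symm (v, c * Circle.exp t))).2 ⟨Φ.map_target h1, by rw [Φ.right_inv h1]⟩
  have hd := hasDerivAt_trivCurve hΦ c hv
  have hdQ : trivVelocity Φ c v ∈ Q.plane := by
    rw [mem_plane_iff_proj_perp]
    have h1 := Q.planeᗮ.orthogonalProjectionOnto.hasFDerivAt.comp_hasDerivAt (0 : ℝ) hd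
    have h2 : (Q.planeᗮ.orthogonalProjectionOnto ∘ fun t : ℝ => trivCurve Φ c (v, t)) =
        fun _ => 0 := funext fun t => (mem_plane_iff_proj_perp _).1 (hmem t)
    rw [h2] at h1
    exact h1.unique (hasDerivAt_const _ _)
  have hx : (v, c) ∈ Φ.target := (mem_target_iff hΦ _ _).2 hv
  have h0 : trivCurve Φ c (v, 0) = Φ.symm (v, c) := by simp [trivCurve]
  have hxQ : (Φ.symm (v, c) : Amb n) ∈ Q.plane := h0 ▸ hmem 0
  have hor := hΦ.oriented Q hQ ⟨_, hxQ⟩ (Φ.symm (v, c)).2 (Φ.map_target hx)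
  simp only [Subtype.coe_eta, Φ.right_inv hx] at hor
  have h2 : deriv (fun t : ℝ => (Φ.symm (v, c * Circle.exp t) : Amb n)) 0 = trivVelocity Φ c v :=
    hd.deriv
  rw [h2] at hor
  rw [h0]
  exact (posPair_coe_iff (u := ⟨_, hxQ⟩) (v := ⟨_, hdQ⟩)).2 hor

/-- Near `P`, the base of a fibration is a graph over the base of a trivialization: the fibre over
`v` is the graph of `L v`, for a smooth map `L`. -/
theorem exists_smooth_graph (hM : IsGreatCircleFibration M) (hP : P ∈ M)
    (hΦ : IsSmoothTrivialization M Φ) (hPΦ : P.circle ⊆ Φ.source) :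
    ∃ (v₀ : EuclideanSpace ℝ (Fin (2 * n))) (L : EuclideanSpace ℝ (Fin (2 * n)) → P.HomPerp),
      L v₀ = 0 ∧ (∀ y ∈ P.circle, (Φ y).1 = v₀) ∧
      ∀ᶠ v in nhds v₀, ContDiffAt ℝ ∞ L v ∧ P.graph (L v) ∈ M ∧
        ∀ y : Sph n, y ∈ (P.graph (L v)).circle ↔ y ∈ Φ.source ∧ (Φ y).1 = v := by
  obtain ⟨e, he⟩ := P.exists_norm_eq_one
  let x₀ : Sph n := ⟨e, by simpa using he⟩
  have hx₀P : x₀ ∈ P.circle := e.2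
  have hx₀ : x₀ ∈ Φ.source := hPΦ hx₀P
  set v₀ := (Φ x₀).1
  set c := (Φ x₀).2
  have hv₀V : v₀ ∈ trivBase Φ := (mem_target_iff hΦ v₀ c).1 (Φ.map_source hx₀)
  have hPv₀ : ∀ y : Sph n, y ∈ P.circle ↔ y ∈ Φ.source ∧ (Φ y).1 = v₀ := by
    obtain ⟨Q, hQ, hQv⟩ := exists_fibre hM hΦ hv₀V
    rwa [(hM.partition x₀).unique ⟨hP, hx₀P⟩ ⟨hQ, (hQv x₀).2 ⟨hx₀, rfl⟩⟩]
  let x : EuclideanSpace ℝ (Fin (2 * n)) → Amb n := fun v => trivCurve Φ c (v, 0)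
  let d : EuclideanSpace ℝ (Fin (2 * n)) → Amb n := trivVelocity Φ c
  have hx : ∀ v ∈ trivBase Φ, ContDiffAt ℝ ∞ x v := fun v hv =>
    ContDiffAt.comp (g := trivCurve Φ c) (f := fun v => (v, (0 : ℝ))) v
      (contDiffAt_trivCurve hΦ c (z := (v, 0)) hv) (contDiff_prodMk_left 0).contDiffAt
  have hd : ∀ v ∈ trivBase Φ, ContDiffAt ℝ ∞ d v := fun v hv => contDiffAt_trivVelocity hΦ c hv
  let π := P.plane.orthogonalProjectionOnto
  let π' := P.planeᗮ.orthogonalProjectionOnto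
  -- the projections to `P` and `Pᗮ` of the frame `x v`, `d v` of the fibre over `v`
  let B : EuclideanSpace ℝ (Fin (2 * n)) → P.plane →L[ℝ] P.plane := fun v =>
    (innerSL ℝ e).smulRight (π (x v)) + (innerSL ℝ (P.rot e)).smulRight (π (d v))
  let C : EuclideanSpace ℝ (Fin (2 * n)) → P.HomPerp := fun v =>
    (innerSL ℝ e).smulRight (π' (x v)) + (innerSL ℝ (P.rot e)).smulRight (π' (d v))
  have he' : ‖(e : Amb n)‖ = 1 := he
  have hre : inner ℝ (P.rot e) e = 0 := P.inner_rot_self e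
  have her : inner ℝ e (P.rot e) = 0 := by rw [real_inner_comm, hre]
  have hBe : ∀ v, B v e = π (x v) := fun v => by simp [B, he', hre]
  have hBr : ∀ v, B v (P.rot e) = π (d v) := fun v => by simp [B, her, he']
  have hCe : ∀ v, C v e = π' (x v) := fun v => by simp [C, he', hre]
  have hCr : ∀ v, C v (P.rot e) = π' (d v) := fun v => by simp [C, her, he']
  have hB : ∀ v ∈ trivBase Φ, ContDiffAt ℝ ∞ B v := fun v hv =>
    (contDiffAt_const.smulRight (π.contDiff.contDiffAt.comp v (hx v hv))).add
      (contDiffAt_const.smulRight (π.contDiff.contDiffAt.comp v (hd v hv)))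
  have hC : ∀ v ∈ trivBase Φ, ContDiffAt ℝ ∞ C v := fun v hv =>
    (contDiffAt_const.smulRight (π'.contDiff.contDiffAt.comp v (hx v hv))).add
      (contDiffAt_const.smulRight (π'.contDiff.contDiffAt.comp v (hd v hv)))
  have hpos₀ : 0 < inner ℝ (P.rot (π (x v₀))) (π (d v₀)) := by
    have h1 := posPair_trivVelocity hΦ c hv₀V hP hPv₀
    have h2 := (posPair_coe_iff (u := ⟨_, h1.mem_left⟩) (v := ⟨_, h1.mem_right⟩)).1 h1
    have e1 : π (x v₀) = ⟨_, h1.mem_left⟩ :=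
      P.plane.orthogonalProjectionOnto_mem_subspace_eq_self ⟨_, h1.mem_left⟩
    have e2 : π (d v₀) = ⟨_, h1.mem_right⟩ :=
      P.plane.orthogonalProjectionOnto_mem_subspace_eq_self ⟨_, h1.mem_right⟩
    rw [e1, e2]
    exact h2
  -- positivity of the projected frame makes `B v` invertible
  have hBinv : ∀ v, 0 < inner ℝ (P.rot (π (x v))) (π (d v)) →
      ∃ b : P.plane ≃L[ℝ] P.plane, (b : P.plane →L[ℝ] P.plane) = B v := by
    intro v hv
    have hinj : Function.Injective (B v : P.plane →ₗ[ℝ] P.plane) := by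
      rw [injective_iff_map_eq_zero]
      intro p hp
      have hp0 : (P.coord e p).1 • π (x v) + (P.coord e p).2 • π (d v) = 0 := hp
      have h1 : (P.coord e p).2 * inner ℝ (P.rot (π (x v))) (π (d v)) = 0 := by
        calc (P.coord e p).2 * inner ℝ (P.rot (π (x v))) (π (d v))
            = (P.coord e p).1 * inner ℝ (P.rot (π (x v))) (π (x v)) +
                (P.coord e p).2 * inner ℝ (P.rot (π (x v))) (π (d v)) := by
              rw [P.inner_rot_self, mul_zero, zero_add]
          _ = inner ℝ (P.rot (π (x v))) ((P.coord e p).1 • π (x v) + (P.coord e p).2 • π (d v)) :=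
              ((inner_add_right _ _ _).trans (congrArg₂ (· + ·) (real_inner_smul_right _ _ _)
                (real_inner_smul_right _ _ _))).symm
          _ = 0 := by rw [hp0, inner_zero_right]
      have h2 : (P.coord e p).2 = 0 := (mul_eq_zero.1 h1).resolve_right hv.ne'
      rw [h2, zero_smul, add_zero] at hp0
      have h3 : π (x v) ≠ 0 := by
        intro h3
        rw [h3] at hv
        simp at hv
      have h4 : (P.coord e p).1 = 0 := (smul_eq_zero.1 hp0).resolve_right h3
      refine eq_of_coord_eq he ?_
      rw [Submodule.coe_zero, map_zero]
      exact Prod.ext h4 h2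
    exact ⟨(LinearEquiv.ofInjectiveEndo _ hinj).toContinuousLinearEquiv, rfl⟩
  -- the fibre over `v` is the graph of the map that takes the projections of its frame to `P` to
  -- the projections to `Pᗮ`
  let L : EuclideanSpace ℝ (Fin (2 * n)) → P.HomPerp := fun v => C v ∘L (B v).inverse
  have hcont : ContinuousAt (fun v => inner ℝ (P.rot (π (x v))) (π (d v))) v₀ := by
    refine ContinuousAt.inner ?_ ?_
    · exact P.rot.continuous.continuousAt.comp
        (π.continuous.continuousAt.comp (hx v₀ hv₀V).continuousAt)
    · exact π.continuous.continuousAt.comp (hd v₀ hv₀V).continuousAt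
  have hgood : ∀ v ∈ trivBase Φ, 0 < inner ℝ (P.rot (π (x v))) (π (d v)) →
      ContDiffAt ℝ ∞ L v ∧ P.graph (L v) ∈ M ∧
        ∀ y : Sph n, y ∈ (P.graph (L v)).circle ↔ y ∈ Φ.source ∧ (Φ y).1 = v := by
    intro v hv hpos
    obtain ⟨b, hb⟩ := hBinv v hpos
    have hinv : ∀ p, (B v).inverse (B v p) = p := by
      intro p
      rw [← hb, ContinuousLinearMap.inverse_equiv]
      exact b.symm_apply_apply p
    obtain ⟨Q, hQ, hQv⟩ := exists_fibre hM hΦ hv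
    have hQgraph : Q = P.graph (L v) := by
      have h1 : P.PosPair (π (x v)) (π (d v)) := posPair_coe_iff.2 hpos
      have h2 := h1.graph (L v)
      have e1 : P.graphMap (L v) (π (x v)) = x v := by
        have : L v (π (x v)) = π' (x v) := by
          rw [← hBe, ← hCe]
          exact congrArg (C v) (hinv e)
        rw [coe_graphMap, this, proj_add_proj_perp]
      have e2 : P.graphMap (L v) (π (d v)) = d v := by
        have : L v (π (d v)) = π' (d v) := by
          rw [← hBr, ← hCr]
          exact congrArg (C v) (hinv (P.rot e))
        rw [coe_graphMap, this, proj_add_proj_perp]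
      rw [e1, e2] at h2
      exact (posPair_trivVelocity hΦ c hv hQ hQv).eq h2
    refine ⟨?_, hQgraph ▸ hQ, hQgraph ▸ hQv⟩
    have h3 : ContDiffAt ℝ ∞ ContinuousLinearMap.inverse (B v) := by
      rw [← hb]
      exact contDiffAt_map_inverse b
    exact (hC v hv).clm_comp (h3.comp v (hB v hv))
  refine ⟨v₀, L, ?_, fun y hy => ((hPv₀ y).1 hy).2, ?_⟩
  · obtain ⟨-, h1, h2⟩ := hgood v₀ hv₀V hpos₀
    have h3 : P.graph (L v₀) = P :=
      (hM.partition x₀).unique ⟨h1, (h2 x₀).2 ⟨hx₀, rfl⟩⟩ ⟨hP, hx₀P⟩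
    exact P.graph_injective (h3.trans P.graph_zero.symm)
  · filter_upwards [isOpen_trivBase.mem_nhds hv₀V, hcont.eventually (lt_mem_nhds hpos₀)] with v hv hv'
    exact hgood v hv hv'

/-- The normalization of `u + A u`, as a function of `A`. -/
noncomputable def graphSpherePoint {u : P.plane} (hu : u ≠ 0) (A : P.HomPerp) : Sph n :=
  ⟨‖P.graphMap A u‖⁻¹ • P.graphMap A u, by
    have : P.graphMap A u ≠ 0 := fun h => hu (P.graphMap_injective A (h.trans (map_zero _).symm))
    simp [norm_smul, this]⟩

theorem graphSpherePoint_mem {u : P.plane} (hu : u ≠ 0) (A : P.HomPerp) :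
    graphSpherePoint hu A ∈ (P.graph A).circle :=
  Submodule.smul_mem _ _ (graphMap_mem P A u)

theorem contMDiff_graphSpherePoint {u : P.plane} (hu : u ≠ 0) :
    ContMDiff 𝓘(ℝ, P.HomPerp) (𝓡 (2 * n + 1)) ∞ (graphSpherePoint (P := P) hu) := by
  have h1 : ContDiff ℝ ∞ fun A : P.HomPerp => P.graphMap A u := by
    simp only [coe_graphMap]
    exact contDiff_const.add (P.planeᗮ.subtypeL.contDiff.comp
      (contDiff_id.clm_apply contDiff_const))
  have h2 : ContDiff ℝ ∞ fun A : P.HomPerp => ‖P.graphMap A u‖⁻¹ • P.graphMap A u := by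
    rw [contDiff_iff_contDiffAt]
    intro A
    have : P.graphMap A u ≠ 0 := fun h => hu (P.graphMap_injective A (h.trans (map_zero _).symm))
    exact ContDiffAt.comp (g := fun z : Amb n => ‖z‖⁻¹ • z) A (contDiffAt_normalize this)
      h1.contDiffAt
  exact h2.contMDiff.codRestrict_sphere fun A => (graphSpherePoint hu A).2

/-- If `L` is a smooth immersion at `v₀`, with local left inverse `G`, whose image is the set `S`
near `0 = L v₀`, then the velocities at `0` of the smooth curves in `S` form the range of the
derivative of `L`. -/
theorem velocities_eq_range_fderiv {E H : Type*} [NormedAddCommGroup E] [NormedSpace ℝ E]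
    [NormedAddCommGroup H] [NormedSpace ℝ H] {L : E → H} {G : H → E} {S : Set H} {v₀ : E}
    (hL0 : L v₀ = 0) (hL : ∀ᶠ v in nhds v₀, ContDiffAt ℝ ∞ L v ∧ L v ∈ S) (hG0 : G 0 = v₀)
    (hGd : DifferentiableAt ℝ G 0) (hLG : ∀ᶠ A in nhds 0, A ∈ S → L (G A) = A) :
    {A | ∃ ε > (0 : ℝ), ∃ γ : ℝ → H, ContDiffOn ℝ ∞ γ (Set.Ioo (-ε) ε) ∧ γ 0 = 0 ∧
      (∀ t ∈ Set.Ioo (-ε) ε, γ t ∈ S) ∧ HasDerivAt γ A 0} = Set.range (fderiv ℝ L v₀) := by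
  have hLd : HasFDerivAt L (fderiv ℝ L v₀) v₀ :=
    (hL.self_of_nhds.1.differentiableAt (by simp)).hasFDerivAt
  apply Set.Subset.antisymm
  · rintro A ⟨ε, hε, γ, -, hγ0, hγM, hγd⟩
    have h1 : HasFDerivAt G (fderiv ℝ G 0) (γ 0) := by
      rw [hγ0]; exact hGd.hasFDerivAt
    have h2 : HasFDerivAt L (fderiv ℝ L v₀) (G (γ 0)) := by rw [hγ0, hG0]; exact hLd
    have h3 : HasDerivAt (fun t => L (G (γ t))) (fderiv ℝ L v₀ (fderiv ℝ G 0 A)) 0 :=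
      h2.comp_hasDerivAt (0 : ℝ) (h1.comp_hasDerivAt (0 : ℝ) hγd)
    have h4 : ∀ᶠ t in nhds (0 : ℝ), γ t = L (G (γ t)) := by
      have h5 : Filter.Tendsto γ (nhds 0) (nhds 0) := by
        have := hγd.continuousAt.tendsto
        rwa [hγ0] at this
      filter_upwards [h5.eventually hLG, Ioo_mem_nhds (neg_lt_zero.2 hε) hε] with t ht ht'
      exact (ht (hγM t ht')).symm
    exact ⟨fderiv ℝ G 0 A, (h3.congr_of_eventuallyEq h4).unique hγd⟩
  · rintro _ ⟨w, rfl⟩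
    have hc : Filter.Tendsto (fun t : ℝ => v₀ + t • w) (nhds 0) (nhds v₀) :=
      Continuous.tendsto' (by fun_prop) _ _ (by simp)
    obtain ⟨ε, hε, hball⟩ := Metric.eventually_nhds_iff.1 (hc.eventually hL)
    have hball' : ∀ t ∈ Set.Ioo (-ε) ε, ContDiffAt ℝ ∞ L (v₀ + t • w) ∧ L (v₀ + t • w) ∈ S :=
      fun t ht => hball (y := t) (by rw [Real.dist_eq, sub_zero]; exact abs_lt.2 ht)
    refine ⟨ε, hε, fun t => L (v₀ + t • w), fun t ht => ?_, by simpa using hL0,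
      fun t ht => (hball' t ht).2, ?_⟩
    · have h1 : ContDiffAt ℝ ∞ (fun t : ℝ => v₀ + t • w) t :=
        contDiffAt_const.add (contDiffAt_id.smul contDiffAt_const)
      exact ((hball' t ht).1.comp t h1).contDiffWithinAt
    · have h1 : HasDerivAt (fun t : ℝ => v₀ + t • w) w 0 := by
        simpa using ((hasDerivAt_id (0 : ℝ)).smul_const w).const_add v₀
      have h2 : HasFDerivAt L (fderiv ℝ L v₀) (v₀ + (0 : ℝ) • w) := by simpa using hLd
      exact h2.comp_hasDerivAt (0 : ℝ) h1

theorem fderiv_fderiv_of_leftInverse {E H : Type*} [NormedAddCommGroup E] [NormedSpace ℝ E]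
    [NormedAddCommGroup H] [NormedSpace ℝ H] {L : E → H} {G : H → E} {v₀ : E} (hL0 : L v₀ = 0)
    (hLd : DifferentiableAt ℝ L v₀) (hGd : DifferentiableAt ℝ G 0)
    (hGL : ∀ᶠ v in nhds v₀, G (L v) = v) (w : E) : fderiv ℝ G 0 (fderiv ℝ L v₀ w) = w := by
  have h1 : HasFDerivAt G (fderiv ℝ G 0) (L v₀) := by
    rw [hL0]; exact hGd.hasFDerivAt
  have h2 := h1.comp v₀ hLd.hasFDerivAt
  have h3 : HasFDerivAt (G ∘ L) (ContinuousLinearMap.id ℝ E) v₀ :=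
    (hasFDerivAt_id v₀).congr_of_eventuallyEq hGL
  exact congrArg (fun l => l w) (h2.unique h3)

theorem fderiv_apply_eq_zero_of_const {E H : Type*} [NormedAddCommGroup E] [NormedSpace ℝ E]
    [NormedAddCommGroup H] [NormedSpace ℝ H] {G : H → E} (hGd : DifferentiableAt ℝ G 0) {A : H}
    (h : ∀ t : ℝ, G (t • A) = G 0) : fderiv ℝ G 0 A = 0 := by
  have h2 : HasDerivAt (fun t : ℝ => t • A) A 0 := by
    simpa using (hasDerivAt_id (0 : ℝ)).smul_const A
  have h3 : HasFDerivAt G (fderiv ℝ G 0) ((0 : ℝ) • A) := by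
    rw [zero_smul]; exact hGd.hasFDerivAt
  have h4 : HasDerivAt (fun t : ℝ => G (t • A)) (fderiv ℝ G 0 A) 0 :=
    h3.comp_hasDerivAt (0 : ℝ) h2
  simp only [h] at h4
  exact h4.unique (hasDerivAt_const _ _)

/-- The vectors tangent to the base of a fibration form a `2n`-dimensional subspace, in which all
nonzero elements are injective: a nearby fibre is determined by any one of its points, so that the
evaluation at `u ≠ 0` is injective on the tangent space. -/
theorem exists_tangentSpace (hM : IsGreatCircleFibration M) (hP : P ∈ M) :
    ∃ T : Gr (2 * n) P.HomPerp, (T.1 : Set P.HomPerp) = P.tangentVectors M ∧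
      ∀ A ∈ T.1, ∀ u : P.plane, u ≠ 0 → A u = 0 → A = 0 := by
  obtain ⟨Φ, hΦ, hPΦ⟩ := hM.locallyTrivial P hP
  obtain ⟨v₀, L, hL0, hPv₀, hL⟩ := exists_smooth_graph hM hP hΦ hPΦ
  set D := fderiv ℝ L v₀
  -- a smooth left inverse of `L` for every `u ≠ 0`
  let G : ∀ u : P.plane, u ≠ 0 → P.HomPerp → EuclideanSpace ℝ (Fin (2 * n)) :=
    fun u hu A => (Φ (graphSpherePoint hu A)).1
  have hmem0 : ∀ (u : P.plane) (hu : u ≠ 0), graphSpherePoint hu 0 ∈ P.circle := by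
    intro u hu
    have := graphSpherePoint_mem hu (0 : P.HomPerp)
    rwa [graph_zero] at this
  have hG0 : ∀ (u : P.plane) (hu : u ≠ 0), G u hu 0 = v₀ := fun u hu => hPv₀ _ (hmem0 u hu)
  have hGd : ∀ (u : P.plane) (hu : u ≠ 0), DifferentiableAt ℝ (G u hu) 0 := by
    intro u hu
    have h1 : ContMDiffAt (𝓡 (2 * n + 1)) ((𝓡 (2 * n)).prod (𝓡 1)) ∞ Φ (graphSpherePoint hu 0) :=
      hΦ.smooth.contMDiffAt (Φ.open_source.mem_nhds (hPΦ (hmem0 u hu)))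
    have h2 : ContMDiffAt 𝓘(ℝ, P.HomPerp) (𝓡 (2 * n)) ∞ (G u hu) 0 :=
      (h1.comp 0 (contMDiff_graphSpherePoint hu 0)).fst
    exact h2.contDiffAt.differentiableAt (by simp)
  have hGL : ∀ (u : P.plane) (hu : u ≠ 0), ∀ᶠ v in nhds v₀, G u hu (L v) = v := by
    intro u hu
    filter_upwards [hL] with v hv
    exact ((hv.2.2 _).1 (graphSpherePoint_mem hu (L v))).2
  have hGD : ∀ (u : P.plane) (hu : u ≠ 0) w, fderiv ℝ (G u hu) 0 (D w) = w := by
    exact fun u hu w => fderiv_fderiv_of_leftInverse hL0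
      (hL.self_of_nhds.1.differentiableAt (by simp)) (hGd u hu) (hGL u hu) w
  have hLG : ∀ (u : P.plane) (hu : u ≠ 0), ∀ᶠ A in nhds (0 : P.HomPerp), P.graph A ∈ M →
      L (G u hu A) = A := by
    intro u hu
    have h1 : Filter.Tendsto (G u hu) (nhds 0) (nhds v₀) := by
      have := (hGd u hu).continuousAt.tendsto
      rwa [hG0] at this
    have h2 : ∀ᶠ A in nhds (0 : P.HomPerp), graphSpherePoint hu A ∈ Φ.source :=
      (contMDiff_graphSpherePoint hu).continuous.continuousAt.eventually
        (Φ.open_source.mem_nhds (hPΦ (hmem0 u hu)))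
    filter_upwards [h1.eventually hL, h2] with A hA hAs hAM
    have h3 : graphSpherePoint hu A ∈ (P.graph (L (G u hu A))).circle := (hA.2.2 _).2 ⟨hAs, rfl⟩
    exact P.graph_injective ((hM.partition _).unique ⟨hA.2.1, h3⟩ ⟨hAM, graphSpherePoint_mem hu A⟩)
  obtain ⟨e, he⟩ := P.exists_norm_eq_one
  have he0 : e ≠ 0 := by rintro rfl; simp at he
  have hinj : Function.Injective D := Function.LeftInverse.injective (hGD e he0)
  refine ⟨⟨(D : EuclideanSpace ℝ (Fin (2 * n)) →ₗ[ℝ] P.HomPerp).range, ?_⟩, ?_, ?_⟩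
  · rw [LinearMap.finrank_range_of_inj hinj, finrank_euclideanSpace_fin]
  · exact (velocities_eq_range_fderiv (S := {A | P.graph A ∈ M}) hL0
      (hL.mono fun v hv => ⟨hv.1, hv.2.1⟩) (hG0 e he0) (hGd e he0) (hLG e he0)).symm
  · rintro _ ⟨w, rfl⟩ u hu hAu
    -- `G u` depends on `A` only through `A u`, hence is constant along the line spanned by `D w`
    have h1 : fderiv ℝ (G u hu) 0 (D w) = 0 := by
      refine fderiv_apply_eq_zero_of_const (H := P.HomPerp) (G := G u hu) (A := D w) (hGd u hu)
        fun t => ?_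
      have h5 : graphSpherePoint hu (t • D w) = graphSpherePoint hu 0 := by
        have h6 : D w u = 0 := hAu
        have h7 : P.graphMap (t • D w) u = P.graphMap 0 u := by
          rw [coe_graphMap, coe_graphMap, smul_apply, h6, smul_zero, zero_apply]
        apply Subtype.ext
        simp only [graphSpherePoint, h7]
      simp only [G, h5]
    have h8 : w = 0 := by rw [← hGD u hu w, h1]
    rw [h8]
    exact map_zero _

end OrientedPlane

/-! ### Deformation retractions in a chart -/

theorem DeformationRetractsTo.image {X Y : Type*} [TopologicalSpace X] [TopologicalSpace Y]
    {S A : Set X} (h : DeformationRetractsTo S A) {f : X → Y} (hf : Topology.IsEmbedding f) :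
    DeformationRetractsTo (f '' S) (f '' A) := by
  obtain ⟨hAS, H, h0, h1, hA⟩ := h
  let g : S ≃ₜ f '' S := hf.homeomorphImage S
  have hg : ∀ x : f '' S, f (g.symm x) = x := fun x => congrArg Subtype.val (g.apply_symm_apply x)
  refine ⟨Set.image_mono hAS, ⟨fun z => g (H (z.1, g.symm z.2)), by fun_prop⟩, fun x => ?_,
    fun x => ?_, fun t x hx => ?_⟩
  · simp only [ContinuousMap.coe_mk, h0, g.apply_symm_apply]
  · exact ⟨_, h1 _, rfl⟩
  · have hx' : (g.symm x : X) ∈ A := by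
      obtain ⟨a, ha, hax⟩ := hx
      rwa [hf.injective ((hg x).trans hax.symm)]
    simp only [ContinuousMap.coe_mk, hA t _ hx', g.apply_symm_apply]

/-! ### Charts of the Grassmannian -/

namespace Gr

theorem eq_of_le {k : ℕ} {V : Type*} [AddCommGroup V] [Module ℝ V] {T T' : Gr k V}
    [FiniteDimensional ℝ V] (h : T.1 ≤ T'.1) : T = T' :=
  Subtype.ext (Submodule.eq_of_le_of_finrank_eq h (T.2.trans T'.2.symm))

variable {k : ℕ} {V E : Type*} [AddCommGroup V] [Module ℝ V] [TopologicalSpace V]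
  [NormedAddCommGroup E] [NormedSpace ℝ E] (hk : Module.finrank ℝ E = k) (ev : V ≃L[ℝ] E × E)

/-- The subspace of `V ≃ E × E` that corresponds to the graph of the linear map `φ : E → E`. -/
noncomputable def ofSlope (φ : E →L[ℝ] E) : Gr k V :=
  ⟨LinearMap.range ((ev.symm ∘L (ContinuousLinearMap.id ℝ E).prod φ : E →L[ℝ] V) : E →ₗ[ℝ] V), by
    rw [LinearMap.finrank_range_of_inj, hk]
    exact ev.symm.injective.comp fun x y h => congrArg Prod.fst h⟩

variable {hk ev} {φ : E →L[ℝ] E}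

theorem mem_ofSlope {x : V} : x ∈ (ofSlope hk ev φ).1 ↔ (ev x).2 = φ (ev x).1 := by
  constructor
  · rintro ⟨y, rfl⟩
    change (ev (ev.symm (y, φ y))).2 = φ (ev (ev.symm (y, φ y))).1
    rw [ev.apply_symm_apply]
  · intro h
    refine ⟨(ev x).1, ?_⟩
    change ev.symm ((ev x).1, φ (ev x).1) = x
    rw [← h]
    exact ev.symm_apply_apply x

theorem ofSlope_injective : Function.Injective (ofSlope hk ev) := by
  intro φ ψ h
  ext1 y
  have h1 : ev.symm (y, φ y) ∈ (ofSlope hk ev ψ).1 := by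
    rw [← h, mem_ofSlope, ev.apply_symm_apply]
  rwa [mem_ofSlope, ev.apply_symm_apply] at h1

/-- The linear map that takes the standard basis of `ℝᵏ` to the family `w`. -/
noncomputable def combination (w : Fin k → E) : (Fin k → ℝ) →L[ℝ] E :=
  ∑ i, (ContinuousLinearMap.proj (R := ℝ) (φ := fun _ : Fin k => ℝ) i).smulRight (w i)

theorem combination_apply (w : Fin k → E) (c : Fin k → ℝ) :
    combination w c = ∑ i, c i • w i := by
  simp [combination]

theorem combination_single (w : Fin k → E) (i : Fin k) :
    combination w (Pi.single i 1) = w i := by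
  simp [combination_apply, Pi.single_apply]

theorem continuous_combination : Continuous (combination : (Fin k → E) → _) := by
  refine continuous_finsetSum _ fun i _ => ?_
  exact (ContinuousLinearMap.smulRightL ℝ (Fin k → ℝ) E
    (ContinuousLinearMap.proj i)).continuous.comp (continuous_apply i)

variable [FiniteDimensional ℝ E]

theorem eq_ofSlope {T : Gr k V} (h : ∀ y, ev.symm (y, φ y) ∈ T.1) : T = ofSlope hk ev φ := by
  have : FiniteDimensional ℝ V := ev.symm.toLinearEquiv.finiteDimensional
  refine (eq_of_le ?_).symm
  rintro _ ⟨y, rfl⟩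
  exact h y

/-- A frame spans the graph of `φ` as soon as its members lie in that graph. -/
theorem frameSpan_eq_ofSlope (v : {v : Fin k → V // LinearIndependent ℝ v})
    (h : ∀ i, (ev (v.1 i)).2 = φ (ev (v.1 i)).1) : frameSpan k V v = ofSlope hk ev φ := by
  have : FiniteDimensional ℝ V := ev.symm.toLinearEquiv.finiteDimensional
  refine eq_of_le (Submodule.span_le.2 ?_)
  rintro _ ⟨i, rfl⟩
  exact mem_ofSlope.2 (h i)

/-- A subspace of the right dimension is a graph if its projection to the first factor is
injective. -/
theorem exists_eq_ofSlope {T : Gr k V} (h : ∀ x ∈ T.1, (ev x).1 = 0 → x = 0) :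
    ∃ φ, T = ofSlope hk ev φ := by
  have : FiniteDimensional ℝ V := ev.symm.toLinearEquiv.finiteDimensional
  let a₀ : T.1 →ₗ[ℝ] E := LinearMap.fst ℝ E E ∘ₗ (ev : V →ₗ[ℝ] E × E) ∘ₗ T.1.subtype
  have ha₀ : Function.Injective a₀ := by
    rw [injective_iff_map_eq_zero]
    exact fun x hx => Subtype.ext (h x.1 x.2 hx)
  let a : T.1 ≃ₗ[ℝ] E := LinearEquiv.ofInjectiveOfFinrankEq a₀ ha₀ (T.2.trans hk.symm)
  let q : T.1 →ₗ[ℝ] E := LinearMap.snd ℝ E E ∘ₗ (ev : V →ₗ[ℝ] E × E) ∘ₗ T.1.subtype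
  refine ⟨(q ∘ₗ (a.symm : E →ₗ[ℝ] T.1)).toContinuousLinearMap, eq_ofSlope fun y => ?_⟩
  have h1 : ev.symm (y, q (a.symm y)) = (a.symm y).1 := by
    rw [ContinuousLinearEquiv.symm_apply_eq]
    exact Prod.ext (a.apply_symm_apply y).symm rfl
  exact (congrArg (· ∈ T.1) h1).mpr (a.symm y).2

theorem continuous_frameSpan : Continuous (frameSpan k V) := continuous_coinduced_rng

theorem continuous_ofSlope : Continuous (ofSlope hk ev) := by
  let b : Module.Basis (Fin k) ℝ E := Module.finBasisOfFinrankEq ℝ E hk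
  have hli : ∀ φ : E →L[ℝ] E, LinearIndependent ℝ fun i => ev.symm (b i, φ (b i)) := by
    intro φ
    refine LinearIndependent.of_comp (LinearMap.fst ℝ E E ∘ₗ (ev : V →ₗ[ℝ] E × E)) ?_
    have : (LinearMap.fst ℝ E E ∘ₗ (ev : V →ₗ[ℝ] E × E)) ∘ (fun i => ev.symm (b i, φ (b i))) = b := by
      funext i
      change (ev (ev.symm (b i, φ (b i)))).1 = b i
      rw [ev.apply_symm_apply]
    rw [this]
    exact b.linearIndependent
  have h : ofSlope hk ev = fun φ => frameSpan k V ⟨fun i => ev.symm (b i, φ (b i)), hli φ⟩ := by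
    funext φ
    refine (frameSpan_eq_ofSlope _ fun i => ?_).symm
    simp only [ev.apply_symm_apply]
  rw [h]
  have hc : Continuous fun φ : E →L[ℝ] E => fun i => ev.symm (b i, φ (b i)) :=
    continuous_pi fun i => ev.symm.continuous.comp
      (continuous_const.prodMk (ContinuousLinearMap.apply ℝ E (b i)).continuous)
  exact continuous_frameSpan.comp (hc.subtype_mk hli)

/-- The graphs of the linear maps form an open subset of the Grassmannian: if `v` is a frame, with
components `v₁` and `v₂` in `E × E`, then it spans a graph if and only if the matrix `v₁` is
invertible, and then it spans the graph of `v₂ v₁⁻¹`. -/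
theorem isOpenEmbedding_ofSlope : Topology.IsOpenEmbedding (ofSlope hk ev) := by
  refine .of_continuous_injective_isOpenMap continuous_ofSlope ofSlope_injective fun B hB => ?_
  let F : Type _ := {v : Fin k → V // LinearIndependent ℝ v}
  let c₁ : F → (Fin k → ℝ) →L[ℝ] E := fun v => combination fun i => (ev (v.1 i)).1
  let c₂ : F → (Fin k → ℝ) →L[ℝ] E := fun v => combination fun i => (ev (v.1 i)).2
  have hev : ∀ i, Continuous fun v : F => ev (v.1 i) := fun i =>
    ev.continuous.comp ((continuous_apply i).comp continuous_subtype_val)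
  have hc₁ : Continuous c₁ := continuous_combination.comp (continuous_pi fun i => (hev i).fst)
  have hc₂ : Continuous c₂ := continuous_combination.comp (continuous_pi fun i => (hev i).snd)
  let O : Set F := c₁ ⁻¹' Set.range ((↑) : ((Fin k → ℝ) ≃L[ℝ] E) → (Fin k → ℝ) →L[ℝ] E)
  have hO : IsOpen O := ContinuousLinearEquiv.isOpen.preimage hc₁
  have hslope : ContinuousOn (fun v => c₂ v ∘L (c₁ v).inverse) O := by
    rintro v ⟨a, ha⟩
    have h1 : ContinuousAt ContinuousLinearMap.inverse (c₁ v) := by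
      rw [← ha]
      exact (contDiffAt_map_inverse (n := 0) a).continuousAt
    exact (hc₂.continuousAt.clm_comp (ContinuousAt.comp (f := c₁) h1
      hc₁.continuousAt)).continuousWithinAt
  have hpre : frameSpan k V ⁻¹' (ofSlope hk ev '' B) =
      O ∩ (fun v => c₂ v ∘L (c₁ v).inverse) ⁻¹' B := by
    ext v
    constructor
    · rintro ⟨φ, hφ, hφv⟩
      have h1 : ∀ i, (ev (v.1 i)).2 = φ (ev (v.1 i)).1 := by
        intro i
        rw [← mem_ofSlope (hk := hk), hφv]
        exact Submodule.subset_span ⟨i, rfl⟩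
      have h2 : c₂ v = φ ∘L c₁ v := by
        ext1 c
        simp only [c₁, c₂, combination_apply, ContinuousLinearMap.comp_apply, map_sum, map_smul, h1]
      have hinj : Function.Injective (c₁ v : (Fin k → ℝ) →ₗ[ℝ] E) := by
        rw [injective_iff_map_eq_zero]
        intro c hc
        have hc' : ∑ i, c i • (ev (v.1 i)).1 = 0 := (combination_apply _ c).symm.trans hc
        have h3 : ∑ i, c i • v.1 i = 0 := by
          apply ev.injective
          rw [map_zero, map_sum]
          refine Prod.ext ?_ ?_
          · simpa [Prod.fst_sum] using hc'
          · simpa [Prod.snd_sum, h1] using congrArg φ hc'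
        funext i
        exact Fintype.linearIndependent_iff.1 v.2 c h3 i
      let a : (Fin k → ℝ) ≃L[ℝ] E :=
        (LinearEquiv.ofInjectiveOfFinrankEq _ hinj (by simp [hk])).toContinuousLinearEquiv
      have ha : (a : (Fin k → ℝ) →L[ℝ] E) = c₁ v := rfl
      refine ⟨⟨a, ha⟩, ?_⟩
      have h4 : c₂ v ∘L (c₁ v).inverse = φ := by
        rw [h2, ← ha, ContinuousLinearMap.inverse_equiv]
        ext1 y
        exact congrArg φ (a.apply_symm_apply y)
      rwa [Set.mem_preimage, h4]
    · rintro ⟨⟨a, ha⟩, hv⟩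
      refine ⟨_, hv, (frameSpan_eq_ofSlope v fun i => ?_).symm⟩
      rw [← combination_single (fun i => (ev (v.1 i)).2) i,
        ← combination_single (fun i => (ev (v.1 i)).1) i]
      change c₂ v _ = c₂ v ((c₁ v).inverse (c₁ v _))
      rw [← ha, ContinuousLinearMap.inverse_equiv]
      exact congrArg (c₂ v) (a.symm_apply_apply _).symm
  change IsOpen (frameSpan k V ⁻¹' (ofSlope hk ev '' B))
  rw [hpre]
  exact hslope.isOpen_inter_preimage hO hB

end Gr

/-! ### The deformation retraction -/

/-- The homotopy follows the segments from `φ` to `r φ`, for the retraction `r` of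
`exists_orthComplex_retraction`. -/
theorem deformationRetractsTo_isOrthComplex (E : Type*) [NormedAddCommGroup E]
    [InnerProductSpace ℝ E] [FiniteDimensional ℝ E] :
    DeformationRetractsTo {φ : E →L[ℝ] E | NoRealEigenvalue φ} {φ | IsOrthComplex φ} := by
  obtain ⟨r, hr, h⟩ := exists_orthComplex_retraction (E := E)
  have hmem : ∀ z : unitInterval × {φ : E →L[ℝ] E | NoRealEigenvalue φ},
      NoRealEigenvalue ((1 - (z.1 : ℝ)) • z.2.1 + (z.1 : ℝ) • r z.2.1) := by
    rintro ⟨t, φ, hφ⟩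
    obtain ⟨-, ⟨W, hW, hW'⟩, -⟩ := h φ hφ
    exact (hW.segment hW' t.2.1 t.2.2).noRealEigenvalue
  have hr' : Continuous fun φ : {φ : E →L[ℝ] E | NoRealEigenvalue φ} => r φ.1 :=
    continuousOn_iff_continuous_domRestrict.1 hr
  refine ⟨fun U hU => IsOrthComplex.tames hU |>.noRealEigenvalue,
    ⟨fun z => ⟨_, hmem z⟩, ?_⟩, fun φ => ?_, fun φ => ?_, fun t φ hφ => ?_⟩
  · have h1 : Continuous fun z : unitInterval × {φ : E →L[ℝ] E | NoRealEigenvalue φ} =>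
        (z.1 : ℝ) := continuous_subtype_val.comp continuous_fst
    have h2 := hr'.comp (continuous_snd (X := unitInterval))
    have h3 := (continuous_subtype_val (p := fun φ : E →L[ℝ] E => NoRealEigenvalue φ)).comp
      (continuous_snd (X := unitInterval))
    exact Continuous.subtype_mk (((continuous_const.sub h1).smul h3).add (h1.smul h2)) _
  · apply Subtype.ext
    simp
  · simpa using (h φ.1 φ.2).1
  · apply Subtype.ext
    have h3 : r φ.1 = φ.1 := (h φ.1 φ.2).2.2 hφ
    simp [h3, ← add_smul]

/-! ### The tangent planes of fibrations in the chart -/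

theorem contDiff_smul_left {H : Type*} [NormedAddCommGroup H] [NormedSpace ℝ H] (A : H) :
    ContDiff ℝ ∞ fun t : ℝ => t • A :=
  contDiff_id.smul contDiff_const

theorem hasDerivAt_smul_left {H : Type*} [NormedAddCommGroup H] [NormedSpace ℝ H] (A : H) :
    HasDerivAt (fun t : ℝ => t • A) A 0 := by
  simpa using (hasDerivAt_id (0 : ℝ)).smul_const A

namespace OrientedPlane

variable {n : ℕ} {P : OrientedPlane n} {e : P.plane}

/-- Evaluation at the oriented orthonormal basis `e`, `P.rot e` of `P`. -/
noncomputable def evalEquiv (he : ‖e‖ = 1) : P.HomPerp ≃L[ℝ] P.planeᗮ × P.planeᗮ :=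
  LinearEquiv.toContinuousLinearEquiv
    { toFun := fun A => (A e, A (P.rot e))
      map_add' := fun _ _ => rfl
      map_smul' := fun _ _ => rfl
      invFun := fun z => P.framedMap e (fun _ => z.2) z.1
      left_inv := fun A => by
        ext1 p
        have hp : p = (P.coord e p).1 • e + (P.coord e p).2 • P.rot e :=
          eq_of_coord_eq he (by rw [coord_smul_add he])
        conv_rhs => rw [hp, map_add, map_smul, map_smul]
        exact framedMap_apply _ _
      right_inv := fun z => Prod.ext (framedMap_apply_self he _) (framedMap_apply_rot he _) }

theorem evalEquiv_apply (he : ‖e‖ = 1) (A : P.HomPerp) :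
    evalEquiv he A = (A e, A (P.rot e)) := rfl

theorem evalEquiv_symm_apply (he : ‖e‖ = 1) (f : P.planeᗮ → P.planeᗮ) (y : P.planeᗮ) :
    (evalEquiv he).symm (y, f y) = P.framedMap e f y := by
  rw [ContinuousLinearEquiv.symm_apply_eq, evalEquiv_apply, framedMap_apply_self he,
    framedMap_apply_rot he]

/-- If the family `M` has the germ at `P` of the planes spanned by `e + y` and `P.rot e + φ y`, with
`φ` linear, then the lines through the origin in the graph of `φ` are curves in `M`. -/
theorem framedMap_mem_tangentVectors (he : ‖e‖ = 1) {φ : P.planeᗮ →L[ℝ] P.planeᗮ}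
    {M : Set (OrientedPlane n)} (h : ∀ᶠ y in nhds 0, P.graph (P.framedMap e φ y) ∈ M)
    (y : P.planeᗮ) : P.framedMap e φ y ∈ P.tangentVectors M := by
  have hsmul : ∀ t : ℝ, P.framedMap e φ (t • y) = t • P.framedMap e φ y := by
    intro t
    rw [← evalEquiv_symm_apply he φ, ← evalEquiv_symm_apply he φ, ← map_smul, Prod.smul_mk,
      map_smul φ]
  have ht : Filter.Tendsto (fun t : ℝ => t • y) (nhds 0) (nhds 0) :=
    Continuous.tendsto' (by fun_prop) _ _ (zero_smul _ _)
  obtain ⟨ε, hε, hball⟩ := Metric.eventually_nhds_iff.1 (ht.eventually h)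
  refine ⟨ε, hε, fun t => t • P.framedMap e φ y,
    (contDiff_smul_left (P.framedMap e φ y)).contDiffOn, zero_smul ℝ (P.framedMap e φ y),
    fun t ht => ?_, hasDerivAt_smul_left (P.framedMap e φ y)⟩
  change P.graph (t • P.framedMap e φ y) ∈ M
  rw [← hsmul]
  exact hball (y := t) (by rw [Real.dist_eq, sub_zero]; exact abs_lt.2 ht)

theorem eq_ofSlope_of_tangentVectors (he : ‖e‖ = 1) {φ : P.planeᗮ →L[ℝ] P.planeᗮ}
    {M : Set (OrientedPlane n)} (h : ∀ᶠ y in nhds 0, P.graph (P.framedMap e φ y) ∈ M)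
    {T : Gr (2 * n) P.HomPerp} (hT : (T.1 : Set P.HomPerp) = P.tangentVectors M) :
    T = Gr.ofSlope P.finrank_perp (evalEquiv he) φ := by
  refine Gr.eq_ofSlope fun y => ?_
  rw [evalEquiv_symm_apply, ← SetLike.mem_coe, hT]
  exact framedMap_mem_tangentVectors he h y

/-- In the chart given by evaluation at `e` and `P.rot e`, the tangent planes of the smooth
fibrations are the endomorphisms without real eigenvalues. -/
theorem fibrationTangentPlanes_eq (he : ‖e‖ = 1) :
    fibrationTangentPlanes P =
      Gr.ofSlope P.finrank_perp (evalEquiv he) '' {φ | NoRealEigenvalue φ} := by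
  apply Set.Subset.antisymm
  · rintro T ⟨M, hM, hP, hTM⟩
    obtain ⟨T', hT', hinj⟩ := exists_tangentSpace hM hP
    obtain rfl : T = T' := Subtype.ext (SetLike.coe_injective (hTM.trans hT'.symm))
    have he0 : e ≠ 0 := by rintro rfl; simp at he
    -- evaluation at `e` is injective on `T`, which is therefore a graph
    obtain ⟨φ, rfl⟩ := Gr.exists_eq_ofSlope (hk := P.finrank_perp) (ev := evalEquiv he) (T := T)
      fun A hA hAe => hinj A hA e he0 hAe
    refine ⟨φ, fun c y hy => ?_, rfl⟩
    have hA : P.framedMap e φ y ∈ (Gr.ofSlope P.finrank_perp (evalEquiv he) φ).1 := by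
      rw [Gr.mem_ofSlope, evalEquiv_apply, framedMap_apply_self he, framedMap_apply_rot he]
    have h2 : P.framedMap e φ y (P.rot e - c • e) = 0 := by
      rw [map_sub, map_smul, framedMap_apply_rot he, framedMap_apply_self he, hy, sub_self]
    have h3 : P.rot e - c • e ≠ 0 := by
      intro h3
      have h4 := coord_smul_add he (-c) 1
      rw [show (-c) • e + (1 : ℝ) • P.rot e = 0 by rw [← h3]; module, Submodule.coe_zero,
        map_zero] at h4
      exact zero_ne_one (congrArg Prod.snd h4)
    -- `A = (y, φ y)` is tangent and kills `P.rot e - c e`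
    rw [← framedMap_apply_self (f := φ) he y, hinj _ hA _ h3 h2, zero_apply]
  · rintro _ ⟨φ, hφ, rfl⟩
    obtain ⟨M, hM, hP, hMφ⟩ := exists_isGreatCircleFibration he hφ
    obtain ⟨T, hT, -⟩ := exists_tangentSpace hM hP
    exact ⟨M, hM, hP, eq_ofSlope_of_tangentVectors he hMφ hT ▸ hT⟩

/-- In the chart given by evaluation at `e` and `P.rot e`, the tangent planes of the Hopf fibrations
are the orthogonal complex structures. -/
theorem hopfTangentPlanes_eq (he : ‖e‖ = 1) :
    hopfTangentPlanes P =
      Gr.ofSlope P.finrank_perp (evalEquiv he) '' {φ | IsOrthComplex φ} := by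
  apply Set.Subset.antisymm
  · rintro T ⟨M, ⟨J, hJ, rfl⟩, hP, hT⟩
    have hJ' := isOrthComplex_of_isometry J hJ
    have hPJ : IsLine (J : Amb n →L[ℝ] Amb n) P := hP
    refine ⟨perpComplex hJ' hPJ, isOrthComplex_perpComplex hJ' hPJ,
      (eq_ofSlope_of_tangentVectors he ?_ hT).symm⟩
    exact Filter.Eventually.of_forall fun y =>
      isLine_graph_framedMap hJ' hPJ he (coe_perpComplex hJ' hPJ y)
  · rintro _ ⟨U, hU, rfl⟩
    have hJ := isOrthComplex_extendComplex (P := P) hU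
    have hM := isHopfFibration_isLine hJ
    have hP : P ∈ {Q | IsLine (P.extendComplex U) Q} := isLine_extendComplex U
    obtain ⟨T, hT, -⟩ := exists_tangentSpace hM.isGreatCircleFibration hP
    refine ⟨_, hM, hP, eq_ofSlope_of_tangentVectors he ?_ hT ▸ hT⟩
    refine Filter.Eventually.of_forall fun y =>
      isLine_graph_framedMap hJ hP he (extendComplex_perp U y).symm

end OrientedPlane

theorem theoremA (n : ℕ) (P : OrientedPlane n) :
    (∀ M : Set (OrientedPlane n), IsGreatCircleFibration M → P ∈ M →
      ∃ T : Gr (2 * n) P.HomPerp, (T.1 : Set P.HomPerp) = P.tangentVectors M) ∧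
    (∀ M : Set (OrientedPlane n), IsHopfFibration M → IsGreatCircleFibration M) ∧
    DeformationRetractsTo (fibrationTangentPlanes P) (hopfTangentPlanes P) := by
  refine ⟨fun M hM hP => ?_, fun M hM => hM.isGreatCircleFibration, ?_⟩
  · obtain ⟨T, hT, -⟩ := OrientedPlane.exists_tangentSpace hM hP
    exact ⟨T, hT⟩
  · obtain ⟨e, he⟩ := P.exists_norm_eq_one
    rw [OrientedPlane.fibrationTangentPlanes_eq he, OrientedPlane.hopfTangentPlanes_eq he]
    exact (deformationRetractsTo_isOrthComplex P.planeᗮ).image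
      Gr.isOpenEmbedding_ofSlope.isEmbedding
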